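/- **Setting.** Let $n,\mu\ge 1$ and $N,M\ge 0$ be integers, $a(0),\dots,a(N)\in\mathbb C$, and let $\rho_0=P_0,\rho_1,\dots,\rho_M$ be a strictly positive sequence of reals (the Toeplitz matrix $(\rho_{|i-j|})_{i,j=0}^M$ is positive definite). For a stochastic sequence $\xi=\{\xi(m)\}_{m\in\mathbb Z}$ put $\xi^{(n)}(m,s)=\sum_{l=0}^n(-1)^l\binom nl\xi(m-ls)$, $m,s\in\mathbb Z$. A nonnegative $f\in L_1(-\pi,\pi)$ is the spectral density of $\xi$ if the increments have mean zero and finite variance and $$E\,\xi^{(n)}(m_0+m,s_1)\overline{\xi^{(n)}(m_0,s_2)}=\frac1{2\pi}\int_{-\pi}^{\pi}e^{i\lambda m}(1-e^{-is_1\lambda})^n(1-e^{is_2\lambda})^n\frac{f(\lambda)}{\lambda^{2n}}\,d\lambda$$ for all integers $m_0,m,s_1,s_2$. Let $\sum_k d_\mu(k)x^k=(\sum_{j\ge0}x^{\mu j})^n$ and $b_{\mu,N}(k)=\sum_{m=k}^N a(m)d_\mu(m-k)$ (zero for $k>N$). The functional $A_N\xi=\sum_{k=0}^N a(k)\xi(k)$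 is estimated from $\xi(m)$, $m\le-1$, by $-\sum_{i=1}^{\mu n}v_{\mu,N}(-i)\xi(-i)$ plus an element of the closed linear span of $\{\xi^{(n)}(k,\mu):k\le-1\}$, where $v_{\mu,N}(-i)=\sum_{0\le l\le n,\ l\mu\ge i}(-1)^l\binom nl b_{\mu,N}(l\mu-i)$ (so that $A_N\xi+\sum_i v_{\mu,N}(-i)\xi(-i)=\sum_k b_{\mu,N}(k)\xi^{(n)}(k,\mu)$). Let $\Delta(f)$ be the least value of $E|A_N\xi-\hat A_N\xi|^2$ over these estimates when $\xi$ has spectral density $f$. A density $f_0\in D$ is *least favorable* in a class $D$ if $\Delta(f_0)=\max_{f\in D}\Delta(f)$. Let $$D_M=\Big\{f\ge0:\ \frac1{2\pi}\int_{-\pi}^{\pi}f(\lambda)\cos(m\lambda)\,d\lambda=\rho_m,\ m=0,\dots,M\Big\}.$$ A sequence $\varphi$ gives the *canonical factorization* of $f$ if $f(\lambda)=|\Phi(e^{-i\lambda})|^2$ a.e., where $\Phi(z)=\sum_{k\ge0}\varphi(k)z^k$ has radius of convergence $>1$ and no zeros in $|z|\le1$. Let $$w_\mu(z)=\sum_{k\ge0}w_\mu(k)z^k=\exp\Big\{\frac1{4\pi}\int_{-\pi}^{\pi}\frac{e^{i\lambda}+z}{e^{i\lambda}-z}\ln\frac{|1-e^{-i\lambda\mu}|^{2n}}{\lambda^{2n}}\,d\lambda\Big\},\quad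 |z|<1,$$ and define $(N+1)\times(N+1)$ matrices, indexed by $0,\dots,N$: $(D_N^\mu)_{k,j}=d_\mu(j-k)$ for $k\le j$; $(\hat D_N^\mu)_{k,l}=d_\mu(l+k-N)$ for $l+k\ge N$; $(A_N)_{k,j}=a(k+j)$ for $k+j\le N$; $(W_N^\mu)_{j,k}=w_\mu(j-k)$ for $k\le j$; all other entries are $0$. For a sequence $\varphi$ let $\varphi_N=(\varphi(0),\dots,\varphi(N))$ and $$\varphi_{\mu,N}=W_N^\mu\varphi_N.\tag{38}$$ * Let $S$ be the set of $\varphi_N\in\mathbb C^{N+1}$ with $\|\varphi_N\|^2=P_0$ which, for some $\alpha$ or $\beta$ in $\mathbb C$, satisfy $D_N^\mu A_NW_N^\mu\varphi_N=\alpha\overline{\varphi_N}$ (49) or $\hat D_N^\mu A_NW_N^\mu\varphi_N=\beta\overline{\varphi_N}$ (50), and which (extended by zero) give the canonical factorization of $$f^0(\lambda)=\Big|\sum_{k=0}^N\varphi(k)e^{-i\lambda k}\Big|^2\in D_M.\tag{41}$$ * Let $S^+$ be the set of triples $(\varphi,c,f)$ where $c_0,\dots,c_M\in\mathbb R$, $f\in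 D_M$, the sequence $\varphi$ gives the canonical factorization of $f$, $\|\varphi\|^2=\sum_k|\varphi(k)|^2=P_0$, and, for almost every $\lambda$, $$f(\lambda)=\frac{\big|c_0\sum_{k=0}^N(D_N^\mu A_N\varphi_{\mu,N})_ke^{i\lambda k}\big|^2}{\big|1+\sum_{k=1}^Mc_ke^{-i\lambda k}\big|^2}.\tag{53}$$ Let $\nu_0P_0$ and $\nu_0^+P_0$ be the suprema of $\|D_N^\mu A_NW_N^\mu\varphi_N\|^2$ over $S$ and over $S^+$ respectively ($0$ for an empty set). An *ARMA$(M,N)$ type representation* for $f$ with canonical factor $\Phi$ means: there are $\gamma_0=1,\gamma_1,\dots,\gamma_M,\theta_0,\dots,\theta_N\in\mathbb C$ such that $\sum_j\gamma_jz^j$ and $\sum_k\theta_kz^k$ have no zeros in $|z|\le1$, $\Phi(z)\sum_j\gamma_jz^j=\sum_k\theta_kz^k$ there, and for every $\xi$ with spectral density $f$ there is, on the same probability space, a sequence $\varepsilon$ with spectral density identically $1$ such that, for all integers $m,s$, almost surely $$\sum_{j=0}^M\gamma_j\,\xi^{(n)}(m-j,s)=\sum_{k=0}^N\theta_k\,\varepsilon^{(n)}(m-k,s).$$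 **Theorem 6.2.** 1. If $\varphi_N^0\in S$ and $\nu_0P_0=\nu_0^+P_0=\|D_N^\mu A_NW_N^\mu\varphi_N^0\|^2$, then the density (41) with $\varphi_N=\varphi^0_N$ is least favorable in $D_M$ for the optimal estimation of $A_N\xi$, and the ARMA$(M,N)$ type representation holds for it. 2. If $\nu_0<\nu_0^+$, then $S^+\neq\emptyset$, and for every $(\varphi,c,f)\in S^+$ the density $f$, of the form (53), is least favorable in $D_M$, $\|D_N^\mu A_NW_N^\mu\varphi_N\|^2=\nu_0^+P_0$, and the ARMA$(M,N)$ type representation holds for $f$. Moreover the parameters are determined as follows: whenever $\varphi$ gives the canonical factorization of $f$, * $f$ is least favorable in $D_M$ if and only if $(\varphi,c,f)\in S^+$ for some $c$, i.e. if and only if (38), (53) and the moment conditions $\int_{-\pi}^{\pi}f(\lambda)\cos(m\lambda)\,d\lambda=2\pi\rho_m$, $m=0,\dots,M$, hold with some $c_0,\dots,c_M$; * $f$ is least favorable in $D_M$ if and only if $f\in D_M$ and $\varphi$ solves the extremum problem (42): $\|D_N^\mu A_NW_N^\mu\psi_N\|^2\to\max$ over all square-summable $\psi$ with $\big|\sum_{k\ge0}\psi(k)e^{-i\lambda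 k}\big|^2\in D_M$. -/

import Mathlib

universe u

namespace RobustExtrapolation

open MeasureTheory

noncomputable section

/-! ### Sequences with stationary increments and their spectral densities -/

/-- The `n`th increment `ξ⁽ⁿ⁾(m, s) = ∑_{l=0}^{n} (-1)^l C(n,l) ξ(m - l s)` with step `s`. -/
def increment {Ω : Type u} (n : ℕ) (ξ : ℤ → Ω → ℂ) (m s : ℤ) (ω : Ω) : ℂ :=
  ∑ l ∈ Finset.range (n + 1), (-1 : ℂ) ^ l * (n.choose l : ℂ) * ξ (m - l * s) ω

/-- The frequency interval `(-π, π]`. -/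
def freq : Set ℝ := Set.Ioc (-Real.pi) Real.pi

/-- `e^{i x}`. -/
def cis (x : ℝ) : ℂ := Complex.exp (x * Complex.I)

/-- `ξ` is a stochastic sequence with zero-mean square-integrable stationary `n`th increments
whose spectral function is absolutely continuous with spectral density `f`
(with respect to `dλ / 2π`), i.e. whose structural function is
`E ξ⁽ⁿ⁾(m₀+m, s₁) conj ξ⁽ⁿ⁾(m₀, s₂)
  = (1/2π) ∫ e^{iλm} (1 - e^{-i s₁ λ})ⁿ (1 - e^{i s₂ λ})ⁿ λ^{-2n} f(λ) dλ`. -/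
structure HasSpectralDensity {Ω : Type u} [MeasurableSpace Ω] (n : ℕ) (P : Measure Ω)
    (ξ : ℤ → Ω → ℂ) (f : ℝ → ℝ) : Prop where
  measurable : ∀ m, AEStronglyMeasurable (ξ m) P
  memLp : ∀ m s, MemLp (increment n ξ m s) 2 P
  mean_zero : ∀ m s, ∫ ω, increment n ξ m s ω ∂P = 0
  structural : ∀ m₀ m s₁ s₂ : ℤ,
    ∫ ω, increment n ξ (m₀ + m) s₁ ω * star (increment n ξ m₀ s₂ ω) ∂P =
      (1 / (2 * Real.pi) : ℂ) * ∫ t in freq,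
        cis (m * t) * (1 - cis (-(s₁ * t))) ^ n * (1 - cis (s₂ * t)) ^ n / (t : ℂ) ^ (2 * n)
          * (f t : ℂ)

/-! ### The functional, its linear estimates and the mean square error -/

/-- `d_μ(k)`: the coefficients of `(∑_j x^{μ j})ⁿ`. -/
def dCoef (n μ k : ℕ) : ℂ :=
  PowerSeries.coeff k ((PowerSeries.mk fun j => if μ ∣ j then (1 : ℂ) else 0) ^ n)

/-- `b_{μ,N}(k) = ∑_{m=k}^{N} a(m) d_μ(m-k)`; it vanishes for `k > N`. -/
def bCoef (n μ N : ℕ) (a : ℕ → ℂ) (k : ℕ) : ℂ :=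
  ∑ m ∈ Finset.Icc k N, a m * dCoef n μ (m - k)

/-- `v_{μ,N}(-i) = ∑_l (-1)^l C(n,l) b_{μ,N}(l μ - i)`, the sum being over those `0 ≤ l ≤ n`
with `0 ≤ l μ - i` (and, since `b_{μ,N}` vanishes beyond `N`, `l μ - i ≤ N`). -/
def vCoef (n μ N : ℕ) (a : ℕ → ℂ) (i : ℕ) : ℂ :=
  ∑ l ∈ Finset.range (n + 1),
    if i ≤ l * μ then (-1 : ℂ) ^ l * (n.choose l : ℂ) * bCoef n μ N a (l * μ - i) else 0

/-- The functional `A_N ξ = ∑_{k=0}^{N} a(k) ξ(k)`. -/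
def functional {Ω : Type u} (N : ℕ) (a : ℕ → ℂ) (ξ : ℤ → Ω → ℂ) (ω : Ω) : ℂ :=
  ∑ k ∈ Finset.range (N + 1), a k * ξ k ω

/-- The linear estimates of `A_N ξ` from the observations `ξ(m)`, `m ≤ -1`:
`-∑_{k=-μn}^{-1} v_{μ,N}(k) ξ(k)` plus a finite linear combination of the observed increments
`ξ⁽ⁿ⁾(k, μ)`, `k ≤ -1` (`c j` is the weight of `k = -1 - j`). -/
def linearEstimate {Ω : Type u} (n μ N : ℕ) (a : ℕ → ℂ) (ξ : ℤ → Ω → ℂ) (c : ℕ →₀ ℂ)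
    (ω : Ω) : ℂ :=
  -(∑ i ∈ Finset.Icc 1 (μ * n), vCoef n μ N a i * ξ (-(i : ℤ)) ω)
    + c.sum fun j x => x * increment n ξ (-1 - (j : ℤ)) μ ω

/-- The mean square error `E |A_N ξ - Â_N ξ|²` of the optimal linear estimate `Â_N ξ`.
The infimum over finite linear combinations is the minimum over their mean square limits. -/
def optimalError {Ω : Type u} [MeasurableSpace Ω] (n μ N : ℕ) (a : ℕ → ℂ) (P : Measure Ω)
    (ξ : ℤ → Ω → ℂ) : ℝ :=
  ⨅ c : ℕ →₀ ℂ, ∫ ω, ‖functional N a ξ ω - linearEstimate n μ N a ξ c ω‖ ^ 2 ∂P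

/-- `f₀ ∈ D` is least favorable in the class `D` for the optimal linear estimation of `A_N ξ`:
the error of the optimal estimate is, over all densities in `D`, the largest at `f₀`. -/
def IsLeastFavorable (n μ N : ℕ) (a : ℕ → ℂ) (D : Set (ℝ → ℝ)) (f₀ : ℝ → ℝ) : Prop :=
  f₀ ∈ D ∧ ∀ f ∈ D,
    ∀ (Ω₀ Ω : Type u) [MeasurableSpace Ω₀] [MeasurableSpace Ω]
      (P₀ : Measure Ω₀) (P : Measure Ω) [IsProbabilityMeasure P₀] [IsProbabilityMeasure P]
      (ξ₀ : ℤ → Ω₀ → ℂ) (ξ : ℤ → Ω → ℂ),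
      HasSpectralDensity n P₀ ξ₀ f₀ → HasSpectralDensity n P ξ f →
        optimalError n μ N a P ξ ≤ optimalError n μ N a P₀ ξ₀

/-! ### The class `D_M` -/

/-- `ρ_0, …, ρ_M` is strictly positive: the Toeplitz matrix `(ρ_{|i-j|})` is positive definite. -/
def StrictlyPositive (M : ℕ) (ρ : ℕ → ℝ) : Prop :=
  (Matrix.of fun i j : Fin (M + 1) => ρ ((i : ℤ) - (j : ℤ)).natAbs).PosDef

/-- The spectral densities with `(1/2π) ∫ f(λ) cos(mλ) dλ = ρ_m`, `m = 0, …, M`. -/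
def momentClass (M : ℕ) (ρ : ℕ → ℝ) : Set (ℝ → ℝ) :=
  {f | IntegrableOn f freq ∧ (∀ᵐ t ∂volume.restrict freq, 0 ≤ f t) ∧
    ∀ m ≤ M, (1 / (2 * Real.pi)) * ∫ t in freq, f t * Real.cos (m * t) = ρ m}

/-! ### Factorizations -/

/-- The canonical factorization `f(λ) = |Φ(e^{-iλ})|²`, `Φ(z) = ∑ φ(k) z^k`, with radius of
convergence greater than one and no zeros in the closed unit disk. -/
structure IsCanonicalFactor (φ : ℕ → ℂ) (f : ℝ → ℝ) : Prop where
  radius : ∃ r : ℝ, 1 < r ∧ Summable fun k => ‖φ k‖ * r ^ k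
  zero_free : ∀ z : ℂ, ‖z‖ ≤ 1 → ∑' k, φ k * z ^ k ≠ 0
  density : ∀ᵐ t ∂volume.restrict freq, f t = ‖∑' k, φ k * cis (-t) ^ k‖ ^ 2

/-- `f(λ) = |∑_k φ(k) e^{-iλk}|²` with `φ` square summable, the series being the Fourier series
of a square-integrable function `g`; no condition on zeros. -/
def IsFactor (φ : ℕ → ℂ) (f : ℝ → ℝ) : Prop :=
  ∃ g : ℝ → ℂ, MemLp g 2 (volume.restrict freq) ∧
    (∀ k : ℤ, (1 / (2 * Real.pi) : ℂ) * ∫ t in freq, g t * cis (k * t) =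
      if 0 ≤ k then φ k.toNat else 0) ∧
    ∀ᵐ t ∂volume.restrict freq, f t = ‖g t‖ ^ 2

/-- `w_μ(z) = exp {(1/4π) ∫ (e^{iλ}+z)/(e^{iλ}-z) ln(|1-e^{-iλμ}|^{2n} / λ^{2n}) dλ}`, `|z| < 1`. -/
def wFun (n μ : ℕ) (z : ℂ) : ℂ :=
  Complex.exp ((1 / (4 * Real.pi) : ℂ) * ∫ t in freq,
    (cis t + z) / (cis t - z)
      * (Real.log (‖1 - cis (-(t * μ))‖ ^ (2 * n) / t ^ (2 * n)) : ℂ))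

/-- The Taylor coefficients `w_μ(k)` of `w_μ(z) = ∑ w_μ(k) z^k`. -/
def wCoef (n μ k : ℕ) : ℂ := iteratedDeriv k (wFun n μ) 0 / (k.factorial : ℂ)

/-! ### The matrices -/

/-- `D_N^μ`. -/
def matD (n μ N : ℕ) : Matrix (Fin (N + 1)) (Fin (N + 1)) ℂ :=
  Matrix.of fun k j => if k ≤ j then dCoef n μ ((j : ℕ) - k) else 0

/-- The matrix `D̂_N^μ`, with entries `d_μ(l + k - N)` for `l ≥ N - k` and `0` otherwise. -/
def matDhat (n μ N : ℕ) : Matrix (Fin (N + 1)) (Fin (N + 1)) ℂ :=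
  Matrix.of fun k l => if N ≤ (l : ℕ) + k then dCoef n μ ((l : ℕ) + k - N) else 0

/-- `A_N`. -/
def matA (N : ℕ) (a : ℕ → ℂ) : Matrix (Fin (N + 1)) (Fin (N + 1)) ℂ :=
  Matrix.of fun k j => if (k : ℕ) + j ≤ N then a ((k : ℕ) + j) else 0

/-- `W_N^μ`. -/
def matW (n μ N : ℕ) : Matrix (Fin (N + 1)) (Fin (N + 1)) ℂ :=
  Matrix.of fun j k => if k ≤ j then wCoef n μ ((j : ℕ) - k) else 0

/-- `φ_{μ,N} = W_N^μ φ_N`. -/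
def phiMu (n μ N : ℕ) (φ : Fin (N + 1) → ℂ) : Fin (N + 1) → ℂ := (matW n μ N).mulVec φ

/-- The coefficients `D_N^μ A_N φ_{μ,N}` of `r_{μ,N}`. -/
def rVec (n μ N : ℕ) (a : ℕ → ℂ) (φμ : Fin (N + 1) → ℂ) : Fin (N + 1) → ℂ :=
  (matD n μ N * matA N a).mulVec φμ

/-- `‖D_N^μ A_N W_N^μ φ_N‖²`. -/
def objective (n μ N : ℕ) (a : ℕ → ℂ) (φ : Fin (N + 1) → ℂ) : ℝ :=
  ∑ k, ‖rVec n μ N a (phiMu n μ N φ) k‖ ^ 2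

/-- The first `N + 1` terms `φ_N` of a sequence. -/
def truncate (N : ℕ) (φ : ℕ → ℂ) : Fin (N + 1) → ℂ := fun k => φ k

/-- The extension of a finite vector by zero. -/
def extend (N : ℕ) (φ : Fin (N + 1) → ℂ) : ℕ → ℂ :=
  fun k => if h : k < N + 1 then φ ⟨k, h⟩ else 0

/-- `φ` solves the extremum problem
`‖D_N^μ A_N φ_{μ,N}‖² → max`, `f(λ) = |∑ φ(k) e^{-iλk}|² ∈ D`. -/
def IsExtremal (n μ N : ℕ) (a : ℕ → ℂ) (D : Set (ℝ → ℝ)) (φ : ℕ → ℂ) : Prop :=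
  (∃ f ∈ D, IsFactor φ f) ∧
    ∀ ψ : ℕ → ℂ, ∀ g ∈ D, IsFactor ψ g →
      objective n μ N a (truncate N ψ) ≤ objective n μ N a (truncate N φ)

/-! ### The two candidates and the constants `ν₀`, `ν₀⁺` -/

/-- The moving average density `|∑_{k=0}^{N} φ(k) e^{-iλk}|²`. -/
def maDensity (N : ℕ) (φ : Fin (N + 1) → ℂ) (t : ℝ) : ℝ :=
  ‖∑ k : Fin (N + 1), φ k * cis (-t) ^ (k : ℕ)‖ ^ 2

/-- The rational density
`|c_0 ∑_{k=0}^{N} (D_N^μ A_N φ_{μ,N})_k e^{iλk}|² / |1 + ∑_{k=1}^{M} c_k e^{-iλk}|²`. -/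
def rationalDensity (n μ N M : ℕ) (a : ℕ → ℂ) (φμ : Fin (N + 1) → ℂ) (c : ℕ → ℝ) (t : ℝ) : ℝ :=
  ‖(c 0 : ℂ) * ∑ k : Fin (N + 1), rVec n μ N a φμ k * cis t ^ (k : ℕ)‖ ^ 2
    / ‖1 + ∑ k ∈ Finset.Icc 1 M, (c k : ℂ) * cis (-t) ^ k‖ ^ 2

/-- `φ_N` solves `D_N^μ A_N W_N^μ φ_N = α conj φ_N` or `D̂_N^μ A_N W_N^μ φ_N = β conj φ_N`,
has `‖φ_N‖² = ρ_0`, and gives the canonical factorization of its moving average density,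
which belongs to `D_M`. -/
structure IsMASolution (n μ N M : ℕ) (a : ℕ → ℂ) (ρ : ℕ → ℝ) (φ : Fin (N + 1) → ℂ) : Prop where
  equation :
    (∃ α : ℂ, (matD n μ N * matA N a * matW n μ N).mulVec φ = α • star φ) ∨
    (∃ β : ℂ, (matDhat n μ N * matA N a * matW n μ N).mulVec φ = β • star φ)
  norm_sq : ∑ k, ‖φ k‖ ^ 2 = ρ 0
  canonical : IsCanonicalFactor (extend N φ) (maDensity N φ)
  mem : maDensity N φ ∈ momentClass M ρ

/-- The density `f ∈ D_M` is the rational density with real parameters `c_0, …, c_M` and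
`φ_{μ,N} = W_N^μ φ_N`, where `φ` gives the canonical factorization of `f` and `‖φ‖² = ρ_0`. -/
structure IsRationalSolution (n μ N M : ℕ) (a : ℕ → ℂ) (ρ : ℕ → ℝ) (φ : ℕ → ℂ) (c : ℕ → ℝ)
    (f : ℝ → ℝ) : Prop where
  form : ∀ᵐ t ∂volume.restrict freq,
    f t = rationalDensity n μ N M a (phiMu n μ N (truncate N φ)) c t
  norm_sq : HasSum (fun k => ‖φ k‖ ^ 2) (ρ 0)
  canonical : IsCanonicalFactor φ f
  mem : f ∈ momentClass M ρ

/-- `ν₀`, where `ν₀ P₀` is the greatest value of the objective over the moving average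
solutions. (The values lie in a bounded set of nonnegative numbers; `0` if there are none.) -/
def nuMA (n μ N M : ℕ) (a : ℕ → ℂ) (ρ : ℕ → ℝ) : ℝ :=
  sSup {v | ∃ φ, IsMASolution n μ N M a ρ φ ∧ v = objective n μ N a φ} / ρ 0

/-- `ν₀⁺`, where `ν₀⁺ P₀` is the greatest value of the objective over the rational solutions.
(The values lie in a bounded set of nonnegative numbers; `0` if there are none.) -/
def nuRational (n μ N M : ℕ) (a : ℕ → ℂ) (ρ : ℕ → ℝ) : ℝ :=
  sSup {v | ∃ φ c f, IsRationalSolution n μ N M a ρ φ c f ∧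
    v = objective n μ N a (truncate N φ)} / ρ 0

/-! ### Autoregressive moving average representation -/

/-- Every sequence `ξ` with spectral density `f(λ) = |Φ(e^{-iλ})|²`, `Φ(z) = ∑ φ(k) z^k`, admits
an autoregressive moving average representation of order `(M, N)` of its increments,
`∑_{j=0}^{M} γ_j ξ⁽ⁿ⁾(m-j, s) = ∑_{k=0}^{N} θ_k ε⁽ⁿ⁾(m-k, s)` almost surely,
driven by the `n`th increments of a sequence `ε` with spectral density identically one;
here `γ_0 = 1`, `Φ(z) = (∑ θ_k z^k) / (∑ γ_j z^j)`, and neither polynomial has a zero in the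
closed unit disk. -/
def HasARMARepresentation (n M N : ℕ) (φ : ℕ → ℂ) (f : ℝ → ℝ) : Prop :=
  ∃ (γ : Fin (M + 1) → ℂ) (θ : Fin (N + 1) → ℂ), γ 0 = 1 ∧
    (∀ z : ℂ, ‖z‖ ≤ 1 →
      ∑ j, γ j * z ^ (j : ℕ) ≠ 0 ∧ ∑ k, θ k * z ^ (k : ℕ) ≠ 0 ∧
      (∑' k, φ k * z ^ k) * ∑ j, γ j * z ^ (j : ℕ) = ∑ k, θ k * z ^ (k : ℕ)) ∧
    ∀ (Ω : Type u) [MeasurableSpace Ω] (P : Measure Ω) [IsProbabilityMeasure P]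
      (ξ : ℤ → Ω → ℂ), HasSpectralDensity n P ξ f →
      ∃ ε : ℤ → Ω → ℂ, HasSpectralDensity n P ε (fun _ => 1) ∧
        ∀ m s : ℤ, ∀ᵐ ω ∂P,
          ∑ j : Fin (M + 1), γ j * increment n ξ (m - (j : ℕ)) s ω =
            ∑ k : Fin (N + 1), θ k * increment n ε (m - (k : ℕ)) s ω

end

end RobustExtrapolation

/-! In the spectral domain the error of an estimate with weights `c` is the mean of `|E_c|² |w_μ|²
f`, where `E_c = ∑ b(k) e^{ikt} - ∑ c_j e^{-i(j+1)t}`. Only the negative frequencies of `E_c` can be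
chosen. If `f = |g|²` with `g` carrying only the frequencies `e^{-ikt}`, `k ≥ 0`, then the
coefficients of `E_c w_μ g` at `e^{ijt}`, `0 ≤ j ≤ N`, do not depend on `c`: they form the vector `D
A W φ`. By Pythagoras the objective at `φ` is a lower bound for every error
(`objective_le_spectralError`). If `φ` is canonical with sum `Φ`, and `R` is the polynomial with
coefficients `D A W φ`, suitable `E_c w_μ` converge boundedly to `R / Φ` (`exists_tendsto_errPoly`),
so the bound is the optimal error.

The minimax step is a saddle point. For a triple in `S⁺` the form (53) says `|R / Φ|² = |1 + ∑ c_k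
e^{-ikt}|² / c_0²`, a trigonometric polynomial of degree at most `M` determined by real parameters.
The error under `f'` of the limiting estimate for `f` is the mean of `|R / Φ|² f'`, and this depends
only on the moments `ρ_0, …, ρ_M`. It is therefore the same for all `f'` in `D_M`, and no density of
the class has a larger optimal error than `f` (`IsRationalSolution.iInf_spectralError_le`). Hence
all triples of `S⁺` share one value of the objective, which is `ν₀⁺ P₀`. Conversely, if a canonical
`φ'` reaches that value, equality in Pythagoras forces `R' / Φ' = R / Φ`, so its density has the
form (53) with the same `c` (`IsRationalSolution.of_objective_eq`).

If `ν₀ < ν₀⁺`, then `S⁺` is nonempty because `ν₀ ≥ 0`, and all the equivalences are read off from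
one triple. In the moving average case there are two possibilities. Either `S⁺` is nonempty and its
common value bounds the errors over the class; or it is empty, `ν₀⁺ = 0`, the objective vanishes,
all `b(k)` vanish because `w_μ Φ` is invertible as a formal series, and every density gives error
zero.

For the ARMA representation, `Φ` has the modulus of a quotient of polynomials on the circle.
Cancelling common zeros on the circle, reflecting the zeros inside and applying the maximum
principle makes `Φ` itself a zero-free quotient `θ / γ`. Filtering `ξ` by the geometrically decaying
coefficients of `1 / Φ` gives `ε`. -/

namespace RobustExtrapolation

open MeasureTheory Filter Topology

noncomputable section

/-! ### Power series with absolutely summable coefficients -/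

/-- The coefficients of the power series are absolutely summable. -/
def AbsSummable (p : PowerSeries ℂ) : Prop := Summable fun k => ‖PowerSeries.coeff k p‖

lemma AbsSummable.summable {p : PowerSeries ℂ} (hp : AbsSummable p) :
    Summable fun k => ‖PowerSeries.coeff k p‖ := hp

/-- The sum of a power series at a point. -/
def ev (p : PowerSeries ℂ) (z : ℂ) : ℂ := ∑' k, PowerSeries.coeff k p * z ^ k

/-- The `ℓ¹` norm of the coefficients. -/
def coeffNorm (p : PowerSeries ℂ) : ℝ := ∑' k, ‖PowerSeries.coeff k p‖

lemma coeffNorm_nonneg (p : PowerSeries ℂ) : 0 ≤ coeffNorm p := tsum_nonneg fun _ => norm_nonneg _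

lemma norm_term_le (p : PowerSeries ℂ) {z : ℂ} (hz : ‖z‖ ≤ 1) (k : ℕ) :
    ‖PowerSeries.coeff k p * z ^ k‖ ≤ ‖PowerSeries.coeff k p‖ := by
  rw [norm_mul, norm_pow]
  exact mul_le_of_le_one_right (norm_nonneg _) (pow_le_one₀ (norm_nonneg _) hz)

lemma AbsSummable.norm_term {p : PowerSeries ℂ} (hp : AbsSummable p) {z : ℂ} (hz : ‖z‖ ≤ 1) :
    Summable fun k => ‖PowerSeries.coeff k p * z ^ k‖ :=
  Summable.of_nonneg_of_le (fun _ => norm_nonneg _) (norm_term_le p hz) hp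

lemma AbsSummable.hasSum_ev {p : PowerSeries ℂ} (hp : AbsSummable p) {z : ℂ} (hz : ‖z‖ ≤ 1) :
    HasSum (fun k => PowerSeries.coeff k p * z ^ k) (ev p z) :=
  (hp.norm_term hz).of_norm.hasSum

lemma AbsSummable.norm_ev_le {p : PowerSeries ℂ} (hp : AbsSummable p) {z : ℂ} (hz : ‖z‖ ≤ 1) :
    ‖ev p z‖ ≤ coeffNorm p :=
  (norm_tsum_le_tsum_norm (hp.norm_term hz)).trans
    ((hp.norm_term hz).tsum_le_tsum (norm_term_le p hz) hp)

lemma absSummable_of_finite (p : PowerSeries ℂ) (d : ℕ)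
    (h : ∀ k, d < k → PowerSeries.coeff k p = 0) : AbsSummable p :=
  summable_of_ne_finset_zero (s := Finset.range (d + 1)) fun k hk => by
    rw [h k (by simpa using hk), norm_zero]

lemma absSummable_coe (p : Polynomial ℂ) : AbsSummable (p : PowerSeries ℂ) :=
  absSummable_of_finite _ p.natDegree fun k hk => by
    simpa using Polynomial.coeff_eq_zero_of_natDegree_lt hk

lemma ev_coe (p : Polynomial ℂ) (z : ℂ) : ev (p : PowerSeries ℂ) z = p.eval z := by
  rw [ev, Polynomial.eval_eq_sum_range, tsum_eq_sum (s := Finset.range (p.natDegree + 1))]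
  · simp
  · intro k hk
    have : p.coeff k = 0 := Polynomial.coeff_eq_zero_of_natDegree_lt (by simpa using hk)
    simp [this]

lemma absSummable_one : AbsSummable 1 := by
  simpa using absSummable_coe 1

lemma ev_one (z : ℂ) : ev 1 z = 1 := by
  simpa using ev_coe 1 z

lemma AbsSummable.mul {p q : PowerSeries ℂ} (hp : AbsSummable p) (hq : AbsSummable q) :
    AbsSummable (p * q) := by
  refine (summable_norm_sum_mul_antidiagonal_of_summable_norm
    (f := fun k => PowerSeries.coeff k p) (g := fun k => PowerSeries.coeff k q) hp hq).congr
    fun k => ?_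
  rw [PowerSeries.coeff_mul]

lemma ev_mul_of_summable {p q : PowerSeries ℂ} {z : ℂ}
    (hp : Summable fun k => ‖PowerSeries.coeff k p * z ^ k‖)
    (hq : Summable fun k => ‖PowerSeries.coeff k q * z ^ k‖) :
    ev (p * q) z = ev p z * ev q z := by
  rw [ev, ev, ev, tsum_mul_tsum_eq_tsum_sum_antidiagonal_of_summable_norm hp hq]
  refine tsum_congr fun k => ?_
  rw [PowerSeries.coeff_mul, Finset.sum_mul]
  refine Finset.sum_congr rfl fun x hx => ?_
  rw [← Finset.HasAntidiagonal.mem_antidiagonal.1 hx, pow_add]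
  ring

lemma AbsSummable.ev_mul {p q : PowerSeries ℂ} (hp : AbsSummable p) (hq : AbsSummable q) {z : ℂ}
    (hz : ‖z‖ ≤ 1) : ev (p * q) z = ev p z * ev q z :=
  ev_mul_of_summable (hp.norm_term hz) (hq.norm_term hz)

lemma coeffNorm_mul_le {p q : PowerSeries ℂ} (hp : AbsSummable p) (hq : AbsSummable q) :
    coeffNorm (p * q) ≤ coeffNorm p * coeffNorm q := by
  have hp' : Summable fun k => ‖‖PowerSeries.coeff k p‖‖ := Summable.norm hp
  have hq' : Summable fun k => ‖‖PowerSeries.coeff k q‖‖ := Summable.norm hq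
  rw [coeffNorm, coeffNorm, coeffNorm,
    tsum_mul_tsum_eq_tsum_sum_antidiagonal_of_summable_norm hp' hq']
  refine (hp.mul hq).tsum_le_tsum (fun k => ?_) ?_
  · rw [PowerSeries.coeff_mul]
    exact (norm_sum_le _ _).trans (Finset.sum_le_sum fun x _ => (norm_mul _ _).le)
  · have := summable_norm_sum_mul_antidiagonal_of_summable_norm hp' hq'
    exact this.of_norm

lemma AbsSummable.pow {p : PowerSeries ℂ} (hp : AbsSummable p) (j : ℕ) : AbsSummable (p ^ j) := by
  induction j with
  | zero => simpa using absSummable_one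
  | succ j ih => rw [pow_succ]; exact ih.mul hp

lemma AbsSummable.ev_pow {p : PowerSeries ℂ} (hp : AbsSummable p) (j : ℕ) {z : ℂ}
    (hz : ‖z‖ ≤ 1) : ev (p ^ j) z = ev p z ^ j := by
  induction j with
  | zero => simp [ev_one]
  | succ j ih => rw [pow_succ, (hp.pow j).ev_mul hp hz, ih, pow_succ]

lemma coeffNorm_pow_le {p : PowerSeries ℂ} (hp : AbsSummable p) (j : ℕ) :
    coeffNorm (p ^ j) ≤ coeffNorm p ^ j := by
  induction j with
  | zero =>
    rw [pow_zero, pow_zero, coeffNorm, tsum_eq_single 0]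
    · simp
    · intro k hk
      simp [PowerSeries.coeff_one, hk]
  | succ j ih =>
    rw [pow_succ, pow_succ]
    exact (coeffNorm_mul_le (hp.pow j) hp).trans
      (mul_le_mul_of_nonneg_right ih (coeffNorm_nonneg p))

lemma AbsSummable.neg {p : PowerSeries ℂ} (hp : AbsSummable p) : AbsSummable (-p) := by
  simpa [AbsSummable] using hp

lemma ev_neg (p : PowerSeries ℂ) (z : ℂ) : ev (-p) z = -ev p z := by
  simp [ev, tsum_neg]

lemma tsum_comm_of_summable (g : ℕ → ℕ → ℂ) (h : Summable fun x : ℕ × ℕ => g x.1 x.2) :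
    ∑' k, ∑' j, g k j = ∑' j, ∑' k, g k j :=
  (Summable.tsum_comm (f := g) h).symm

/-- The exponential of an absolutely summable power series. -/
lemma AbsSummable.exists_exp {u : PowerSeries ℂ} (hu : AbsSummable u) :
    ∃ v, AbsSummable v ∧ ∀ z : ℂ, ‖z‖ ≤ 1 → ev v z = Complex.exp (ev u z) := by
  -- The coefficient norm of `u ^ j` is at most the `j`th power of that of `u`, so the double series
  -- of all coefficients is dominated by the exponential series; this licenses the exchange of sums
  -- below.
  have hS : Summable fun x : ℕ × ℕ =>
      ‖PowerSeries.coeff x.2 (u ^ x.1) / (x.1.factorial : ℂ)‖ := by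
    refine (summable_prod_of_nonneg fun _ => norm_nonneg _).2 ⟨fun j => ?_, ?_⟩
    · simp only [norm_div]
      exact (hu.pow j).div_const _
    · refine Summable.of_nonneg_of_le (fun j => tsum_nonneg fun _ => norm_nonneg _) (fun j => ?_)
        (Real.summable_pow_div_factorial (coeffNorm u))
      simp only [norm_div]
      rw [tsum_div_const, Complex.norm_natCast]
      gcongr
      exact coeffNorm_pow_le hu j
  have hS' : Summable fun x : ℕ × ℕ =>
      ‖PowerSeries.coeff x.1 (u ^ x.2) / (x.2.factorial : ℂ)‖ :=
    hS.comp_injective (i := Prod.swap) Prod.swap_injective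
  refine ⟨PowerSeries.mk fun k => ∑' j, PowerSeries.coeff k (u ^ j) / (j.factorial : ℂ), ?_, ?_⟩
  · refine Summable.of_nonneg_of_le (fun _ => norm_nonneg _) (fun k => ?_) hS'.prod
    rw [PowerSeries.coeff_mk]
    exact norm_tsum_le_tsum_norm (hS'.prod_factor k)
  · intro z hz
    have h1 : Summable fun x : ℕ × ℕ =>
        PowerSeries.coeff x.1 (u ^ x.2) / (x.2.factorial : ℂ) * z ^ x.1 := by
      refine Summable.of_norm_bounded hS' fun x => ?_
      rw [norm_mul, norm_pow]
      exact mul_le_of_le_one_right (norm_nonneg _) (pow_le_one₀ (norm_nonneg _) hz)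
    have h2 : ev (PowerSeries.mk fun k => ∑' j, PowerSeries.coeff k (u ^ j) / (j.factorial : ℂ)) z
        = ∑' k, ∑' j, PowerSeries.coeff k (u ^ j) / (j.factorial : ℂ) * z ^ k := by
      rw [ev]
      refine tsum_congr fun k => ?_
      rw [PowerSeries.coeff_mk, tsum_mul_right]
    have h3 : ∑' k, ∑' j, PowerSeries.coeff k (u ^ j) / (j.factorial : ℂ) * z ^ k
        = ∑' j, ∑' k, PowerSeries.coeff k (u ^ j) / (j.factorial : ℂ) * z ^ k :=
      tsum_comm_of_summable (fun k j => PowerSeries.coeff k (u ^ j) / (j.factorial : ℂ) * z ^ k) h1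
    rw [h2, h3, Complex.exp_eq_exp_ℂ, NormedSpace.exp_eq_tsum_div]
    refine tsum_congr fun j => ?_
    rw [← hu.ev_pow j hz, ev, ← tsum_div_const]
    exact tsum_congr fun k => by ring

/-! ### Coefficients and local behaviour -/

lemma hasFPowerSeriesAt_ev {p : PowerSeries ℂ} {r : ℝ} (hr : 0 < r)
    (hp : Summable fun k => ‖PowerSeries.coeff k p‖ * r ^ k) :
    HasFPowerSeriesOnBall (ev p)
      (FormalMultilinearSeries.ofScalars ℂ fun k => PowerSeries.coeff k p) 0 (ENNReal.ofReal r) := by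
  have hle : ENNReal.ofReal r ≤
      (FormalMultilinearSeries.ofScalars ℂ fun k => PowerSeries.coeff k p).radius := by
    rw [ENNReal.ofReal]
    refine FormalMultilinearSeries.le_radius_of_summable _ ?_
    simpa [FormalMultilinearSeries.ofScalars_norm, hr.le] using hp
  have hpos : 0 < ENNReal.ofReal r := by simpa using hr
  have h := (FormalMultilinearSeries.hasFPowerSeriesOnBall _ (hpos.trans_le hle)).mono hpos hle
  refine h.congr fun z _ => ?_
  have := FormalMultilinearSeries.ofScalars_sum_eq (𝕜 := ℂ) (E := ℂ)
    (fun k => PowerSeries.coeff k p) z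
  rw [FormalMultilinearSeries.ofScalarsSum] at this
  rw [this, ev]
  rfl

lemma analyticAt_ev {p : PowerSeries ℂ} {r : ℝ} (hr : 0 < r)
    (hp : Summable fun k => ‖PowerSeries.coeff k p‖ * r ^ k) {z : ℂ} (hz : ‖z‖ < r) :
    AnalyticAt ℂ (ev p) z :=
  (hasFPowerSeriesAt_ev hr hp).analyticAt_of_mem (by
    rw [Metric.eball_ofReal]; simpa using hz)

/-- The coefficients of an absolutely summable series are the Taylor coefficients of its sum. -/
lemma AbsSummable.coeff_eq {p : PowerSeries ℂ} (hp : AbsSummable p) {F : ℂ → ℂ}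
    (hF : F =ᶠ[𝓝 0] ev p) (k : ℕ) :
    PowerSeries.coeff k p = iteratedDeriv k F 0 / (k.factorial : ℂ) := by
  have h1 := ((hasFPowerSeriesAt_ev (p := p) one_pos (by simpa using hp.summable)).hasFPowerSeriesAt).congr
    hF.symm
  have h2 := h1.analyticAt.hasFPowerSeriesAt
  have h3 := FormalMultilinearSeries.ofScalars_series_injective ℂ ℂ
    (h1.eq_formalMultilinearSeries h2)
  exact congrFun h3 k

/-- Both coefficient sequences are the Taylor coefficients at `0` of the same germ. This turns
identities between functions in the disk into identities between formal series. -/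
lemma AbsSummable.eq_of_ev {p q : PowerSeries ℂ} (hp : AbsSummable p) (hq : AbsSummable q)
    (h : ∀ z : ℂ, ‖z‖ < 1 → ev p z = ev q z) : p = q := by
  ext k
  have h1 : ev p =ᶠ[𝓝 0] ev q := by
    filter_upwards [Metric.ball_mem_nhds (0 : ℂ) one_pos] with z hz
    exact h z (by simpa using hz)
  rw [hp.coeff_eq EventuallyEq.rfl, hq.coeff_eq h1]

lemma AbsSummable.continuousOn {p : PowerSeries ℂ} (hp : AbsSummable p) :
    ContinuousOn (ev p) (Metric.closedBall 0 1) := by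
  refine continuousOn_tsum (fun k => by fun_prop) hp fun k z hz => norm_term_le p (by simpa using hz) k

/-! ### Taylor expansion and inversion beyond the closed unit disk -/

/-- The Taylor series of a function which is holomorphic in a disk of radius greater than one. -/
lemma exists_taylorSeries {F : ℂ → ℂ} {δ : ℝ} (hδ : 1 < δ)
    (hdiff : DifferentiableOn ℂ F (Metric.ball 0 δ)) :
    ∃ q : PowerSeries ℂ, AbsSummable q ∧ (∀ z : ℂ, ‖z‖ < δ → ev q z = F z) ∧
      ∃ r : ℝ, 1 < r ∧ Summable fun k => ‖PowerSeries.coeff k q‖ * r ^ k := by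
  set q : PowerSeries ℂ :=
    PowerSeries.mk fun k => iteratedDeriv k F 0 / (k.factorial : ℂ) with hq
  have hT : ∀ z : ℂ, ‖z‖ < δ →
      HasSum (fun k => PowerSeries.coeff k q * z ^ k) (F z) := by
    intro z hz
    have h := Complex.hasSum_taylorSeries_on_ball hdiff (z := z) (by simpa using hz)
    have h2 : (fun k => PowerSeries.coeff k q * z ^ k) = fun k =>
        ((k.factorial : ℂ))⁻¹ • (z - 0) ^ k • iteratedDeriv k F 0 := by
      funext k
      rw [hq, PowerSeries.coeff_mk, sub_zero, smul_eq_mul, smul_eq_mul]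
      ring
    rw [h2]
    exact h
  have hsum : Summable fun k => ‖PowerSeries.coeff k q‖ * ((1 + δ) / 2) ^ k := by
    have h1 := (hT (((1 + δ) / 2 : ℝ) : ℂ) (by
      rw [Complex.norm_real, Real.norm_of_nonneg (by linarith)]; linarith)).summable.norm
    refine h1.congr fun k => ?_
    rw [norm_mul, norm_pow, Complex.norm_real, Real.norm_of_nonneg (by linarith)]
  have hqabs : AbsSummable q := by
    refine Summable.of_nonneg_of_le (fun _ => norm_nonneg _) (fun k => ?_) hsum
    exact le_mul_of_one_le_right (norm_nonneg _) (one_le_pow₀ (by linarith))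
  exact ⟨q, hqabs, fun z hz => (hT z hz).tsum_eq, (1 + δ) / 2, by linarith, hsum⟩

lemma coeff_zero_eq_ev (p : PowerSeries ℂ) : PowerSeries.coeff 0 p = ev p 0 := by
  rw [ev, tsum_eq_single 0 fun k hk => by simp [hk]]
  simp

/-- An absolutely summable series with coefficients summable against `r ^ k`, `r > 1`, and without
zeros in the closed unit disk has an inverse of the same kind. -/
lemma exists_inverse {p : PowerSeries ℂ} {r : ℝ} (hr : 1 < r)
    (hp : Summable fun k => ‖PowerSeries.coeff k p‖ * r ^ k)
    (h0 : ∀ z : ℂ, ‖z‖ ≤ 1 → ev p z ≠ 0) :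
    ∃ q : PowerSeries ℂ, p * q = 1 ∧
      ∃ r' : ℝ, 1 < r' ∧ Summable fun k => ‖PowerSeries.coeff k q‖ * r' ^ k := by
  have hr0 : 0 < r := by linarith
  have habs : AbsSummable p := by
    refine Summable.of_nonneg_of_le (fun _ => norm_nonneg _) (fun k => ?_) hp
    exact le_mul_of_one_le_right (norm_nonneg _) (one_le_pow₀ hr.le)
  -- By compactness of the closed disk, zero-freeness persists on a slightly larger disk; the
  -- inverse is then holomorphic there and its Taylor coefficients decay geometrically.
  obtain ⟨δ, hδ, hδr, hδ0⟩ : ∃ δ : ℝ, 1 < δ ∧ δ < r ∧ ∀ z : ℂ, ‖z‖ < δ → ev p z ≠ 0 := by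
    let U : Set ℂ := {z | ‖z‖ < r ∧ ev p z ≠ 0}
    have hU : IsOpen U := by
      have hc : ContinuousOn (ev p) (Metric.ball 0 r) := fun z hz =>
        (analyticAt_ev hr0 hp (by simpa using hz)).continuousAt.continuousWithinAt
      have := hc.isOpen_inter_preimage Metric.isOpen_ball (isOpen_compl_singleton (x := (0 : ℂ)))
      convert this using 1
      ext z
      simp [U]
    obtain ⟨d, hd, hsub⟩ := (isCompact_closedBall (0 : ℂ) 1).exists_thickening_subset_open hU
      (fun z hz => ⟨by have := mem_closedBall_zero_iff.1 hz; linarith,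
        h0 z (mem_closedBall_zero_iff.1 hz)⟩)
    have hsub' : ∀ z : ℂ, ‖z‖ < 1 + d → ev p z ≠ 0 := by
      intro z hz
      refine (hsub ?_ : z ∈ U).2
      rw [thickening_closedBall hd zero_le_one]
      simpa [add_comm] using hz
    refine ⟨1 + min d ((r - 1) / 2), ?_, ?_, ?_⟩
    · have : 0 < min d ((r - 1) / 2) := lt_min hd (by linarith)
      linarith
    · have := min_le_right d ((r - 1) / 2)
      linarith
    · intro z hz
      exact hsub' z (hz.trans_le (by gcongr; exact min_le_left _ _))
  have hdiff : DifferentiableOn ℂ (fun z => (ev p z)⁻¹) (Metric.ball 0 δ) := fun z hz => by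
    have hz' : ‖z‖ < δ := by simpa using hz
    exact ((analyticAt_ev hr0 hp (hz'.trans hδr)).differentiableAt.inv
      (hδ0 z hz')).differentiableWithinAt
  obtain ⟨q, hqabs, hq, r', hr', hsum⟩ := exists_taylorSeries hδ hdiff
  refine ⟨q, ?_, r', hr', hsum⟩
  refine (habs.mul hqabs).eq_of_ev absSummable_one fun z hz => ?_
  rw [habs.ev_mul hqabs hz.le, ev_one, hq z (hz.trans hδ)]
  exact mul_inv_cancel₀ (h0 z hz.le)

/-! ### Geometric series in a power of the variable -/

/-- The geometric series `∑ s ^ j X ^ (μ j)`. -/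
def geomSeries (μ : ℕ) (s : ℂ) : PowerSeries ℂ :=
  PowerSeries.mk fun k => if μ ∣ k then s ^ (k / μ) else 0

lemma geomSeries_mul (μ : ℕ) (hμ : 1 ≤ μ) (s : ℂ) :
    geomSeries μ s * (1 - PowerSeries.C s * PowerSeries.X ^ μ) = 1 := by
  ext k
  rw [mul_sub, mul_one, map_sub, ← mul_assoc, PowerSeries.coeff_mul_X_pow',
    PowerSeries.coeff_mul_C, geomSeries, PowerSeries.coeff_mk, PowerSeries.coeff_one]
  rcases Nat.eq_zero_or_pos k with rfl | hk
  · simp [show ¬ μ ≤ 0 by omega]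
  · rw [if_neg hk.ne']
    by_cases hd : μ ∣ k
    · obtain ⟨j, rfl⟩ := hd
      have hj : 1 ≤ j := Nat.pos_of_ne_zero (by rintro rfl; simp at hk)
      obtain ⟨i, rfl⟩ := Nat.exists_eq_add_of_le' hj
      have h1 : μ ≤ μ * (i + 1) := Nat.le_mul_of_pos_right _ (by omega)
      have h2 : μ * (i + 1) - μ = μ * i := by rw [mul_add, mul_one]; omega
      rw [if_pos h1, h2, PowerSeries.coeff_mk, if_pos (dvd_mul_right _ _),
        if_pos (dvd_mul_right _ _), Nat.mul_div_cancel_left _ hμ, Nat.mul_div_cancel_left _ hμ,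
        pow_succ, sub_self]
    · rw [if_neg hd, PowerSeries.coeff_mk]
      split_ifs with h1 h2
      · exact absurd ((Nat.dvd_sub_iff_left h1 dvd_rfl).1 h2) hd
      · simp
      · simp

/-- The condition `s < 1` is essential: at `s = 1` the coefficients are not summable, which is why
the inverse of `1 - X ^ μ` is only approached by dilated geometric series. -/
lemma absSummable_geomSeries (μ : ℕ) (hμ : 1 ≤ μ) {s : ℝ} (hs0 : 0 < s) (hs1 : s < 1) :
    AbsSummable (geomSeries μ s) := by
  have hinj : Function.Injective fun j : ℕ => μ * j := fun i j h => by
    simpa [show μ ≠ 0 by omega] using h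
  refine (hinj.summable_iff (f := fun k => ‖PowerSeries.coeff k (geomSeries μ s)‖) ?_).1 ?_
  · intro k hk
    have : ¬ μ ∣ k := by
      rintro ⟨j, rfl⟩
      exact hk ⟨j, rfl⟩
    simp [geomSeries, this]
  · have : ((fun k => ‖PowerSeries.coeff k (geomSeries μ s)‖) ∘ fun j : ℕ => μ * j)
        = fun j => s ^ j := by
      funext j
      simp [geomSeries, Nat.mul_div_cancel_left _ hμ, abs_of_pos hs0]
    rw [this]
    exact summable_geometric_of_lt_one hs0.le hs1

/-! ### Exponentials on the frequency interval -/

lemma cis_zero : cis 0 = 1 := by simp [cis]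

lemma cis_add (x y : ℝ) : cis (x + y) = cis x * cis y := by
  rw [cis, cis, cis, ← Complex.exp_add]
  push_cast
  ring_nf

lemma cis_ne_zero (x : ℝ) : cis x ≠ 0 := Complex.exp_ne_zero _

lemma norm_cis (x : ℝ) : ‖cis x‖ = 1 := Complex.norm_exp_ofReal_mul_I x

lemma star_cis (x : ℝ) : star (cis x) = cis (-x) := by
  rw [cis, cis, ← starRingEnd_apply, ← Complex.exp_conj]
  simp

lemma cis_mul_neg (x : ℝ) : cis x * cis (-x) = 1 := by rw [← cis_add]; simp [cis_zero]

lemma cis_neg (x : ℝ) : cis (-x) = (cis x)⁻¹ :=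
  eq_inv_of_mul_eq_one_right (cis_mul_neg x)

lemma cis_sub (x y : ℝ) : cis (x - y) = cis x * cis (-y) := by rw [sub_eq_add_neg, cis_add]

lemma cis_nat_mul (k : ℕ) (x : ℝ) : cis (k * x) = cis x ^ k := by
  rw [cis, cis, ← Complex.exp_nat_mul]
  push_cast
  ring_nf

@[fun_prop]
lemma continuous_cis : Continuous cis := by
  unfold cis
  fun_prop

lemma norm_cis_le_one (x : ℝ) : ‖cis x‖ ≤ 1 := (norm_cis x).le

lemma measurableSet_freq : MeasurableSet freq := measurableSet_Ioc

lemma volume_freq : volume freq = ENNReal.ofReal (2 * Real.pi) := by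
  rw [freq, Real.volume_Ioc]
  ring_nf

instance isFiniteMeasure_freq : IsFiniteMeasure (volume.restrict freq) :=
  ⟨by rw [Measure.restrict_apply_univ, volume_freq]; exact ENNReal.ofReal_lt_top⟩

lemma measureReal_freq : volume.real freq = 2 * Real.pi := by
  rw [measureReal_def, volume_freq, ENNReal.toReal_ofReal (by positivity)]

lemma integrable_freq_of_continuous {E : Type*} [NormedAddCommGroup E] {g : ℝ → E}
    (hg : Continuous g) : IntegrableOn g freq :=
  hg.integrableOn_Ioc

lemma integral_cis_int (k : ℤ) : ∫ t in freq, cis (k * t) = if k = 0 then 2 * Real.pi else 0 := by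
  split_ifs with hk
  · subst hk
    simp [cis_zero, measureReal_freq]
  · have hle : -Real.pi ≤ Real.pi := by linarith [Real.pi_pos]
    have hc : (k : ℂ) * Complex.I ≠ 0 := by simpa using hk
    have h1 : ∀ t : ℝ, cis (k * t) = Complex.exp ((k : ℂ) * Complex.I * t) := fun t => by
      rw [cis]
      push_cast
      ring_nf
    rw [freq, ← intervalIntegral.integral_of_le hle]
    simp_rw [h1]
    rw [integral_exp_mul_complex hc, Complex.ofReal_zero, div_eq_zero_iff]
    left
    rw [sub_eq_zero, Complex.exp_eq_exp_iff_exists_int]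
    refine ⟨k, ?_⟩
    push_cast
    ring

/-- The mean `(1/2π) ∫ F` over the frequency interval. -/
def circMean (F : ℝ → ℂ) : ℂ := (1 / (2 * Real.pi) : ℂ) * ∫ t in freq, F t

lemma two_pi_ne_zero : (2 * Real.pi : ℂ) ≠ 0 := by
  exact_mod_cast (by positivity : (2 * Real.pi : ℝ) ≠ 0)

lemma circMean_cis (k : ℤ) : circMean (fun t => cis (k * t)) = if k = 0 then 1 else 0 := by
  rw [circMean, integral_cis_int]
  split_ifs
  · push_cast
    rw [one_div, inv_mul_cancel₀ two_pi_ne_zero]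
  · simp

lemma circMean_add {F G : ℝ → ℂ} (hF : IntegrableOn F freq) (hG : IntegrableOn G freq) :
    circMean (fun t => F t + G t) = circMean F + circMean G := by
  rw [circMean, circMean, circMean, integral_add hF hG, mul_add]

lemma circMean_sub {F G : ℝ → ℂ} (hF : IntegrableOn F freq) (hG : IntegrableOn G freq) :
    circMean (fun t => F t - G t) = circMean F - circMean G := by
  rw [circMean, circMean, circMean, integral_sub hF hG, mul_sub]

lemma circMean_const_mul (c : ℂ) (F : ℝ → ℂ) : circMean (fun t => c * F t) = c * circMean F := by
  rw [circMean, circMean, integral_const_mul]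
  ring

lemma circMean_sum {ι : Type*} (s : Finset ι) {F : ι → ℝ → ℂ}
    (hF : ∀ i ∈ s, IntegrableOn (F i) freq) :
    circMean (fun t => ∑ i ∈ s, F i t) = ∑ i ∈ s, circMean (F i) := by
  simp only [circMean]
  rw [integral_finsetSum _ hF, Finset.mul_sum]

lemma circMean_ofReal (F : ℝ → ℝ) :
    circMean (fun t => (F t : ℂ)) = ((1 / (2 * Real.pi) * ∫ t in freq, F t : ℝ) : ℂ) := by
  rw [circMean, integral_complex_ofReal]
  push_cast
  ring

/-- Termwise integration of an absolutely summable series against an integrable function. -/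
lemma AbsSummable.hasSum_circMean {p : PowerSeries ℂ} (hp : AbsSummable p) {u : ℝ → ℂ}
    (hu : Continuous u) (hu1 : ∀ t, ‖u t‖ ≤ 1) {g : ℝ → ℂ} (hg : IntegrableOn g freq) :
    HasSum (fun k => PowerSeries.coeff k p * circMean fun t => u t ^ k * g t)
      (circMean fun t => ev p (u t) * g t) := by
  have h := hasSum_integral_of_dominated_convergence (μ := volume.restrict freq)
    (F := fun k t => PowerSeries.coeff k p * u t ^ k * g t) (f := fun t => ev p (u t) * g t)
    (fun k t => ‖PowerSeries.coeff k p‖ * ‖g t‖)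
    (fun k => (by fun_prop : Continuous fun t => PowerSeries.coeff k p * u t ^ k)
      |>.aestronglyMeasurable.mul hg.aestronglyMeasurable)
    (fun k => ae_of_all _ fun t => by
      rw [norm_mul]
      gcongr
      exact norm_term_le p (hu1 t) k)
    (ae_of_all _ fun t => hp.summable.mul_right _)
    (by
      simp_rw [tsum_mul_right]
      exact hg.norm.const_mul _)
    (ae_of_all _ fun t => (hp.hasSum_ev (hu1 t)).mul_right _)
  have h2 := h.mul_left (1 / (2 * Real.pi) : ℂ)
  have he : (fun k => PowerSeries.coeff k p * circMean fun t => u t ^ k * g t) = fun k =>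
      (1 / (2 * Real.pi) : ℂ) * ∫ t in freq, PowerSeries.coeff k p * u t ^ k * g t := by
    funext k
    simp_rw [mul_assoc]
    rw [circMean, integral_const_mul]
    ring
  rw [he]
  exact h2

lemma AbsSummable.continuous_ev_comp {p : PowerSeries ℂ} (hp : AbsSummable p) {u : ℝ → ℂ}
    (hu : Continuous u) (hu1 : ∀ t, ‖u t‖ ≤ 1) : Continuous fun t => ev p (u t) :=
  hp.continuousOn.comp_continuous hu fun t => by simpa using hu1 t

/-- Boundary values `p(e^{-it})`. -/
def bdry (p : PowerSeries ℂ) (t : ℝ) : ℂ := ev p (cis (-t))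

lemma AbsSummable.continuous_bdry {p : PowerSeries ℂ} (hp : AbsSummable p) : Continuous (bdry p) :=
  hp.continuous_ev_comp (by fun_prop) fun _ => norm_cis_le_one _

lemma AbsSummable.norm_bdry_le {p : PowerSeries ℂ} (hp : AbsSummable p) (t : ℝ) :
    ‖bdry p t‖ ≤ coeffNorm p := hp.norm_ev_le (norm_cis_le_one _)

lemma AbsSummable.bdry_mul {p q : PowerSeries ℂ} (hp : AbsSummable p) (hq : AbsSummable q) (t : ℝ) :
    bdry (p * q) t = bdry p t * bdry q t := hp.ev_mul hq (norm_cis_le_one _)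

lemma AbsSummable.hasSum_circMean_bdry {p : PowerSeries ℂ} (hp : AbsSummable p) {g : ℝ → ℂ}
    (hg : IntegrableOn g freq) :
    HasSum (fun k => PowerSeries.coeff k p * circMean fun t => cis (-(k * t)) * g t)
      (circMean fun t => bdry p t * g t) := by
  have := hp.hasSum_circMean (u := fun t => cis (-t)) (by fun_prop) (fun _ => norm_cis_le_one _) hg
  have h : ∀ (k : ℕ) (t : ℝ), cis (-(k * t)) = cis (-t) ^ k := fun k t => by
    rw [← cis_nat_mul]; ring_nf
  simp_rw [h]
  exact this

/-- Fourier coefficients of the boundary values of a power series. -/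
lemma AbsSummable.circMean_bdry_mul_cis {p : PowerSeries ℂ} (hp : AbsSummable p) (k : ℤ) :
    circMean (fun t => bdry p t * cis (k * t)) =
      if 0 ≤ k then PowerSeries.coeff k.toNat p else 0 := by
  have h := hp.hasSum_circMean_bdry (g := fun t => cis (k * t))
    (integrable_freq_of_continuous (by fun_prop))
  have h1 : ∀ j : ℕ, circMean (fun t => cis (-(j * t)) * cis (k * t))
      = if k = j then 1 else 0 := fun j => by
    have : ∀ t : ℝ, cis (-(j * t)) * cis (k * t) = cis (((k - j : ℤ) : ℝ) * t) := fun t => by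
      rw [← cis_add]
      push_cast
      ring_nf
    simp_rw [this]
    rw [circMean_cis]
    simp [sub_eq_zero]
  simp_rw [h1] at h
  rw [← h.tsum_eq]
  split_ifs with hk
  · obtain ⟨i, rfl⟩ := Int.eq_ofNat_of_zero_le hk
    rw [tsum_eq_single i]
    · simp
    · intro j hj
      simp [Ne.symm hj]
  · have : ∀ j : ℕ, k ≠ j := fun j hj => hk (by omega)
    simp [this]

/-! ### Absolutely convergent Fourier series -/

lemma norm_fourierCoeffOn_le {a b : ℝ} (hab : a < b) (f : ℝ → ℂ) (n : ℤ) :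
    ‖fourierCoeffOn hab f n‖ ≤ (1 / (b - a)) * ∫ x in a..b, ‖f x‖ := by
  have h0 : 0 < b - a := by linarith
  rw [fourierCoeffOn_eq_integral, norm_smul, Real.norm_of_nonneg (by positivity)]
  gcongr
  refine (intervalIntegral.norm_integral_le_integral_norm hab.le).trans (le_of_eq ?_)
  refine intervalIntegral.integral_congr fun x _ => ?_
  simp only [norm_smul]
  have := Fact.mk h0
  rw [fourier_apply, Circle.norm_coe, one_mul]

/-- The Fourier series of a function which is twice continuously differentiable on `[-π, π]`, with
equal values at the end points, converges absolutely. -/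
lemma exists_hasSum_fourier {g g' g'' : ℝ → ℂ} (hg : ∀ t ∈ Set.Icc (-Real.pi) Real.pi,
    HasDerivAt g (g' t) t) (hg' : ∀ t ∈ Set.Icc (-Real.pi) Real.pi, HasDerivAt g' (g'' t) t)
    (hc : ContinuousOn g'' (Set.Icc (-Real.pi) Real.pi)) (hend : g (-Real.pi) = g Real.pi) :
    Summable (fun k : ℤ => ‖circMean fun t => cis (-(k * t)) * g t‖) ∧
      ∀ t ∈ freq, HasSum (fun k : ℤ => (circMean fun t => cis (-(k * t)) * g t) * cis (k * t))
        (g t) := by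
  have hab : -Real.pi < Real.pi := by linarith [Real.pi_pos]
  have hfact : Fact (0 < Real.pi - -Real.pi) := ⟨by linarith⟩
  have hfour : ∀ (n : ℤ) (t : ℝ), (fourier n (t : AddCircle (Real.pi - -Real.pi)) : ℂ)
      = cis (n * t) := by
    intro n t
    rw [fourier_coe_apply, cis]
    congr 1
    push_cast
    have := Complex.ofReal_ne_zero.2 Real.pi_ne_zero
    field_simp
    ring
  have hcoef : ∀ n : ℤ, fourierCoeffOn hab g n = circMean fun t => cis (-(n * t)) * g t := by
    intro n
    rw [fourierCoeffOn_eq_integral, circMean, freq, ← intervalIntegral.integral_of_le hab.le,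
      Complex.real_smul]
    congr 1
    · push_cast
      ring
    · refine intervalIntegral.integral_congr fun t _ => ?_
      simp only [hfour, smul_eq_mul]
      push_cast
      ring_nf
  have huIcc : Set.uIcc (-Real.pi) Real.pi = Set.Icc (-Real.pi) Real.pi := Set.uIcc_of_le hab.le
  have hint' : IntervalIntegrable g' volume (-Real.pi) Real.pi := by
    refine ContinuousOn.intervalIntegrable ?_
    rw [huIcc]
    exact fun t ht => (hg' t ht).continuousAt.continuousWithinAt
  have hint'' : IntervalIntegrable g'' volume (-Real.pi) Real.pi := by
    refine ContinuousOn.intervalIntegrable ?_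
    rwa [huIcc]
  -- Two integrations by parts give the decay `1 / n²`. The boundary term of `g` vanishes by `hend`,
  -- whereas that of `g'` need not vanish and enters `K`.
  set K : ℝ := ‖g' Real.pi - g' (-Real.pi)‖ + ∫ x in -Real.pi..Real.pi, ‖g'' x‖ with hK
  have hbound : ∀ n : ℤ, n ≠ 0 → ‖fourierCoeffOn hab g n‖ ≤ K * (1 / (n : ℝ) ^ 2) := by
    intro n hn
    have h1 := fourierCoeffOn_of_hasDerivAt hab hn (fun t ht => hg t (huIcc ▸ ht)) hint'
    have h2 := fourierCoeffOn_of_hasDerivAt hab hn (fun t ht => hg' t (huIcc ▸ ht)) hint''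
    have h3 := norm_fourierCoeffOn_le hab g'' n
    have hpi := Real.pi_pos
    have hn' : (0 : ℝ) < |(n : ℝ)| := by simpa using hn
    have h4 : ‖fourierCoeffOn hab g' n‖ ≤ 1 / (2 * Real.pi * |(n : ℝ)|) * K := by
      rw [h2, norm_mul]
      have e1 : ‖(1 / (-2 * Real.pi * Complex.I * n) : ℂ)‖ = 1 / (2 * Real.pi * |(n : ℝ)|) := by
        simp [abs_of_pos hpi]
      rw [e1]
      gcongr
      refine (norm_sub_le _ _).trans ?_
      rw [hK]
      gcongr
      · rw [norm_mul, fourier_apply, Circle.norm_coe, one_mul]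
      · rw [norm_mul]
        have e2 : ‖((Real.pi : ℂ) - ((-Real.pi : ℝ) : ℂ))‖ = Real.pi - -Real.pi := by
          rw [← Complex.ofReal_sub, Complex.norm_real, Real.norm_of_nonneg (by linarith)]
        rw [e2]
        calc (Real.pi - -Real.pi) * ‖fourierCoeffOn hab g'' n‖
            ≤ (Real.pi - -Real.pi) * (1 / (Real.pi - -Real.pi) *
              ∫ x in -Real.pi..Real.pi, ‖g'' x‖) := by
              have : 0 < Real.pi - -Real.pi := by linarith
              gcongr
          _ = _ := by
              have : Real.pi - -Real.pi ≠ 0 := by linarith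
              field_simp
    rw [h1, hend, sub_self, mul_zero, zero_sub, norm_mul, norm_neg, norm_mul]
    have e1 : ‖(1 / (-2 * Real.pi * Complex.I * n) : ℂ)‖ = 1 / (2 * Real.pi * |(n : ℝ)|) := by
      simp [abs_of_pos hpi]
    have e2 : ‖((Real.pi : ℂ) - ((-Real.pi : ℝ) : ℂ))‖ = 2 * Real.pi := by
      rw [← Complex.ofReal_sub, Complex.norm_real, Real.norm_of_nonneg (by linarith)]
      ring
    rw [e1, e2]
    have hK0 : 0 ≤ K := by
      have : 0 ≤ ∫ x in -Real.pi..Real.pi, ‖g'' x‖ :=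
        intervalIntegral.integral_nonneg hab.le fun _ _ => norm_nonneg _
      positivity
    have h5 : 1 ≤ 2 * Real.pi := by linarith [Real.pi_gt_three]
    calc 1 / (2 * Real.pi * |(n : ℝ)|) * (2 * Real.pi * ‖fourierCoeffOn hab g' n‖)
        ≤ 1 / (2 * Real.pi * |(n : ℝ)|) * (2 * Real.pi * (1 / (2 * Real.pi * |(n : ℝ)|) * K)) := by
          gcongr
      _ = K * (1 / (n : ℝ) ^ 2) / (2 * Real.pi) := by
          rw [← sq_abs (n : ℝ)]
          field_simp
      _ ≤ K * (1 / (n : ℝ) ^ 2) := div_le_self (by positivity) h5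
  have hsum : Summable fun k : ℤ => ‖fourierCoeffOn hab g k‖ := by
    have h1 : Summable fun k : ℤ => K * (1 / (k : ℝ) ^ 2) :=
      (Real.summable_one_div_int_pow.2 one_lt_two).mul_left K
    refine Summable.of_norm_bounded_eventually h1 ?_
    rw [Filter.eventually_cofinite]
    refine (Set.finite_singleton (0 : ℤ)).subset fun n hn => ?_
    by_contra h0
    exact hn (by simpa using hbound n h0)
  refine ⟨by simpa only [hcoef] using hsum, fun t ht => ?_⟩
  -- Equality at the end points makes the periodic extension continuous, so the absolutely
  -- convergent Fourier series represents it at every point.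
  have hcont : Continuous (AddCircle.liftIoc (Real.pi - -Real.pi) (-Real.pi) g) := by
    refine AddCircle.liftIoc_continuous (by rw [hend]; congr 1; ring) ?_
    rw [show -Real.pi + (Real.pi - -Real.pi) = Real.pi by ring]
    exact fun t ht => (hg t ht).continuousAt.continuousWithinAt
  have h := has_pointwise_sum_fourier_series_of_summable
    (f := ⟨AddCircle.liftIoc (Real.pi - -Real.pi) (-Real.pi) g, hcont⟩)
    (show Summable (fourierCoeffOn hab g) from hsum.of_norm) (t : AddCircle (Real.pi - -Real.pi))
  have hval : AddCircle.liftIoc (Real.pi - -Real.pi) (-Real.pi) g (t : AddCircle _) = g t :=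
    AddCircle.liftIoc_coe_apply (by rw [show -Real.pi + (Real.pi - -Real.pi) = Real.pi by ring]; exact ht)
  simp only [ContinuousMap.coe_mk, hval] at h
  have he : (fun k : ℤ => (circMean fun t => cis (-(k * t)) * g t) * cis (k * t)) = fun k : ℤ =>
      fourierCoeff (AddCircle.liftIoc (Real.pi - -Real.pi) (-Real.pi) g) k •
        (fourier k (t : AddCircle (Real.pi - -Real.pi)) : ℂ) := by
    funext k
    rw [hfour, smul_eq_mul, ← hcoef]
    rfl
  rw [he]
  exact h

/-! ### The logarithm of the `sinc` function -/

/-- At the origin `sinc` is the divided slope of `sin`, whose power series is the shifted one. -/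
lemma analyticAt_sinc (x : ℝ) : AnalyticAt ℝ Real.sinc x := by
  rcases eq_or_ne x 0 with rfl | hx
  · rw [Real.sinc_eq_dslope]
    obtain ⟨p, hp⟩ := Real.analyticAt_sin (x := 0)
    exact ⟨_, hp.has_fpower_series_dslope_fslope⟩
  · have h : AnalyticAt ℝ (fun y => Real.sin y / y) x :=
      Real.analyticAt_sin.div analyticAt_id hx
    refine h.congr ?_
    filter_upwards [isOpen_ne.mem_nhds hx] with y hy
    exact (Real.sinc_of_ne_zero hy).symm

lemma sinc_half_pos {t : ℝ} (ht : t ∈ Set.Icc (-Real.pi) Real.pi) : 0 < Real.sinc (t / 2) := by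
  have key : ∀ s : ℝ, 0 ≤ s → s ≤ Real.pi → 0 < Real.sinc (s / 2) := by
    intro s h0 h1
    rcases h0.eq_or_lt with rfl | h0
    · simp
    · rw [Real.sinc_of_ne_zero (by positivity)]
      exact div_pos (Real.sin_pos_of_pos_of_lt_pi (by linarith) (by linarith [Real.pi_pos]))
        (by linarith)
  rcases le_total 0 t with h | h
  · exact key t h ht.2
  · have := key (-t) (by linarith) (by linarith [ht.1])
    rwa [neg_div, Real.sinc_neg] at this

/-- The chord has length `2 |sin (t / 2)|`. Splitting off `|t|` exhibits the factor that cancels the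
pole `λ^{-2n}` and leaves the smooth positive function `sinc (t / 2)`. -/
lemma norm_one_sub_cis (t : ℝ) : ‖1 - cis t‖ = |t| * |Real.sinc (t / 2)| := by
  have h := Complex.norm_exp_I_mul_ofReal_sub_one (x := t)
  rw [mul_comm Complex.I] at h
  rw [norm_sub_rev, cis, h]
  rcases eq_or_ne t 0 with rfl | ht
  · simp
  · rw [Real.sinc_of_ne_zero (by positivity), Real.norm_eq_abs, abs_div, abs_mul, abs_div]
    have : |t| ≠ 0 := by simpa using ht
    field_simp

lemma norm_one_sub_cis_le (t : ℝ) : ‖1 - cis t‖ ≤ |t| := by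
  rw [norm_one_sub_cis]
  exact mul_le_of_le_one_right (abs_nonneg _) (Real.abs_sinc_le_one _)

lemma circMean_star (F : ℝ → ℂ) : star (circMean F) = circMean fun t => star (F t) := by
  simp only [circMean, ← starRingEnd_apply]
  rw [map_mul, ← integral_conj]
  congr 1
  rw [show (1 / (2 * Real.pi) : ℂ) = ((1 / (2 * Real.pi) : ℝ) : ℂ) by push_cast; rfl,
    Complex.conj_ofReal]

/-- On the interval, `log sinc (t / 2)` is the real part of an absolutely summable power series in
`e^{it}`. -/
lemma exists_log_sinc : ∃ U : PowerSeries ℂ, AbsSummable U ∧ (PowerSeries.coeff 0 U).im = 0 ∧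
    ∀ t ∈ freq, (ev U (cis t)).re = Real.log (Real.sinc (t / 2)) := by
  set G : ℝ → ℝ := fun t => Real.log (Real.sinc (t / 2)) with hG
  have hGa : ∀ t ∈ Set.Icc (-Real.pi) Real.pi, AnalyticAt ℝ G t := fun t ht =>
    ((analyticAt_sinc (t / 2)).comp (f := fun t : ℝ => t / 2)
      (by fun_prop)).log (sinc_half_pos ht)
  -- `G` is analytic at each point of the closed interval, where `sinc (t / 2)` is positive, and it
  -- is even, so its end values agree.
  obtain ⟨hs, hsum⟩ := exists_hasSum_fourier (g := fun t => (G t : ℂ))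
    (g' := fun t => ((deriv G t : ℝ) : ℂ)) (g'' := fun t => ((deriv (deriv G) t : ℝ) : ℂ))
    (fun t ht => (hGa t ht).differentiableAt.hasDerivAt.ofReal_comp)
    (fun t ht => (hGa t ht).deriv.differentiableAt.hasDerivAt.ofReal_comp)
    (fun t ht => (Complex.continuous_ofReal.continuousAt.comp
      (hGa t ht).deriv.deriv.continuousAt).continuousWithinAt)
    (by simp [hG, neg_div, Real.sinc_neg])
  set l : ℤ → ℂ := fun k => circMean fun t => cis (-(k * t)) * (G t : ℂ) with hl
  have hstar : ∀ k, star (l k) = l (-k) := by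
    intro k
    simp only [hl]
    rw [circMean_star]
    congr 1
    funext t
    rw [star_mul', star_cis]
    simp
  have hl0 : (l 0).im = 0 := by
    have := hstar 0
    rw [neg_zero, ← starRingEnd_apply] at this
    exact Complex.conj_eq_iff_im.1 this
  have hsn : Summable fun k : ℕ => ‖l k‖ := hs.comp_injective Nat.cast_injective
  -- Since `l (-k)` is conjugate to `l k`, folding the negative frequencies onto the positive ones
  -- doubles the coefficients without changing the real part of the sum.
  set U : PowerSeries ℂ := PowerSeries.mk fun k => if k = 0 then l 0 else 2 * l k with hU
  have hUs : AbsSummable U := by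
    refine Summable.of_nonneg_of_le (fun _ => norm_nonneg _) (fun k => ?_) (hsn.mul_left 2)
    rw [hU, PowerSeries.coeff_mk]
    split_ifs with h
    · subst h
      simp only [Nat.cast_zero]
      linarith [norm_nonneg (l 0)]
    · simp
  refine ⟨U, hUs, by simpa [hU] using hl0, fun t ht => ?_⟩
  have h1 := (hsum t ht).nat_add_neg
  have h2 : HasSum (fun k : ℕ => l k * cis t ^ k) (∑' k : ℕ, l k * cis t ^ k) := by
    refine Summable.hasSum (Summable.of_norm ?_)
    simpa [norm_cis] using hsn
  have h3 := (Complex.hasSum_re h2).mul_left 2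
  have h4 := Complex.hasSum_re h1
  have h5 : (fun k : ℕ => 2 * (l k * cis t ^ k).re) = fun k : ℕ =>
      (l k * cis ((k : ℤ) * t) + l (-k) * cis ((-k : ℤ) * t)).re := by
    funext k
    have e1 : cis (((k : ℤ) : ℝ) * t) = cis t ^ k := by
      rw [← cis_nat_mul]; norm_cast
    have e2 : l (-k) * cis (((-k : ℤ) : ℝ) * t) = star (l k * cis t ^ k) := by
      rw [star_mul', hstar, ← e1, star_cis]
      congr 2
      push_cast
      ring
    rw [e1, e2, Complex.add_re, ← starRingEnd_apply, Complex.conj_re]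
    ring
  have hl0' : (l 0).re = (circMean fun t => (G t : ℂ)).re := by simp [hl, cis_zero]
  have h6 : 2 * (∑' k : ℕ, l k * cis t ^ k).re = G t + (l 0).re := by
    rw [h5] at h3
    have := h3.unique h4
    rw [hl0']
    simpa [cis_zero] using this
  have h7 : HasSum (fun k => PowerSeries.coeff k U * cis t ^ k)
      (2 * (∑' k : ℕ, l k * cis t ^ k) - l 0) := by
    have h8 := (h2.mul_left 2).sub (hasSum_ite_eq 0 (l 0))
    have he : (fun k => PowerSeries.coeff k U * cis t ^ k) = fun k : ℕ =>
        2 * (l k * cis t ^ k) - if k = 0 then l 0 else 0 := by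
      funext k
      rw [hU, PowerSeries.coeff_mk]
      split_ifs with h
      · subst h
        simp
        ring
      · ring
    rw [he]
    exact h8
  rw [ev, h7.tsum_eq, Complex.sub_re, show (2 : ℂ) = ((2 : ℝ) : ℂ) by norm_num,
    Complex.re_ofReal_mul, h6, add_sub_cancel_right]

/-! ### Herglotz integrals -/

/-- The conjugate series. -/
def conjSeries (p : PowerSeries ℂ) : PowerSeries ℂ := PowerSeries.mk fun k => star (PowerSeries.coeff k p)

lemma AbsSummable.conj {p : PowerSeries ℂ} (hp : AbsSummable p) :
    AbsSummable (conjSeries p) := by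
  simpa [AbsSummable, conjSeries] using hp.summable

lemma star_ev (p : PowerSeries ℂ) (z : ℂ) : star (ev p z) = ev (conjSeries p) (star z) := by
  simp only [ev, ← starRingEnd_apply, Complex.conj_tsum]
  refine tsum_congr fun k => ?_
  simp [conjSeries]

lemma star_bdry (p : PowerSeries ℂ) (t : ℝ) : star (bdry p t) = ev (conjSeries p) (cis t) := by
  rw [bdry, star_ev, star_cis, neg_neg]

/-- The Herglotz kernel. -/
lemma herglotz_kernel {z : ℂ} (hz : ‖z‖ < 1) :
    ∃ K : PowerSeries ℂ, AbsSummable K ∧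
      (∀ k, PowerSeries.coeff k K = if k = 0 then 1 else 2 * z ^ k) ∧
      ∀ t, bdry K t = (cis t + z) / (cis t - z) := by
  -- This is the expansion `(e^{it} + z) / (e^{it} - z) = 1 + 2 ∑_{k ≥ 1} z^k e^{-ikt}`.
  set K : PowerSeries ℂ := PowerSeries.mk fun k => if k = 0 then 1 else 2 * z ^ k with hK
  have hgeom : Summable fun k : ℕ => ‖z‖ ^ k := summable_geometric_of_lt_one (norm_nonneg _) hz
  refine ⟨K, ?_, fun k => by rw [hK, PowerSeries.coeff_mk], fun t => ?_⟩
  · refine Summable.of_nonneg_of_le (fun _ => norm_nonneg _) (fun k => ?_) (hgeom.mul_left 2)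
    rw [hK, PowerSeries.coeff_mk]
    split_ifs with h
    · subst h
      simp
    · simp
  · have hz' : ‖z * cis (-t)‖ < 1 := by rwa [norm_mul, norm_cis, mul_one]
    have h1 := ((hasSum_geometric_of_norm_lt_one hz').mul_left 2).sub (hasSum_ite_eq 0 (1 : ℂ))
    have he : (fun k => PowerSeries.coeff k K * cis (-t) ^ k) = fun k : ℕ =>
        2 * (z * cis (-t)) ^ k - if k = 0 then 1 else 0 := by
      funext k
      rw [hK, PowerSeries.coeff_mk]
      split_ifs with h
      · subst h
        simp
        ring
      · rw [mul_pow]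
        ring
    rw [bdry, ev, he, h1.tsum_eq, cis_neg]
    have h0 := cis_ne_zero t
    have h2 : cis t - z ≠ 0 := by
      intro h
      have : ‖z‖ = 1 := by rw [← sub_eq_zero.1 h, norm_cis]
      linarith
    have h3 : 1 - z * (cis t)⁻¹ ≠ 0 := by
      intro h
      apply h2
      field_simp at h
      simpa using h
    field_simp
    ring

/-- The Herglotz integral reproduces a power series with real value at the origin from the real
part of its boundary values. -/
lemma AbsSummable.herglotz {U : PowerSeries ℂ} (hU : AbsSummable U)
    (h0 : (PowerSeries.coeff 0 U).im = 0) {z : ℂ} (hz : ‖z‖ < 1) :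
    circMean (fun t => (cis t + z) / (cis t - z) * ((ev U (cis t)).re : ℂ)) = ev U z := by
  obtain ⟨K, hK, hKc, hKb⟩ := herglotz_kernel hz
  have hc1 : Continuous fun t => ev U (cis t) := hU.continuous_ev_comp (by fun_prop) norm_cis_le_one
  have h1 := hK.hasSum_circMean_bdry (g := fun t => ((ev U (cis t)).re : ℂ))
    (integrable_freq_of_continuous (by fun_prop))
  simp_rw [hKb] at h1
  have hstar : conjSeries (conjSeries U) = U := by
    ext k
    simp [conjSeries]
  have hUk : ∀ k : ℕ, circMean (fun t => cis (-(k * t)) * ev U (cis t)) = PowerSeries.coeff k U := by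
    intro k
    have h2 := hU.conj.circMean_bdry_mul_cis (k : ℤ)
    have h3 := congrArg star h2
    rw [circMean_star] at h3
    simp only [star_mul', star_bdry, hstar, star_cis] at h3
    simpa [conjSeries, mul_comm] using h3
  have hUk' : ∀ k : ℕ, circMean (fun t => cis (-(k * t)) * star (ev U (cis t)))
      = if k = 0 then star (PowerSeries.coeff 0 U) else 0 := by
    intro k
    have h2 := hU.conj.circMean_bdry_mul_cis (-(k : ℤ))
    have h3 : ∀ t, bdry (conjSeries U) t = star (ev U (cis t)) := fun t => by
      rw [star_ev, star_cis]; rfl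
    simp only [h3] at h2
    rcases Nat.eq_zero_or_pos k with rfl | hk
    · simpa [conjSeries, mul_comm] using h2
    · rw [if_neg (by omega)] at h2
      rw [if_neg hk.ne', ← h2]
      congr 1
      funext t
      push_cast
      rw [neg_mul, mul_comm]
  -- Taking real parts halves the coefficients of positive index, and the kernel doubles them back;
  -- the constant term is preserved because it is real.
  have hre : ∀ k : ℕ, circMean (fun t => cis (-(k * t)) * ((ev U (cis t)).re : ℂ))
      = if k = 0 then PowerSeries.coeff 0 U else PowerSeries.coeff k U / 2 := by
    intro k
    have e1 : (fun t => cis (-(k * t)) * ((ev U (cis t)).re : ℂ)) = fun t =>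
        (1 / 2 : ℂ) * (cis (-(k * t)) * ev U (cis t) + cis (-(k * t)) * star (ev U (cis t))) := by
      funext t
      rw [Complex.re_eq_add_conj, starRingEnd_apply]
      ring
    rw [e1, circMean_const_mul, circMean_add (integrable_freq_of_continuous (by fun_prop))
      (integrable_freq_of_continuous (by fun_prop)), hUk, hUk']
    split_ifs with h
    · subst h
      have : star (PowerSeries.coeff 0 U) = PowerSeries.coeff 0 U := Complex.conj_eq_iff_im.2 h0
      rw [this]
      ring
    · ring
  rw [← h1.tsum_eq, ev]
  refine tsum_congr fun k => ?_
  rw [hre, hKc]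
  split_ifs with h
  · subst h
    simp
  · ring

/-! ### The outer function `w_μ` -/

lemma ae_cis_ne_one (μ : ℕ) (hμ : 1 ≤ μ) : ∀ᵐ t : ℝ, cis t ^ μ ≠ 1 := by
  have hsub : {t : ℝ | cis t ^ μ = 1} ⊆ Set.range fun k : ℤ => (2 * Real.pi / μ) * k := by
    intro t ht
    change cis t ^ μ = 1 at ht
    rw [← cis_nat_mul, cis, Complex.exp_eq_one_iff] at ht
    obtain ⟨k, hk⟩ := ht
    refine ⟨k, ?_⟩
    have hμ0 : (μ : ℝ) ≠ 0 := by positivity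
    have h2 : ((μ * t : ℝ) : ℂ) = ((k * (2 * Real.pi) : ℝ) : ℂ) := by
      apply mul_right_cancel₀ Complex.I_ne_zero
      rw [hk]
      push_cast
      ring
    have h3 : (μ : ℝ) * t = k * (2 * Real.pi) := by exact_mod_cast h2
    field_simp
    linarith
  have h0 : volume {t : ℝ | cis t ^ μ = 1} = 0 :=
    ((Set.countable_range _).mono hsub).measure_zero _
  rw [ae_iff]
  simpa using h0

lemma norm_one_sub_cis_pow (μ : ℕ) (t : ℝ) : ‖1 - cis (-(t * μ))‖ = ‖1 - cis t ^ μ‖ := by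
  rw [← norm_star, star_sub, star_one, star_cis, neg_neg, mul_comm, cis_nat_mul]

/-- The logarithm is unbounded at the `μ`th roots of unity, but `log` of the norm of a meromorphic
function is integrable on circles; periodicity moves the interval from `[0, 2π]` to `(-π, π]`. -/
lemma integrable_log_norm_one_sub (μ : ℕ) :
    IntegrableOn (fun t => Real.log ‖1 - cis t ^ μ‖) freq := by
  have h1 : CircleIntegrable (fun z : ℂ => Real.log ‖1 - z ^ μ‖) 0 1 :=
    MeromorphicOn.circleIntegrable_log_norm (f := fun z : ℂ => 1 - z ^ μ) fun z _ =>
      (by fun_prop : AnalyticAt ℂ (fun z : ℂ => 1 - z ^ μ) z).meromorphicAt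
  have h2 : IntervalIntegrable (fun t => Real.log ‖1 - cis t ^ μ‖) volume 0 (2 * Real.pi) := by
    simpa [CircleIntegrable, circleMap, cis] using h1
  have hper : Function.Periodic (fun t => Real.log ‖1 - cis t ^ μ‖) (2 * Real.pi) := by
    intro t
    have : cis (t + 2 * Real.pi) = cis t := by
      rw [cis_add, cis, cis]
      push_cast
      rw [Complex.exp_two_pi_mul_I, mul_one]
    simp only [this]
  have h3 := hper.intervalIntegrable₀ (by positivity) h2 (-Real.pi) Real.pi
  exact (intervalIntegrable_iff_integrableOn_Ioc_of_le (by linarith [Real.pi_pos])).1 h3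

/-- Both `|1 - x| ≤ |1 - s x| + (1 - s)` and `1 - s ≤ |1 - s x|` hold. The bound is uniform in `s`,
hence dominates the limits `s → 1`, both for logarithms and for the quotient `(1 - x) / (1 - s x)`.
-/
lemma norm_one_sub_le_two_mul {s : ℝ} (hs0 : 0 ≤ s) (hs1 : s ≤ 1) {x : ℂ} (hx : ‖x‖ ≤ 1) :
    ‖1 - x‖ ≤ 2 * ‖1 - s * x‖ := by
  have h1 : ‖1 - x‖ ≤ ‖1 - s * x‖ + (1 - s) := by
    have : 1 - x = (1 - s * x) - ((1 - s : ℝ) : ℂ) * x := by push_cast; ring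
    rw [this]
    refine (norm_sub_le _ _).trans ?_
    gcongr
    rw [norm_mul, Complex.norm_real, Real.norm_of_nonneg (by linarith)]
    exact mul_le_of_le_one_right (by linarith) hx
  have h2 : 1 - s ≤ ‖1 - s * x‖ := by
    have h3 := norm_sub_norm_le (1 : ℂ) (s * x)
    rw [norm_one, norm_mul, Complex.norm_real, Real.norm_of_nonneg hs0] at h3
    nlinarith
  linarith

/-- The Herglotz integral of `log |1 - e^{iμt}|`. -/
lemma herglotz_log_one_sub (μ : ℕ) (hμ : 1 ≤ μ) {z : ℂ} (hz : ‖z‖ < 1) :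
    circMean (fun t => (cis t + z) / (cis t - z) * (Real.log ‖1 - cis t ^ μ‖ : ℂ)) =
      Complex.log (1 - z ^ μ) := by
  obtain ⟨K, hK, -, hKb⟩ := herglotz_kernel hz
  have hKc := hK.continuous_bdry
  simp_rw [← hKb]
  have hμ0 : μ ≠ 0 := by omega
  -- After the dilation by `r < 1` the function `log (1 - (r w)^μ)` is holomorphic beyond the closed
  -- disk, so the Herglotz formula applies. The singular case follows by letting `r → 1`.
  have hev : ∀ r ∈ Set.Ioo (0 : ℝ) 1,
      circMean (fun t => bdry K t * (Real.log ‖1 - (r * cis t) ^ μ‖ : ℂ)) =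
        Complex.log (1 - (r * z) ^ μ) := by
    intro r hr
    have hr1 : 1 < r⁻¹ := (one_lt_inv₀ hr.1).2 hr.2
    have hmem : ∀ w : ℂ, ‖w‖ < r⁻¹ → 1 - (r * w) ^ μ ∈ Complex.slitPlane := by
      intro w hw
      rw [sub_eq_add_neg]
      apply Complex.mem_slitPlane_of_norm_lt_one
      rw [norm_neg, norm_pow]
      refine pow_lt_one₀ (norm_nonneg _) ?_ hμ0
      rw [norm_mul, Complex.norm_real, Real.norm_of_nonneg hr.1.le]
      have := mul_lt_mul_of_pos_left hw hr.1
      rwa [mul_inv_cancel₀ hr.1.ne'] at this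
    obtain ⟨U, hU, hUe, -⟩ := exists_taylorSeries (F := fun w => Complex.log (1 - (r * w) ^ μ)) hr1
      (fun w hw => (DifferentiableAt.clog (f := fun w : ℂ => 1 - (r * w) ^ μ) (by fun_prop)
        (hmem w (by simpa using hw))).differentiableWithinAt)
    have h0 : (PowerSeries.coeff 0 U).im = 0 := by
      rw [coeff_zero_eq_ev, hUe 0 (by rw [norm_zero]; linarith)]
      simp [hμ0]
    have h1 := hU.herglotz h0 hz
    rw [hUe z (hz.trans hr1)] at h1
    rw [← h1]
    congr 1
    funext t
    rw [hKb, hUe (cis t) (by rwa [norm_cis]), Complex.log_re]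
  have hlim1 : Tendsto (fun r : ℝ => Complex.log (1 - (r * z) ^ μ)) (𝓝[<] 1)
      (𝓝 (Complex.log (1 - z ^ μ))) := by
    have hs : 1 - ((1 : ℝ) * z) ^ μ ∈ Complex.slitPlane := by
      rw [sub_eq_add_neg]
      apply Complex.mem_slitPlane_of_norm_lt_one
      rw [norm_neg, norm_pow]
      refine pow_lt_one₀ (norm_nonneg _) (by simpa using hz) hμ0
    have hc : ContinuousAt (fun r : ℝ => Complex.log (1 - (r * z) ^ μ)) 1 :=
      ContinuousAt.clog (by fun_prop) hs
    have := hc.tendsto.mono_left (nhdsWithin_le_nhds (s := Set.Iio 1))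
    simpa using this
  have hlim2 : Tendsto (fun r : ℝ => circMean fun t =>
      bdry K t * (Real.log ‖1 - (r * cis t) ^ μ‖ : ℂ)) (𝓝[<] 1)
      (𝓝 (circMean fun t => bdry K t * (Real.log ‖1 - cis t ^ μ‖ : ℂ))) := by
    refine Tendsto.const_mul _ ?_
    -- The dilated norm is at most `2`, and by `norm_one_sub_le_two_mul` at least half of `|1 -
    -- e^{iμt}|`; this bounds its logarithm from both sides uniformly in `r`.
    refine tendsto_integral_filter_of_dominated_convergence
      (fun t => coeffNorm K * (Real.log 2 + |Real.log ‖1 - cis t ^ μ‖|)) ?_ ?_ ?_ ?_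
    · refine Eventually.of_forall fun r => hKc.aestronglyMeasurable.mul ?_
      exact (Complex.measurable_ofReal.comp (Real.measurable_log.comp
        (by fun_prop : Continuous fun t => ‖1 - (r * cis t) ^ μ‖).measurable)).aestronglyMeasurable
    · have hmem : Set.Ioo (0 : ℝ) 1 ∈ 𝓝[<] (1 : ℝ) := Ioo_mem_nhdsLT one_pos
      filter_upwards [hmem] with r hr
      filter_upwards [ae_restrict_of_ae (ae_cis_ne_one μ hμ)] with t ht
      rw [norm_mul, Complex.norm_real]
      refine mul_le_mul (hK.norm_bdry_le t) ?_ (norm_nonneg _) (coeffNorm_nonneg K)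
      have hx : ‖cis t ^ μ‖ ≤ 1 := by rw [norm_pow, norm_cis, one_pow]
      have hs0 : 0 ≤ r ^ μ := pow_nonneg hr.1.le _
      have hs1 : r ^ μ ≤ 1 := pow_le_one₀ hr.1.le hr.2.le
      have hle := norm_one_sub_le_two_mul hs0 hs1 hx
      have hpos : 0 < ‖1 - cis t ^ μ‖ := norm_pos_iff.2 (sub_ne_zero.2 (Ne.symm ht))
      have heq : (r * cis t) ^ μ = ((r ^ μ : ℝ) : ℂ) * cis t ^ μ := by push_cast; ring
      rw [heq]
      have hpos2 : 0 < ‖1 - ((r ^ μ : ℝ) : ℂ) * cis t ^ μ‖ := by linarith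
      have hle2 : ‖1 - ((r ^ μ : ℝ) : ℂ) * cis t ^ μ‖ ≤ 2 := by
        refine (norm_sub_le _ _).trans ?_
        rw [norm_one, norm_mul, Complex.norm_real, Real.norm_of_nonneg hs0]
        nlinarith
      rw [Real.norm_eq_abs, abs_le]
      constructor
      · have h1 := Real.log_le_log hpos hle
        rw [Real.log_mul (by norm_num) hpos2.ne'] at h1
        have h2 := neg_abs_le (Real.log ‖1 - cis t ^ μ‖)
        linarith
      · have h1 := Real.log_le_log hpos2 hle2
        have h2 := abs_nonneg (Real.log ‖1 - cis t ^ μ‖)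
        linarith
    · exact (((integrable_const _).add (integrable_log_norm_one_sub μ).norm)).const_mul _
    · filter_upwards [ae_restrict_of_ae (ae_cis_ne_one μ hμ)] with t ht
      refine Tendsto.const_mul _ ?_
      have hc : ContinuousAt (fun r : ℝ => ((Real.log ‖1 - (r * cis t) ^ μ‖ : ℝ) : ℂ)) 1 := by
        refine Complex.continuous_ofReal.continuousAt.comp ?_
        refine ContinuousAt.log (by fun_prop) ?_
        simpa [sub_eq_zero] using Ne.symm ht
      have := hc.tendsto.mono_left (nhdsWithin_le_nhds (s := Set.Iio 1))
      simpa using this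
  refine tendsto_nhds_unique (hlim2.congr' ?_) hlim1
  filter_upwards [Ioo_mem_nhdsLT (one_pos : (0 : ℝ) < 1)] with r hr
  exact hev r hr

/-- The factor `|1 - e^{-iλμ}|^{2n} / λ^{2n}`. -/
def transfer (n μ : ℕ) (t : ℝ) : ℝ := ‖1 - cis (-(t * μ))‖ ^ (2 * n) / t ^ (2 * n)

/-- The polynomial `1 + X + ⋯ + X^{μ-1}` as a power series. -/
def geomPoly (μ : ℕ) : PowerSeries ℂ := ((∑ i ∈ Finset.range μ, Polynomial.X ^ i : Polynomial ℂ) : PowerSeries ℂ)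

lemma absSummable_geomPoly (μ : ℕ) : AbsSummable (geomPoly μ) := absSummable_coe _

lemma ev_geomPoly_mul (μ : ℕ) (z : ℂ) : ev (geomPoly μ) z * (1 - z) = 1 - z ^ μ := by
  rw [geomPoly, ev_coe]
  simp only [Polynomial.eval_finsetSum, Polynomial.eval_pow, Polynomial.eval_X]
  exact geom_sum_mul_neg z μ

/-- The function `w_μ` is a polynomial with zeros on the unit circle, times an invertible element of
the algebra of absolutely summable power series; its boundary values have the prescribed modulus. -/
lemma exists_outer (n μ : ℕ) (hμ : 1 ≤ μ) :
    ∃ V V' : PowerSeries ℂ, AbsSummable V ∧ AbsSummable V' ∧ V * V' = 1 ∧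
      (∀ k, PowerSeries.coeff k (geomPoly μ ^ n * V) = wCoef n μ k) ∧
      ∀ᵐ t ∂volume.restrict freq, ‖bdry (geomPoly μ ^ n * V) t‖ ^ 2 = transfer n μ t := by
  obtain ⟨U, hU, hU0, hUre⟩ := exists_log_sinc
  obtain ⟨E, hE, hEev⟩ := hU.exists_exp
  obtain ⟨E', hE', hEev'⟩ := hU.neg.exists_exp
  have hP := absSummable_geomPoly μ
  have hEE : E * E' = 1 := by
    refine (hE.mul hE').eq_of_ev absSummable_one fun z hz => ?_
    rw [hE.ev_mul hE' hz.le, hEev z hz.le, hEev' z hz.le, ev_neg, ← Complex.exp_add, ev_one]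
    simp
  have hW : AbsSummable (geomPoly μ ^ n * E ^ n) := (hP.pow n).mul (hE.pow n)
  have hWev : ∀ z : ℂ, ‖z‖ ≤ 1 → ev (geomPoly μ ^ n * E ^ n) z
      = (ev (geomPoly μ) z * Complex.exp (ev U z)) ^ n := fun z hz => by
    rw [(hP.pow n).ev_mul (hE.pow n) hz, hP.ev_pow n hz, hE.ev_pow n hz, hEev z hz, mul_pow]
  -- The point `π` is discarded because the interval is half open and `-t` must also belong to it.
  have hae : ∀ᵐ t ∂volume.restrict freq, t ∈ freq ∧ t ≠ 0 ∧ t ≠ Real.pi ∧ cis t ^ μ ≠ 1 ∧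
      cis t ^ 1 ≠ 1 := by
    filter_upwards [ae_restrict_mem measurableSet_freq,
      ae_restrict_of_ae (Measure.ae_ne volume (0 : ℝ)),
      ae_restrict_of_ae (Measure.ae_ne volume Real.pi),
      ae_restrict_of_ae (ae_cis_ne_one μ hμ), ae_restrict_of_ae (ae_cis_ne_one 1 le_rfl)]
      with t h1 h2 h3 h4 h5
    exact ⟨h1, h2, h3, h4, h5⟩
  refine ⟨E ^ n, E' ^ n, hE.pow n, hE'.pow n, by rw [← mul_pow, hEE, one_pow], fun k => ?_, ?_⟩
  · rw [wCoef]
    refine hW.coeff_eq ?_ k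
    filter_upwards [Metric.ball_mem_nhds (0 : ℂ) one_pos] with z hz
    have hz : ‖z‖ < 1 := by simpa using hz
    rw [hWev z hz.le]
    obtain ⟨K, hK, -, hKb⟩ := herglotz_kernel hz
    have hKi : ∀ g : ℝ → ℝ, IntegrableOn g freq →
        IntegrableOn (fun t => (cis t + z) / (cis t - z) * (g t : ℂ)) freq := fun g hg => by
      simp_rw [← hKb]
      exact hg.ofReal.bdd_mul hK.continuous_bdry.aestronglyMeasurable
        (ae_of_all _ fun t => hK.norm_bdry_le t)
    have hUi : IntegrableOn (fun t => (ev U (cis t)).re) freq :=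
      integrable_freq_of_continuous (Complex.continuous_re.comp
        (hU.continuous_ev_comp (by fun_prop) norm_cis_le_one))
    have hsub : IntegrableOn (fun t => (cis t + z) / (cis t - z) * (Real.log ‖1 - cis t ^ μ‖ : ℂ) -
        (cis t + z) / (cis t - z) * (Real.log ‖1 - cis t ^ 1‖ : ℂ)) freq :=
      (hKi _ (integrable_log_norm_one_sub μ)).sub (hKi _ (integrable_log_norm_one_sub 1))
    -- Using `|t| sinc (t / 2) = |1 - e^{it}|`, the logarithm of the transfer factor is `2n (log |1
    -- - e^{iμt}| - log |1 - e^{it}| + log sinc (t / 2))`. The `2` is absorbed in passing from `1 /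
    -- 4π` to `1 / 2π`. After exponentiation the first two terms give the `n`th power of `(1 - z^μ)
    -- / (1 - z)`, a polynomial.
    have hexp : ((1 / (4 * Real.pi) : ℂ) * ∫ t in freq, (cis t + z) / (cis t - z)
        * (Real.log (‖1 - cis (-(t * μ))‖ ^ (2 * n) / t ^ (2 * n)) : ℂ)) =
        n * (Complex.log (1 - z ^ μ) - Complex.log (1 - z ^ 1) + ev U z) := by
      rw [← herglotz_log_one_sub μ hμ hz, ← herglotz_log_one_sub 1 le_rfl hz, ← hU.herglotz hU0 hz,
        ← circMean_sub (hKi _ (integrable_log_norm_one_sub μ)) (hKi _ (integrable_log_norm_one_sub 1)),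
        ← circMean_add hsub (hKi _ hUi), ← circMean_const_mul]
      have e : (1 / (4 * Real.pi) : ℂ) = (1 / (2 * Real.pi)) * (1 / 2) := by
        have := two_pi_ne_zero
        field_simp
        norm_num
      rw [circMean, e, mul_assoc, ← integral_const_mul]
      congr 1
      refine integral_congr_ae ?_
      filter_upwards [hae] with t ht
      obtain ⟨h1, h2, -, h4, h5⟩ := ht
      have ha : 0 < ‖1 - cis t ^ μ‖ := norm_pos_iff.2 (sub_ne_zero.2 (Ne.symm h4))
      have hs := sinc_half_pos (Set.Ioc_subset_Icc_self h1)
      have hb : ‖1 - cis t ^ 1‖ = |t| * Real.sinc (t / 2) := by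
        rw [pow_one, norm_one_sub_cis, abs_of_pos hs]
      have ht0 : |t| ≠ 0 := by simpa using h2
      rw [hUre t h1, hb, norm_one_sub_cis_pow, Real.log_div (pow_pos ha _).ne' (pow_ne_zero _ h2),
        Real.log_pow, Real.log_pow, Real.log_mul ht0 hs.ne', Real.log_abs]
      push_cast
      ring
    rw [wFun, hexp, Complex.exp_nat_mul, Complex.exp_add, Complex.exp_sub]
    have hz1 : 1 - z ≠ 0 := by
      intro h
      have : ‖z‖ = 1 := by rw [← sub_eq_zero.1 h, norm_one]
      linarith
    have hzμ : 1 - z ^ μ ≠ 0 := by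
      intro h
      have h1 : ‖z ^ μ‖ = 1 := by rw [← sub_eq_zero.1 h, norm_one]
      have h2 : ‖z ^ μ‖ < 1 := by
        rw [norm_pow]
        exact pow_lt_one₀ (norm_nonneg _) hz (by omega)
      linarith
    rw [pow_one, Complex.exp_log hz1, Complex.exp_log hzμ, ← ev_geomPoly_mul,
      mul_div_cancel_right₀ _ hz1]
  · filter_upwards [hae] with t ht
    obtain ⟨h1, h2, h3, -, h5⟩ := ht
    have hneg : -t ∈ freq := ⟨by have := lt_of_le_of_ne h1.2 h3; linarith, by linarith [h1.1]⟩
    have hs := sinc_half_pos (Set.Ioc_subset_Icc_self h1)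
    have hs' := sinc_half_pos (Set.Ioc_subset_Icc_self hneg)
    have hb : ‖1 - cis (-t)‖ = |t| * Real.sinc (-t / 2) := by
      rw [norm_one_sub_cis, abs_neg, abs_of_pos hs']
    have hne : |t| ≠ 0 := by simpa using h2
    rw [bdry, hWev _ (norm_cis_le_one _), norm_pow, norm_mul, Complex.norm_exp, hUre _ hneg,
      Real.exp_log hs', transfer, ← pow_mul, mul_comm n 2, ← Even.pow_abs (even_two_mul n) t, ← div_pow]
    congr 1
    have h6 := congrArg norm (ev_geomPoly_mul μ (cis (-t)))
    rw [norm_mul, hb] at h6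
    have h7 : cis (-(t * μ)) = cis (-t) ^ μ := by rw [← cis_nat_mul]; ring_nf
    rw [h7, ← h6]
    field_simp

/-! ### The coefficients of the functional -/

lemma bCoef_eq_zero (n μ N : ℕ) (a : ℕ → ℂ) {k : ℕ} (hk : N < k) : bCoef n μ N a k = 0 := by
  rw [bCoef, Finset.Icc_eq_empty (by omega), Finset.sum_empty]

lemma bCoef_eq_sum (n μ N : ℕ) (a : ℕ → ℂ) (k : ℕ) :
    bCoef n μ N a k = ∑ m ∈ Finset.range (N + 1), if k ≤ m then a m * dCoef n μ (m - k) else 0 := by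
  rw [bCoef, ← Finset.sum_filter]
  refine Finset.sum_congr ?_ fun _ _ => rfl
  ext m
  simp only [Finset.mem_Icc, Finset.mem_filter, Finset.mem_range]
  omega

/-- The power series `(∑ X^{μ j})ⁿ`. -/
def dSeries (n μ : ℕ) : PowerSeries ℂ :=
  (PowerSeries.mk fun j => if μ ∣ j then (1 : ℂ) else 0) ^ n

lemma geomSeries_one (μ : ℕ) :
    geomSeries μ 1 = PowerSeries.mk fun j => if μ ∣ j then (1 : ℂ) else 0 := by
  simp [geomSeries]

/-- The binomial sum is `(1 - X^μ)^n`, and `dSeries` is the `n`th power of the geometric series in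
`X^μ`: differencing inverts the summation built into `d_μ`. -/
lemma sum_binom_mul_dSeries (n μ : ℕ) (hμ : 1 ≤ μ) :
    (∑ l ∈ Finset.range (n + 1), PowerSeries.C ((-1 : ℂ) ^ l * (n.choose l : ℂ)) *
      PowerSeries.X ^ (l * μ)) * dSeries n μ = 1 := by
  have h1 : (∑ l ∈ Finset.range (n + 1), PowerSeries.C ((-1 : ℂ) ^ l * (n.choose l : ℂ)) *
      PowerSeries.X ^ (l * μ)) = (1 - PowerSeries.X ^ μ : PowerSeries ℂ) ^ n := by
    rw [sub_eq_neg_add, add_pow]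
    refine Finset.sum_congr rfl fun l _ => ?_
    rw [one_pow, mul_one, neg_pow (PowerSeries.X ^ μ) l, ← pow_mul, mul_comm μ l, map_mul, map_pow, map_neg, map_one,
      map_natCast]
    ring
  have h2 := geomSeries_mul μ hμ 1
  rw [geomSeries_one, map_one, one_mul] at h2
  rw [h1, dSeries, ← mul_pow, mul_comm, h2, one_pow]

lemma sum_binom_dCoef (n μ : ℕ) (hμ : 1 ≤ μ) (q : ℕ) :
    ∑ l ∈ Finset.range (n + 1), (if l * μ ≤ q then
      (-1 : ℂ) ^ l * (n.choose l : ℂ) * dCoef n μ (q - l * μ) else 0) = if q = 0 then 1 else 0 := by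
  have h := congrArg (PowerSeries.coeff q) (sum_binom_mul_dSeries n μ hμ)
  rw [Finset.sum_mul, map_sum, PowerSeries.coeff_one] at h
  rw [← h]
  refine Finset.sum_congr rfl fun l _ => ?_
  rw [mul_assoc (PowerSeries.C _), PowerSeries.coeff_C_mul, PowerSeries.coeff_X_pow_mul']
  split_ifs
  · rfl
  · simp

/-- The sequence `b` is `a` summed against `d_μ`, and the `n`th difference with step `μ` undoes this
summation. -/
lemma sum_binom_bCoef (n μ N : ℕ) (hμ : 1 ≤ μ) (a : ℕ → ℂ) {p : ℕ} (hp : p ≤ N) :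
    ∑ l ∈ Finset.range (n + 1), (-1 : ℂ) ^ l * (n.choose l : ℂ) * bCoef n μ N a (p + l * μ) = a p := by
  simp_rw [bCoef_eq_sum, Finset.mul_sum]
  rw [Finset.sum_comm, Finset.sum_eq_single p]
  · have h := sum_binom_dCoef n μ hμ 0
    rw [if_pos rfl] at h
    have h2 := congrArg (fun x => a p * x) h
    simp only [mul_one, Finset.mul_sum] at h2
    refine Eq.trans (Finset.sum_congr rfl fun l _ => ?_) h2
    by_cases hl : l * μ = 0
    · simp [hl]
      ring
    · rw [if_neg (by omega), if_neg (by omega)]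
      ring
  · intro m _ hm
    rcases lt_or_ge m p with h | h
    · refine Finset.sum_eq_zero fun l _ => ?_
      rw [if_neg (by have := Nat.zero_le (l * μ); omega), mul_zero]
    · have h1 := congrArg (fun x => a m * x) (sum_binom_dCoef n μ hμ (m - p))
      simp only [if_neg (show m - p ≠ 0 by omega), mul_zero, Finset.mul_sum] at h1
      refine Eq.trans (Finset.sum_congr rfl fun l _ => ?_) h1
      by_cases hl : l * μ ≤ m - p
      · rw [if_pos (by omega), if_pos hl, Nat.sub_add_eq]
        ring
      · rw [if_neg (by omega), if_neg hl]
        ring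
  · intro h
    exact absurd (Finset.mem_range.2 (by omega)) h

lemma sum_range_shift (N d : ℕ) (g : ℕ → ℂ) (hg : ∀ k, N < k → g k = 0) :
    ∑ k ∈ Finset.range (N + 1), (if d ≤ k then g k else 0)
      = ∑ p ∈ Finset.range (N + 1), g (p + d) := by
  have h1 : ∑ p ∈ Finset.range (N + 1), g (p + d) = ∑ k ∈ Finset.Ico d (d + (N + 1)), g k := by
    rw [Finset.sum_Ico_eq_sum_range]
    simp [add_comm]
  rw [h1, ← Finset.sum_filter]
  refine Finset.sum_subset (fun k hk => ?_) fun k hk hk' => hg k ?_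
  · simp only [Finset.mem_filter, Finset.mem_range, Finset.mem_Ico] at hk ⊢
    omega
  · simp only [Finset.mem_filter, Finset.mem_range, Finset.mem_Ico] at hk hk'
    omega

/-- This handles the terms of the increments that reach back to negative times. The substitution `i
= d - k` relabels them by the distance to the origin; the indices `N < k < d` cost nothing because
`b` vanishes there. -/
lemma sum_range_reflect' (N d L : ℕ) (hd : d ≤ L) (b : ℕ → ℂ) (hb : ∀ k, N < k → b k = 0)
    (x : ℤ → ℂ) :
    ∑ k ∈ Finset.range (N + 1), (if d ≤ k then 0 else b k * x (k - d))
      = ∑ i ∈ Finset.Icc 1 L, if i ≤ d then b (d - i) * x (-i) else 0 := by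
  have h1 : ∑ k ∈ Finset.range (N + 1), (if d ≤ k then 0 else b k * x (k - d))
      = ∑ k ∈ Finset.range d, b k * x (k - d) := by
    have : ∀ k : ℕ, (if d ≤ k then 0 else b k * x (k - d))
        = if k < d then b k * x (k - d) else 0 := fun k => by
      by_cases h : d ≤ k
      · rw [if_pos h, if_neg (by omega)]
      · rw [if_neg h, if_pos (by omega)]
    simp_rw [this]
    rw [← Finset.sum_filter]
    refine Finset.sum_subset (fun k hk => ?_) fun k hk hk' => ?_
    · simp only [Finset.mem_filter, Finset.mem_range] at hk ⊢
      omega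
    · simp only [Finset.mem_filter, Finset.mem_range] at hk hk'
      rw [hb k (by omega), zero_mul]
  rw [h1, ← Finset.sum_filter]
  refine Finset.sum_nbij' (fun k => d - k) (fun i => d - i) ?_ ?_ ?_ ?_ ?_
  · intro k hk
    simp only [Finset.mem_filter, Finset.mem_range, Finset.mem_Icc] at hk ⊢
    omega
  · intro k hk
    simp only [Finset.mem_filter, Finset.mem_range, Finset.mem_Icc] at hk ⊢
    omega
  · intro k hk
    simp only [Finset.mem_range] at hk
    omega
  · intro k hk
    simp only [Finset.mem_filter, Finset.mem_Icc] at hk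
    omega
  · intro k hk
    simp only [Finset.mem_range] at hk
    rw [Nat.sub_sub_self hk.le]
    congr 2
    push_cast [hk.le]
    ring

/-- `A_N ξ + ∑ v_{μ,N}(-i) ξ(-i) = ∑ b_{μ,N}(k) ξ⁽ⁿ⁾(k, μ)`. -/
lemma functional_add_eq {Ω : Type u} (n μ N : ℕ) (hμ : 1 ≤ μ) (a : ℕ → ℂ) (ξ : ℤ → Ω → ℂ) (ω : Ω) :
    functional N a ξ ω + ∑ i ∈ Finset.Icc 1 (μ * n), vCoef n μ N a i * ξ (-(i : ℤ)) ω =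
      ∑ k ∈ Finset.range (N + 1), bCoef n μ N a k * increment n ξ k μ ω := by
  -- The values `ξ (k - l μ)` are split by the sign of the argument: the nonnegative times
  -- reassemble to the functional with weights `a`, the negative ones to the initial values with
  -- weights `v`.
  have h1 : ∑ k ∈ Finset.range (N + 1), bCoef n μ N a k * increment n ξ k μ ω =
      ∑ l ∈ Finset.range (n + 1), (-1 : ℂ) ^ l * (n.choose l : ℂ) *
        ((∑ k ∈ Finset.range (N + 1), if l * μ ≤ k then
          bCoef n μ N a k * ξ (k - (l * μ : ℕ)) ω else 0) +
        ∑ k ∈ Finset.range (N + 1), if l * μ ≤ k then 0 else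
          bCoef n μ N a k * ξ (k - (l * μ : ℕ)) ω) := by
    simp_rw [increment, Finset.mul_sum]
    rw [Finset.sum_comm]
    refine Finset.sum_congr rfl fun l _ => ?_
    rw [← Finset.sum_add_distrib, Finset.mul_sum]
    refine Finset.sum_congr rfl fun k _ => ?_
    push_cast
    split_ifs <;> ring
  have h2 : ∀ l ∈ Finset.range (n + 1),
      (∑ k ∈ Finset.range (N + 1), if l * μ ≤ k then
          bCoef n μ N a k * ξ (k - (l * μ : ℕ)) ω else 0) =
        ∑ p ∈ Finset.range (N + 1), bCoef n μ N a (p + l * μ) * ξ p ω := by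
    intro l _
    rw [sum_range_shift N (l * μ) (fun k => bCoef n μ N a k * ξ (k - (l * μ : ℕ)) ω)
      fun k hk => by rw [bCoef_eq_zero n μ N a hk, zero_mul]]
    refine Finset.sum_congr rfl fun p _ => ?_
    push_cast
    rw [add_sub_cancel_right]
  have h3 : ∀ l ∈ Finset.range (n + 1),
      (∑ k ∈ Finset.range (N + 1), if l * μ ≤ k then 0 else
          bCoef n μ N a k * ξ (k - (l * μ : ℕ)) ω) =
        ∑ i ∈ Finset.Icc 1 (μ * n), if i ≤ l * μ then
          bCoef n μ N a (l * μ - i) * ξ (-(i : ℤ)) ω else 0 := by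
    intro l hl
    refine sum_range_reflect' N (l * μ) (μ * n) ?_ (bCoef n μ N a)
      (fun k hk => bCoef_eq_zero n μ N a hk) fun m => ξ m ω
    rw [mul_comm]
    exact Nat.mul_le_mul_left _ (by simpa [Nat.lt_succ_iff] using hl)
  have h4 := Finset.sum_congr rfl fun l hl =>
    congrArg (fun x => (-1 : ℂ) ^ l * (n.choose l : ℂ) * x) (congrArg₂ (· + ·) (h2 l hl) (h3 l hl))
  rw [h1, h4]
  simp_rw [mul_add, Finset.sum_add_distrib, Finset.mul_sum]
  congr 1
  · rw [Finset.sum_comm, functional]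
    refine Finset.sum_congr rfl fun p hp => ?_
    rw [← sum_binom_bCoef n μ N hμ a (show p ≤ N by simpa [Nat.lt_succ_iff] using hp), Finset.sum_mul]
    refine Finset.sum_congr rfl fun l _ => by ring
  · rw [Finset.sum_comm]
    refine Finset.sum_congr rfl fun i _ => ?_
    rw [vCoef, Finset.sum_mul]
    refine Finset.sum_congr rfl fun l _ => ?_
    split_ifs <;> ring

/-! ### The mean square error in the spectral domain -/

/-- The trigonometric polynomial `∑ b_{μ,N}(k) e^{ikt} - ∑ c_j e^{-i(j+1)t}`. -/
def errPoly (n μ N : ℕ) (a : ℕ → ℂ) (c : ℕ →₀ ℂ) (t : ℝ) : ℂ :=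
  ∑ k ∈ Finset.range (N + 1), bCoef n μ N a k * cis (k * t)
    - c.sum fun j x => x * cis (-((j + 1) * t))

/-- The mean square error of a linear estimate, in terms of the spectral density. -/
def spectralError (n μ N : ℕ) (a : ℕ → ℂ) (f : ℝ → ℝ) (c : ℕ →₀ ℂ) : ℝ :=
  1 / (2 * Real.pi) * ∫ t in freq, ‖errPoly n μ N a c t‖ ^ 2 * transfer n μ t * f t

lemma continuous_errPoly (n μ N : ℕ) (a : ℕ → ℂ) (c : ℕ →₀ ℂ) : Continuous (errPoly n μ N a c) := by
  unfold errPoly Finsupp.sum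
  fun_prop

lemma norm_one_sub_cis_neg_mul_le (s t : ℝ) : ‖1 - cis (-(s * t))‖ ≤ |s| * |t| := by
  simpa [abs_mul] using norm_one_sub_cis_le (-(s * t))

lemma transfer_nonneg (n μ : ℕ) (t : ℝ) : 0 ≤ transfer n μ t :=
  div_nonneg (by positivity) ((even_two_mul n).pow_nonneg t)

/-- The chord estimate `|1 - e^{-itμ}| ≤ μ |t|` cancels the denominator. Boundedness makes the
weighted integrals finite for every merely integrable density. -/
lemma transfer_le (n μ : ℕ) (t : ℝ) : transfer n μ t ≤ (μ : ℝ) ^ (2 * n) := by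
  rw [transfer]
  refine div_le_of_le_mul₀ ((even_two_mul n).pow_nonneg t) (by positivity) ?_
  rw [← (even_two_mul n).pow_abs t, ← mul_pow]
  gcongr
  have := norm_one_sub_cis_neg_mul_le t μ
  rwa [Nat.abs_cast, mul_comm |t|] at this

lemma measurable_transfer (n μ : ℕ) : Measurable (transfer n μ) := by
  unfold transfer
  exact ((by fun_prop : Continuous fun t : ℝ => ‖1 - cis (-(t * μ))‖ ^ (2 * n)).measurable).div
    (by fun_prop)

lemma integrable_mul_transfer {n μ : ℕ} {f : ℝ → ℝ} (hf : IntegrableOn f freq) {g : ℝ → ℝ}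
    (hg : Continuous g) : IntegrableOn (fun t => g t * transfer n μ t * f t) freq := by
  obtain ⟨C, hC⟩ := (isCompact_Icc (a := -Real.pi) (b := Real.pi)).exists_bound_of_continuousOn
    hg.continuousOn
  refine hf.bdd_mul (c := C * (μ : ℝ) ^ (2 * n))
    (hg.measurable.mul (measurable_transfer n μ)).aestronglyMeasurable ?_
  filter_upwards [ae_restrict_mem measurableSet_freq] with t ht
  have h1 := hC t (Set.Ioc_subset_Icc_self ht)
  rw [norm_mul, Real.norm_of_nonneg (transfer_nonneg n μ t)]
  exact mul_le_mul h1 (transfer_le n μ t) (transfer_nonneg n μ t) ((norm_nonneg _).trans h1)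

lemma one_sub_cis_pow_mul (n μ : ℕ) (t : ℝ) :
    (1 - cis (-(((μ : ℤ) : ℝ) * t))) ^ n * (1 - cis (((μ : ℤ) : ℝ) * t)) ^ n / (t : ℂ) ^ (2 * n)
      = (transfer n μ t : ℂ) := by
  have h : 1 - cis (((μ : ℤ) : ℝ) * t) = star (1 - cis (-(((μ : ℤ) : ℝ) * t))) := by
    rw [star_sub, star_one, star_cis, neg_neg]
  rw [h, ← mul_pow, ← starRingEnd_apply, Complex.mul_conj, Complex.normSq_eq_norm_sq, transfer]
  push_cast
  rw [← pow_mul, mul_comm (μ : ℝ) t]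

/-- The second moment of a linear combination of increments. -/
lemma HasSpectralDensity.integral_norm_sq {Ω : Type u} [MeasurableSpace Ω] {n : ℕ} (μ : ℕ)
    {P : Measure Ω} {ξ : ℤ → Ω → ℂ} {f : ℝ → ℝ} (h : HasSpectralDensity n P ξ f)
    (hf : IntegrableOn f freq) {ι : Type*} (s : Finset ι) (x : ι → ℂ) (m : ι → ℤ) :
    ∫ ω, ‖∑ i ∈ s, x i * increment n ξ (m i) μ ω‖ ^ 2 ∂P =
      1 / (2 * Real.pi) * ∫ t in freq, ‖∑ i ∈ s, x i * cis (m i * t)‖ ^ 2 * transfer n μ t * f t := by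
  have key : ∀ z : ℂ, ((‖z‖ ^ 2 : ℝ) : ℂ) = z * star z := fun z => by
    rw [← starRingEnd_apply, Complex.mul_conj, Complex.normSq_eq_norm_sq]
  apply Complex.ofReal_injective
  rw [← integral_complex_ofReal, ← circMean_ofReal]
  have h1 : ∀ ω, ((‖∑ i ∈ s, x i * increment n ξ (m i) μ ω‖ ^ 2 : ℝ) : ℂ) =
      ∑ i ∈ s, ∑ j ∈ s, x i * star (x j) *
        (increment n ξ (m i) μ ω * star (increment n ξ (m j) μ ω)) := by
    intro ω
    rw [key, star_sum, Finset.sum_mul_sum]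
    refine Finset.sum_congr rfl fun i _ => Finset.sum_congr rfl fun j _ => ?_
    rw [star_mul']
    ring
  have h2 : ∀ t : ℝ, ((‖∑ i ∈ s, x i * cis (m i * t)‖ ^ 2 * transfer n μ t * f t : ℝ) : ℂ) =
      ∑ i ∈ s, ∑ j ∈ s, x i * star (x j) *
        ((cis (((m i - m j : ℤ) : ℝ) * t)) * (transfer n μ t : ℂ) * (f t : ℂ)) := by
    intro t
    rw [Complex.ofReal_mul, Complex.ofReal_mul, key, star_sum, Finset.sum_mul_sum, Finset.sum_mul,
      Finset.sum_mul]
    refine Finset.sum_congr rfl fun i _ => ?_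
    rw [Finset.sum_mul, Finset.sum_mul]
    refine Finset.sum_congr rfl fun j _ => ?_
    rw [star_mul', star_cis]
    push_cast
    rw [sub_mul, cis_sub]
    ring
  have hint : ∀ i j, Integrable (fun ω => increment n ξ (m i) μ ω *
      star (increment n ξ (m j) μ ω)) P := fun i j =>
    (h.memLp (m i) μ).integrable_mul (h.memLp (m j) μ).star
  have hint2 : ∀ i j, IntegrableOn (fun t => cis (((m i - m j : ℤ) : ℝ) * t) * (transfer n μ t : ℂ) *
      (f t : ℂ)) freq := by
    intro i j
    have h3 := (integrable_mul_transfer (n := n) (μ := μ) hf (g := fun _ => 1) (by fun_prop)).ofReal (𝕜 := ℂ)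
    have h4 : Integrable _ (volume.restrict freq) := h3.bdd_mul (c := 1)
      (by fun_prop : Continuous fun t : ℝ => cis (((m i - m j : ℤ) : ℝ) * t)).aestronglyMeasurable
      (ae_of_all _ fun t => norm_cis_le_one _)
    refine h4.congr (ae_of_all _ fun t => ?_)
    simp
    ring
  simp_rw [h1, h2]
  rw [integral_finsetSum _ fun i _ => integrable_finsetSum _ fun j _ => (hint i j).const_mul _,
    circMean_sum _ fun i _ => integrable_finsetSum _ fun j _ => (hint2 i j).const_mul _]
  refine Finset.sum_congr rfl fun i _ => ?_
  rw [integral_finsetSum _ fun j _ => (hint i j).const_mul _,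
    circMean_sum _ fun j _ => (hint2 i j).const_mul _]
  refine Finset.sum_congr rfl fun j _ => ?_
  rw [integral_const_mul, circMean_const_mul]
  congr 1
  have h5 := h.structural (m j) (m i - m j) μ μ
  rw [add_sub_cancel] at h5
  rw [h5, circMean]
  congr 1
  refine integral_congr_ae (ae_of_all _ fun t => ?_)
  simp only
  rw [← one_sub_cis_pow_mul]
  ring

/-- By `functional_add_eq` the error is a finite combination of increments only: weights `b(k)` at
the times `k ≥ 0` and `-c_j` at the times `-1 - j`. The disjoint sum of index sets treats both kinds
at once. -/
lemma integral_estimate_error {Ω : Type u} [MeasurableSpace Ω] {n μ N : ℕ} (hμ : 1 ≤ μ) {a : ℕ → ℂ}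
    {P : Measure Ω} {ξ : ℤ → Ω → ℂ} {f : ℝ → ℝ} (h : HasSpectralDensity n P ξ f)
    (hf : IntegrableOn f freq) (c : ℕ →₀ ℂ) :
    ∫ ω, ‖functional N a ξ ω - linearEstimate n μ N a ξ c ω‖ ^ 2 ∂P = spectralError n μ N a f c := by
  have h1 := h.integral_norm_sq μ hf ((Finset.range (N + 1)).disjSum c.support)
    (Sum.elim (bCoef n μ N a) fun j => -c j) (Sum.elim (fun k => (k : ℤ)) fun j => -1 - (j : ℤ))
  rw [spectralError]
  convert h1 using 2
  · funext ω
    congr 2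
    rw [Finset.sum_disjSum]
    simp only [Sum.elim_inl, Sum.elim_inr]
    rw [← functional_add_eq n μ N hμ, linearEstimate, Finsupp.sum]
    simp only [neg_mul, Finset.sum_neg_distrib]
    ring
  · congr 1
    funext t
    congr 4
    rw [Finset.sum_disjSum, errPoly, Finsupp.sum, sub_eq_add_neg, ← Finset.sum_neg_distrib]
    simp only [Sum.elim_inl, Sum.elim_inr, neg_mul]
    congr 1
    refine Finset.sum_congr rfl fun j _ => ?_
    congr 3
    push_cast
    ring

lemma optimalError_eq {Ω : Type u} [MeasurableSpace Ω] {n μ N : ℕ} (hμ : 1 ≤ μ) {a : ℕ → ℂ}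
    {P : Measure Ω} {ξ : ℤ → Ω → ℂ} {f : ℝ → ℝ} (h : HasSpectralDensity n P ξ f)
    (hf : IntegrableOn f freq) :
    optimalError n μ N a P ξ = ⨅ c, spectralError n μ N a f c := by
  rw [optimalError]
  simp_rw [integral_estimate_error hμ h hf]

/-! ### Existence of sequences with a given spectral density -/

lemma norm_one_sub_cis_pow_div_le (n : ℕ) (s t : ℝ) :
    ‖(1 - cis (-(s * t))) ^ n / (t : ℂ) ^ n‖ ≤ |s| ^ n := by
  rw [norm_div, norm_pow, norm_pow, Complex.norm_real, Real.norm_eq_abs]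
  refine div_le_of_le_mul₀ (by positivity) (by positivity) ?_
  rw [← mul_pow]
  gcongr
  exact norm_one_sub_cis_neg_mul_le s t

/-- Exponentials are eigenvectors of shifts, so the increment only multiplies by `(1 - e^{-isτ})^n`,
by the binomial theorem. -/
lemma increment_exponential {Ω : Type u} (n : ℕ) (A T : Ω → ℂ) (τ : Ω → ℝ) (m s : ℤ) (ω : Ω) :
    increment n (fun k ω => A ω * cis (k * τ ω) * T ω) m s ω =
      A ω * cis (m * τ ω) * (1 - cis (-(s * τ ω))) ^ n * T ω := by
  have h : (1 - cis (-(s * τ ω))) ^ n = ∑ l ∈ Finset.range (n + 1),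
      (-1 : ℂ) ^ l * (n.choose l : ℂ) * cis (-(s * τ ω)) ^ l := by
    rw [sub_eq_neg_add, add_pow]
    refine Finset.sum_congr rfl fun l _ => ?_
    rw [neg_pow (cis _) l, one_pow]
    ring
  rw [h, increment, Finset.mul_sum, Finset.sum_mul]
  refine Finset.sum_congr rfl fun l _ => ?_
  rw [← cis_nat_mul]
  have : cis (((m - l * s : ℤ) : ℝ) * τ ω) = cis (m * τ ω) * cis (l * -(s * τ ω)) := by
    rw [← cis_add]
    push_cast
    ring_nf
  rw [this]
  ring

/-- The normalized Lebesgue measure on the frequency interval. -/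
def freqMeasure : Measure ℝ := ENNReal.ofReal (1 / (2 * Real.pi)) • volume.restrict freq

instance isProbabilityMeasure_freqMeasure : IsProbabilityMeasure freqMeasure := by
  refine ⟨?_⟩
  rw [freqMeasure, Measure.smul_apply, Measure.restrict_apply_univ, volume_freq, smul_eq_mul,
    ← ENNReal.ofReal_mul (by positivity), one_div_mul_cancel (by positivity), ENNReal.ofReal_one]

lemma integral_freqMeasure (F : ℝ → ℂ) : ∫ t, F t ∂freqMeasure = circMean F := by
  rw [freqMeasure, integral_smul_measure, circMean, ENNReal.toReal_ofReal (by positivity),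
    Complex.real_smul]
  push_cast
  rfl

/-- Take independent uniform `θ` and `τ` on the interval and set `ξ(k) = e^{iθ} e^{ikτ} √f(τ) /
τ^n`. The random phase makes the increments centred, and averaging over `τ` gives the structural
function. The sequence itself may fail to be square integrable; its increments are, since `(1 -
e^{-isτ})^n` cancels the pole. Without such sequences least favorability would be vacuous; `ULift`
places them in the required universe. -/
lemma exists_hasSpectralDensity (n : ℕ) {f : ℝ → ℝ} (hf : IntegrableOn f freq)
    (hf0 : ∀ᵐ t ∂volume.restrict freq, 0 ≤ f t) :
    ∃ (Ω : Type u) (_ : MeasurableSpace Ω) (P : Measure Ω) (_ : IsProbabilityMeasure P)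
      (ξ : ℤ → Ω → ℂ), HasSpectralDensity n P ξ f := by
  let e : ℝ × ℝ ≃ᵐ ULift.{u} (ℝ × ℝ) := MeasurableEquiv.ulift.symm
  let m : Measure (ℝ × ℝ) := freqMeasure.prod freqMeasure
  let X : ℝ → ℂ := fun t => ((Real.sqrt (f t) : ℝ) : ℂ) / (t : ℂ) ^ n
  let ξ : ℤ → ULift.{u} (ℝ × ℝ) → ℂ := fun k ω =>
    cis ω.down.1 * cis (k * ω.down.2) * X ω.down.2
  have hinc : ∀ (k s : ℤ) (x : ℝ × ℝ), increment n ξ k s (e x) =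
      cis x.1 * (cis (k * x.2) * (1 - cis (-(s * x.2))) ^ n * X x.2) := fun k s x => by
    rw [show ξ = fun (k : ℤ) (ω : ULift.{u} (ℝ × ℝ)) => cis ω.down.1 * cis (k * ω.down.2) * X ω.down.2 from rfl]
    rw [increment_exponential n (fun ω : ULift.{u} (ℝ × ℝ) => cis ω.down.1) (fun ω => X ω.down.2)
      (fun ω => ω.down.2)]
    rw [show (e x).down = x from rfl]
    ring
  have hfm : AEStronglyMeasurable f freqMeasure :=
    hf.aestronglyMeasurable.smul_measure _
  have hXm : AEStronglyMeasurable X freqMeasure := by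
    refine (Complex.continuous_ofReal.comp_aestronglyMeasurable
      (Real.continuous_sqrt.comp_aestronglyMeasurable hfm)).mul ?_
    exact (by fun_prop : Measurable fun t : ℝ => ((t : ℂ) ^ n)).inv.aestronglyMeasurable
  have hmap : ∀ g : ULift.{u} (ℝ × ℝ) → ℂ, ∫ ω, g ω ∂(m.map e) = ∫ x, g (e x) ∂m := fun g =>
    e.measurableEmbedding.integral_map g
  have hYm : ∀ k s : ℤ, AEStronglyMeasurable
      (fun t : ℝ => cis (k * t) * (1 - cis (-(s * t))) ^ n * X t) freqMeasure := fun k s =>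
    (by fun_prop : Continuous fun t : ℝ => cis (k * t) * (1 - cis (-(s * t))) ^ n)
      |>.aestronglyMeasurable.mul hXm
  have hcm : AEStronglyMeasurable (fun x : ℝ × ℝ => cis x.1) m :=
    (by fun_prop : Continuous fun x : ℝ × ℝ => cis x.1).aestronglyMeasurable
  have hsq : ∀ᵐ t ∂freqMeasure, ((Real.sqrt (f t) : ℝ) : ℂ) * ((Real.sqrt (f t) : ℝ) : ℂ) = f t := by
    have : ∀ᵐ t ∂freqMeasure, 0 ≤ f t := Measure.ae_smul_measure hf0 _
    filter_upwards [this] with t ht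
    rw [← Complex.ofReal_mul, Real.mul_self_sqrt ht]
  refine ⟨ULift.{u} (ℝ × ℝ), inferInstance, m.map e,
    Measure.isProbabilityMeasure_map e.measurable.aemeasurable, ξ, ?_, ?_, ?_, ?_⟩
  · intro k
    refine (e.measurableEmbedding.aestronglyMeasurable_map_iff).2 ?_
    have h1 : AEStronglyMeasurable (fun x : ℝ × ℝ => cis x.1 * cis (k * x.2)) m :=
      (by fun_prop : Continuous fun x : ℝ × ℝ => cis x.1 * cis (k * x.2)).aestronglyMeasurable
    exact h1.mul hXm.comp_snd
  · intro k s
    refine (e.measurableEmbedding.memLp_map_measure_iff).2 ?_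
    have h1 : (increment n ξ k s ∘ e) =
        fun x => cis x.1 * (cis (k * x.2) * (1 - cis (-(s * x.2))) ^ n * X x.2) :=
      funext fun x => hinc k s x
    have hm : AEStronglyMeasurable (fun x : ℝ × ℝ =>
        cis x.1 * (cis (k * x.2) * (1 - cis (-(s * x.2))) ^ n * X x.2)) m :=
      hcm.mul (hYm k s).comp_snd
    rw [h1, memLp_two_iff_integrable_sq_norm hm]
    have h2 : Integrable (fun t => |(s : ℝ)| ^ (2 * n) * ‖f t‖) freqMeasure :=
      ((hf.norm.smul_measure ENNReal.ofReal_ne_top).const_mul _)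
    have h3 : Integrable (fun t : ℝ => ‖cis (k * t) * (1 - cis (-(s * t))) ^ n * X t‖ ^ 2)
        freqMeasure := by
      refine h2.mono' ((hYm k s).norm.pow 2) ?_
      filter_upwards [hsq] with t ht
      have h4 : cis (k * t) * (1 - cis (-(s * t))) ^ n * X t = cis (k * t) *
          ((1 - cis (-(s * t))) ^ n / (t : ℂ) ^ n) * ((Real.sqrt (f t) : ℝ) : ℂ) := by
        simp only [X]
        ring
      have h5 : ‖((Real.sqrt (f t) : ℝ) : ℂ)‖ ^ 2 = ‖f t‖ := by
        rw [sq, ← norm_mul, ht, Complex.norm_real]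
      rw [Real.norm_of_nonneg (by positivity), h4, norm_mul, norm_mul, norm_cis, one_mul, mul_pow,
        h5, mul_comm 2 n, pow_mul]
      gcongr
      exact norm_one_sub_cis_pow_div_le n s t
    refine (h3.comp_snd freqMeasure).congr (ae_of_all _ fun x => ?_)
    simp only [norm_mul, norm_cis, one_mul]
  · intro k s
    rw [hmap]
    simp_rw [hinc]
    rw [integral_prod_mul (fun t => cis t)
      (fun t => cis (k * t) * (1 - cis (-(s * t))) ^ n * X t), integral_freqMeasure]
    have := circMean_cis 1
    simp only [Int.cast_one, one_mul, one_ne_zero, if_false] at this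
    rw [this, zero_mul]
  · intro m₀ k s₁ s₂
    rw [hmap]
    have h1 : ∀ x : ℝ × ℝ, increment n ξ (m₀ + k) s₁ (e x) * star (increment n ξ m₀ s₂ (e x)) =
        1 * ((fun t => cis (k * t) * (1 - cis (-(s₁ * t))) ^ n * (1 - cis (s₂ * t)) ^ n /
          (t : ℂ) ^ (2 * n) * (((Real.sqrt (f t) : ℝ) : ℂ) * ((Real.sqrt (f t) : ℝ) : ℂ))) x.2) := by
      intro x
      have h2 := cis_mul_neg x.1
      have h3 := cis_mul_neg (m₀ * x.2)
      have h4 : cis (((m₀ + k : ℤ) : ℝ) * x.2) = cis (m₀ * x.2) * cis (k * x.2) := by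
        rw [← cis_add]
        push_cast
        ring_nf
      rw [hinc, hinc, h4]
      simp only [star_mul', star_pow, star_sub, star_one, star_cis, X, star_div₀, neg_neg,
        Complex.star_def, Complex.conj_ofReal]
      linear_combination (cis (m₀ * x.2) * cis (-(m₀ * x.2)) * cis (k * x.2) *
        (1 - cis (-(s₁ * x.2))) ^ n * (1 - cis (s₂ * x.2)) ^ n *
        (((Real.sqrt (f x.2) : ℝ) : ℂ) / (x.2 : ℂ) ^ n) ^ 2) * h2 + (cis (k * x.2) *
        (1 - cis (-(s₁ * x.2))) ^ n * (1 - cis (s₂ * x.2)) ^ n *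
        (((Real.sqrt (f x.2) : ℝ) : ℂ) / (x.2 : ℂ) ^ n) ^ 2) * h3
    simp_rw [h1]
    rw [integral_prod_mul (fun _ => (1 : ℂ)) (fun t => cis (k * t) * (1 - cis (-(s₁ * t))) ^ n *
      (1 - cis (s₂ * t)) ^ n / (t : ℂ) ^ (2 * n) *
      (((Real.sqrt (f t) : ℝ) : ℂ) * ((Real.sqrt (f t) : ℝ) : ℂ)))]
    have h5 : ∫ _t : ℝ, (1 : ℂ) ∂freqMeasure = 1 := by simp
    rw [h5, one_mul, ← circMean, ← integral_freqMeasure]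
    refine integral_congr_ae ?_
    filter_upwards [hsq] with t ht
    rw [ht]

/-! ### Reversed coefficient vectors -/

/-- The polynomial `∑_{k ≤ N} b(k) X^{N-k}` as a power series. -/
def revSeries (N : ℕ) (b : ℕ → ℂ) : PowerSeries ℂ :=
  PowerSeries.mk fun i => if i ≤ N then b (N - i) else 0

lemma coeff_revSeries (N : ℕ) (b : ℕ → ℂ) {j : ℕ} (hj : j ≤ N) :
    PowerSeries.coeff (N - j) (revSeries N b) = b j := by
  rw [revSeries, PowerSeries.coeff_mk, if_pos (Nat.sub_le _ _), Nat.sub_sub_self hj]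

/-- Reversing the index turns correlation sums `∑_{k ≥ j} b(k) q(k - j)` into Cauchy products, so
that upper triangular Toeplitz matrices become multiplications of power series. -/
lemma coeff_revSeries_mul (N : ℕ) (b : ℕ → ℂ) (q : PowerSeries ℂ) {j : ℕ} (hj : j ≤ N) :
    PowerSeries.coeff (N - j) (revSeries N b * q) =
      ∑ k ∈ Finset.range (N + 1), if j ≤ k then b k * PowerSeries.coeff (k - j) q else 0 := by
  rw [PowerSeries.coeff_mul, Finset.Nat.sum_antidiagonal_eq_sum_range_succ
    (fun i l => PowerSeries.coeff i (revSeries N b) * PowerSeries.coeff l q), ← Finset.sum_filter]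
  refine Finset.sum_nbij' (fun i => N - i) (fun k => N - k) ?_ ?_ ?_ ?_ ?_
  · intro i hi
    simp only [Finset.mem_range, Finset.mem_filter] at hi ⊢
    omega
  · intro k hk
    simp only [Finset.mem_range, Finset.mem_filter] at hk ⊢
    omega
  · intro i hi
    simp only [Finset.mem_range] at hi
    omega
  · intro k hk
    simp only [Finset.mem_range, Finset.mem_filter] at hk
    omega
  · intro i hi
    simp only [Finset.mem_range] at hi
    rw [revSeries, PowerSeries.coeff_mk, if_pos (by omega)]
    congr 3
    omega

lemma coeff_mul_congr {p p' : PowerSeries ℂ} (q : PowerSeries ℂ) {m : ℕ}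
    (h : ∀ i ≤ m, PowerSeries.coeff i p = PowerSeries.coeff i p') :
    PowerSeries.coeff m (p * q) = PowerSeries.coeff m (p' * q) := by
  rw [PowerSeries.coeff_mul, PowerSeries.coeff_mul]
  refine Finset.sum_congr rfl fun x hx => ?_
  rw [h x.1 (Finset.HasAntidiagonal.antidiagonal.fst_le hx)]

lemma coeff_revSeries_congr {N : ℕ} {b : ℕ → ℂ} {p : PowerSeries ℂ}
    (h : ∀ j ≤ N, b j = PowerSeries.coeff (N - j) p) {i : ℕ} (hi : i ≤ N) :
    PowerSeries.coeff i (revSeries N b) = PowerSeries.coeff i p := by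
  rw [revSeries, PowerSeries.coeff_mk, if_pos hi, h _ (Nat.sub_le _ _), Nat.sub_sub_self hi]

lemma coeff_dSeries (n μ k : ℕ) : PowerSeries.coeff k (dSeries n μ) = dCoef n μ k := rfl

lemma bCoef_eq_coeff (n μ N : ℕ) (a : ℕ → ℂ) {k : ℕ} (hk : k ≤ N) :
    bCoef n μ N a k = PowerSeries.coeff (N - k) (revSeries N a * dSeries n μ) := by
  rw [coeff_revSeries_mul N a _ hk, bCoef_eq_sum]
  rfl

/-- The power series with coefficients `w_μ(k)`. -/
def wSeries (n μ : ℕ) : PowerSeries ℂ := PowerSeries.mk (wCoef n μ)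

lemma phiMu_eq_coeff (n μ N : ℕ) (φ : ℕ → ℂ) (j : Fin (N + 1)) :
    phiMu n μ N (truncate N φ) j =
      PowerSeries.coeff j (wSeries n μ * PowerSeries.mk φ) := by
  have hj : (j : ℕ) < N + 1 := j.2
  rw [mul_comm, PowerSeries.coeff_mul, Finset.Nat.sum_antidiagonal_eq_sum_range_succ
    (fun i l => PowerSeries.coeff i (PowerSeries.mk φ) * PowerSeries.coeff l (wSeries n μ))]
  have h1 : phiMu n μ N (truncate N φ) j =
      ∑ k ∈ Finset.range (N + 1), if k ≤ (j : ℕ) then wCoef n μ (j - k) * φ k else 0 := by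
    rw [← Fin.sum_univ_eq_sum_range (fun k => if k ≤ (j : ℕ) then wCoef n μ (j - k) * φ k else 0)]
    simp only [phiMu, matW, Matrix.mulVec, dotProduct, Matrix.of_apply, truncate, ite_mul, zero_mul,
      Fin.le_def]
  rw [h1, ← Finset.sum_filter]
  refine (Finset.sum_congr ?_ fun k _ => ?_)
  · ext k
    simp only [Finset.mem_range, Finset.mem_filter]
    omega
  · simp [wSeries, mul_comm]

/-- In reversed indexing `A_N` is multiplication by the reversed `a` and `D_N^μ` multiplication by
`dSeries`. By commutativity these two merge into the reversed `b`, leaving the product with `w_μ φ`.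
Truncation at `N` is harmless because a coefficient of index at most `N` of a product only sees
coefficients of index at most `N`. -/
lemma rVec_eq_coeff (n μ N : ℕ) (a φ : ℕ → ℂ) (j : Fin (N + 1)) :
    rVec n μ N a (phiMu n μ N (truncate N φ)) j = PowerSeries.coeff (N - j)
      (revSeries N (bCoef n μ N a) * (wSeries n μ * PowerSeries.mk φ)) := by
  set G := wSeries n μ * PowerSeries.mk φ with hG
  have hA : ∀ k : Fin (N + 1), (matA N a).mulVec (phiMu n μ N (truncate N φ)) k =
      PowerSeries.coeff (N - k) (revSeries N a * G) := by
    intro k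
    have hk : (k : ℕ) ≤ N := Nat.lt_succ_iff.1 k.2
    have h1 : (matA N a).mulVec (phiMu n μ N (truncate N φ)) k = ∑ i ∈ Finset.range (N + 1),
        if (k : ℕ) + i ≤ N then a (k + i) * PowerSeries.coeff i G else 0 := by
      rw [← Fin.sum_univ_eq_sum_range
        (fun i => if (k : ℕ) + i ≤ N then a (k + i) * PowerSeries.coeff i G else 0)]
      simp only [Matrix.mulVec, dotProduct, matA, Matrix.of_apply, phiMu_eq_coeff, ← hG, ite_mul,
        zero_mul]
    rw [h1, coeff_revSeries_mul N a G hk, ← Finset.sum_filter, ← Finset.sum_filter]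
    refine Finset.sum_nbij' (fun i => k + i) (fun i => i - k) ?_ ?_ ?_ ?_ ?_
    · intro i hi
      simp only [Finset.mem_range, Finset.mem_filter] at hi ⊢
      omega
    · intro i hi
      simp only [Finset.mem_range, Finset.mem_filter] at hi ⊢
      omega
    · intro i _
      simp
    · intro i hi
      simp only [Finset.mem_range, Finset.mem_filter] at hi
      omega
    · intro i _
      simp
  have hj : (j : ℕ) ≤ N := Nat.lt_succ_iff.1 j.2
  have hD : rVec n μ N a (phiMu n μ N (truncate N φ)) j = PowerSeries.coeff (N - j)
      (revSeries N (fun k => PowerSeries.coeff (N - k) (revSeries N a * G)) * dSeries n μ) := by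
    rw [coeff_revSeries_mul _ _ _ hj, ← Fin.sum_univ_eq_sum_range (fun k => if (j : ℕ) ≤ k then
      PowerSeries.coeff (N - k) (revSeries N a * G) * PowerSeries.coeff (k - j) (dSeries n μ) else 0),
      rVec, ← Matrix.mulVec_mulVec]
    rw [Matrix.mulVec, dotProduct]
    refine Finset.sum_congr rfl fun k _ => ?_
    rw [hA, matD, Matrix.of_apply]
    by_cases h : j ≤ k
    · rw [if_pos h, if_pos (Fin.le_def.1 h), coeff_dSeries, mul_comm]
    · rw [if_neg h, if_neg (fun h' => h (Fin.le_def.2 h')), zero_mul]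
  rw [hD, coeff_mul_congr (p' := revSeries N a * G) (dSeries n μ) fun i hi =>
      coeff_revSeries_congr (fun _ _ => rfl) (hi.trans (Nat.sub_le _ _)),
    coeff_mul_congr (p' := revSeries N a * dSeries n μ) G fun i hi =>
      coeff_revSeries_congr (fun _ hk => bCoef_eq_coeff n μ N a hk) (hi.trans (Nat.sub_le _ _))]
  congr 1
  ring

/-- The coefficients of the error of the optimal estimate. -/
def rSeq (n μ N : ℕ) (a φ : ℕ → ℂ) (j : ℕ) : ℂ :=
  PowerSeries.coeff (N - j) (revSeries N (bCoef n μ N a) * (wSeries n μ * PowerSeries.mk φ))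

/-- The trigonometric polynomial with coefficients `rSeq`. -/
def rPoly (n μ N : ℕ) (a φ : ℕ → ℂ) (t : ℝ) : ℂ :=
  ∑ k ∈ Finset.range (N + 1), rSeq n μ N a φ k * cis (k * t)

lemma continuous_rPoly (n μ N : ℕ) (a φ : ℕ → ℂ) : Continuous (rPoly n μ N a φ) := by
  unfold rPoly
  fun_prop

lemma rPoly_eq (n μ N : ℕ) (a φ : ℕ → ℂ) (t : ℝ) : rPoly n μ N a φ t =
    ∑ k : Fin (N + 1), rVec n μ N a (phiMu n μ N (truncate N φ)) k * cis t ^ (k : ℕ) := by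
  simp_rw [rVec_eq_coeff]
  rw [rPoly, ← Fin.sum_univ_eq_sum_range (fun k => rSeq n μ N a φ k * cis (k * t))]
  refine Finset.sum_congr rfl fun k _ => ?_
  rw [cis_nat_mul]
  rfl

lemma objective_eq (n μ N : ℕ) (a φ : ℕ → ℂ) : objective n μ N a (truncate N φ) =
    ∑ k ∈ Finset.range (N + 1), ‖rSeq n μ N a φ k‖ ^ 2 := by
  rw [objective, ← Fin.sum_univ_eq_sum_range (fun k => ‖rSeq n μ N a φ k‖ ^ 2)]
  refine Finset.sum_congr rfl fun k _ => ?_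
  rw [rVec_eq_coeff]
  rfl

/-! ### Square integrable functions on the frequency interval -/

/-- The mean `(1/2π) ∫ F` of a real function over the frequency interval. -/
def realMean (F : ℝ → ℝ) : ℝ := 1 / (2 * Real.pi) * ∫ t in freq, F t

lemma ofReal_realMean (F : ℝ → ℝ) : ((realMean F : ℝ) : ℂ) = circMean fun t => (F t : ℂ) :=
  (circMean_ofReal F).symm

lemma ofReal_norm_sq (z : ℂ) : ((‖z‖ ^ 2 : ℝ) : ℂ) = z * star z := by
  rw [← starRingEnd_apply, Complex.mul_conj, Complex.normSq_eq_norm_sq]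

lemma realMean_nonneg {F : ℝ → ℝ} (h : ∀ᵐ t ∂volume.restrict freq, 0 ≤ F t) : 0 ≤ realMean F :=
  mul_nonneg (by positivity) (integral_nonneg_of_ae h)

lemma realMean_congr_ae {F G : ℝ → ℝ} (h : ∀ᵐ t ∂volume.restrict freq, F t = G t) :
    realMean F = realMean G := by
  rw [realMean, realMean, integral_congr_ae h]

lemma ae_eq_zero_of_realMean_nonpos {F : ℝ → ℝ} (hF : IntegrableOn F freq)
    (h : ∀ᵐ t ∂volume.restrict freq, 0 ≤ F t) (h0 : realMean F ≤ 0) :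
    ∀ᵐ t ∂volume.restrict freq, F t = 0 := by
  have h1 : ∫ t in freq, F t = 0 := by
    refine le_antisymm ?_ (integral_nonneg_of_ae h)
    by_contra hc
    push Not at hc
    have : 0 < realMean F := mul_pos (by positivity) hc
    linarith
  exact (integral_eq_zero_iff_of_nonneg_ae h hF).1 h1

lemma tendsto_realMean {F : ℕ → ℝ → ℝ} {G B : ℝ → ℝ}
    (hF : ∀ m, AEStronglyMeasurable (F m) (volume.restrict freq)) (hB : IntegrableOn B freq)
    (hb : ∀ m, ∀ᵐ t ∂volume.restrict freq, ‖F m t‖ ≤ B t)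
    (hl : ∀ᵐ t ∂volume.restrict freq, Tendsto (fun m => F m t) atTop (𝓝 (G t))) :
    Tendsto (fun m => realMean (F m)) atTop (𝓝 (realMean G)) :=
  (tendsto_integral_of_dominated_convergence B hF hB hb hl).const_mul _

/-- Pythagoras for the distance to the projection on finitely many exponentials. -/
lemma realMean_norm_sub_sq {F : ℝ → ℂ} (hF : MemLp F 2 (volume.restrict freq)) (N : ℕ) (r : ℕ → ℂ)
    (hr : ∀ j ≤ N, circMean (fun t => F t * cis (-(j * t))) = r j) :
    realMean (fun t => ‖F t - ∑ j ∈ Finset.range (N + 1), r j * cis (j * t)‖ ^ 2) =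
      realMean (fun t => ‖F t‖ ^ 2) - ∑ j ∈ Finset.range (N + 1), ‖r j‖ ^ 2 := by
  set R : ℝ → ℂ := fun t => ∑ j ∈ Finset.range (N + 1), r j * cis (j * t) with hR
  have hRc : Continuous R := by
    rw [hR]
    fun_prop
  have hRL : MemLp R 2 (volume.restrict freq) := by
    rw [memLp_two_iff_integrable_sq_norm hRc.aestronglyMeasurable]
    exact integrable_freq_of_continuous (by fun_prop)
  have hFF : IntegrableOn (fun t => F t * star (F t)) freq := hF.integrable_mul hF.star
  have hFR : IntegrableOn (fun t => F t * star (R t)) freq := hF.integrable_mul hRL.star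
  have hRF : IntegrableOn (fun t => R t * star (F t)) freq := hRL.integrable_mul hF.star
  have hRR : IntegrableOn (fun t => R t * star (R t)) freq := hRL.integrable_mul hRL.star
  have hstarR : ∀ t, star (R t) = ∑ j ∈ Finset.range (N + 1), star (r j) * cis (-(j * t)) := by
    intro t
    simp only [hR, star_sum, star_mul', star_cis]
  -- This is applied to `F` and to its projection `R`, which have the same coefficients `r j`; hence
  -- `⟨F, R⟩ = ⟨R, R⟩`.
  have key : ∀ G : ℝ → ℂ, MemLp G 2 (volume.restrict freq) →
      (∀ j ≤ N, circMean (fun t => G t * cis (-(j * t))) = r j) →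
      circMean (fun t => G t * star (R t)) = ((∑ j ∈ Finset.range (N + 1), ‖r j‖ ^ 2 : ℝ) : ℂ) := by
    intro G hG hr
    have h1 : ∀ t, G t * star (R t) = ∑ j ∈ Finset.range (N + 1),
        star (r j) * (G t * cis (-(j * t))) := fun t => by
      rw [hstarR, Finset.mul_sum]
      exact Finset.sum_congr rfl fun j _ => by ring
    have hGi : ∀ j : ℕ, IntegrableOn (fun t => G t * cis (-(j * t))) freq := fun j =>
      (hG.integrable one_le_two).mul_bdd (c := 1)
        (by fun_prop : Continuous fun t : ℝ => cis (-(j * t))).aestronglyMeasurable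
        (ae_of_all _ fun t => norm_cis_le_one _)
    simp_rw [h1]
    rw [circMean_sum _ fun j _ => (hGi j).const_mul _, Complex.ofReal_sum]
    refine Finset.sum_congr rfl fun j hj => ?_
    rw [circMean_const_mul, hr j (Nat.lt_succ_iff.1 (Finset.mem_range.1 hj)), ofReal_norm_sq, mul_comm]
  have hRr : ∀ j ≤ N, circMean (fun t => R t * cis (-(j * t))) = r j := by
    intro j hj
    have h1 : ∀ t : ℝ, R t * cis (-(j * t)) = ∑ i ∈ Finset.range (N + 1),
        r i * cis (((i - j : ℤ) : ℝ) * t) := by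
      intro t
      simp only [hR, Finset.sum_mul]
      refine Finset.sum_congr rfl fun i _ => ?_
      rw [mul_assoc, ← cis_add]
      push_cast
      ring_nf
    simp_rw [h1]
    rw [circMean_sum _ fun i _ => integrable_freq_of_continuous (by fun_prop)]
    simp_rw [circMean_const_mul, circMean_cis]
    rw [Finset.sum_eq_single j]
    · simp
    · intro i _ hij
      rw [if_neg (by omega), mul_zero]
    · intro h
      exact absurd (Finset.mem_range.2 (by omega)) h
  have h1 := key F hF hr
  have h2 := key R hRL hRr
  have h3 : circMean (fun t => R t * star (F t)) =
      ((∑ j ∈ Finset.range (N + 1), ‖r j‖ ^ 2 : ℝ) : ℂ) := by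
    have h4 := congrArg star h1
    rw [circMean_star] at h4
    simp only [star_mul', star_star] at h4
    rw [← starRingEnd_apply, Complex.conj_ofReal] at h4
    rw [← h4]
    congr 1
    funext t
    rw [mul_comm]
  apply Complex.ofReal_injective
  rw [Complex.ofReal_sub, ofReal_realMean, ofReal_realMean]
  simp_rw [ofReal_norm_sq]
  have h5 : (fun t => (F t - R t) * star (F t - R t)) = fun t =>
      (F t * star (F t) - F t * star (R t)) - (R t * star (F t) - R t * star (R t)) := by
    funext t
    rw [star_sub]
    ring
  have hi1 : IntegrableOn (fun t => F t * star (F t) - F t * star (R t)) freq := hFF.sub hFR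
  have hi2 : IntegrableOn (fun t => R t * star (F t) - R t * star (R t)) freq := hRF.sub hRR
  rw [h5, circMean_sub hi1 hi2, circMean_sub hFF hFR, circMean_sub hRF hRR,
    h1, h2, h3]
  ring

/-! ### Lower bound for the mean square error -/

/-- Multiplication by absolutely convergent boundary values acts on the one-sided Fourier
coefficients of any integrable `g` as a Cauchy product, and one-sidedness is preserved. -/
lemma AbsSummable.circMean_bdry_mul {p : PowerSeries ℂ} (hp : AbsSummable p) {g : ℝ → ℂ}
    (hg : IntegrableOn g freq) {ψ : ℕ → ℂ}
    (hψ : ∀ k : ℤ, circMean (fun t => g t * cis (k * t)) = if 0 ≤ k then ψ k.toNat else 0) (k : ℤ) :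
    circMean (fun t => bdry p t * g t * cis (k * t)) =
      if 0 ≤ k then PowerSeries.coeff k.toNat (p * PowerSeries.mk ψ) else 0 := by
  have hgi : IntegrableOn (fun t => g t * cis (k * t)) freq := hg.mul_bdd (c := 1)
    (by fun_prop : Continuous fun t : ℝ => cis (k * t)).aestronglyMeasurable
    (ae_of_all _ fun t => norm_cis_le_one _)
  have h := hp.hasSum_circMean_bdry hgi
  have h1 : ∀ j : ℕ, circMean (fun t => cis (-(j * t)) * (g t * cis (k * t))) =
      if (j : ℤ) ≤ k then ψ (k - j).toNat else 0 := by
    intro j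
    have h2 := hψ (k - j)
    simp only [sub_nonneg] at h2
    rw [← h2]
    congr 1
    funext t
    have : cis (((k - j : ℤ) : ℝ) * t) = cis (-(j * t)) * cis (k * t) := by
      rw [← cis_add]
      push_cast
      ring_nf
    rw [this]
    ring
  simp_rw [h1, ← mul_assoc] at h
  rw [← h.tsum_eq]
  split_ifs with hk
  · obtain ⟨i, rfl⟩ := Int.eq_ofNat_of_zero_le hk
    rw [PowerSeries.coeff_mul, Finset.Nat.sum_antidiagonal_eq_sum_range_succ
      (fun j l => PowerSeries.coeff j p * PowerSeries.coeff l (PowerSeries.mk ψ)),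
      tsum_eq_sum (s := Finset.range ((i : ℤ).toNat + 1))]
    · refine Finset.sum_congr rfl fun j hj => ?_
      have hj' : j < i + 1 := by simpa using hj
      rw [if_pos (by omega), PowerSeries.coeff_mk]
      congr 2
      omega
    · intro j hj
      have hj' : i < j := by simpa using hj
      rw [if_neg (by omega), mul_zero]
  · have : ∀ j : ℕ, ¬ (j : ℤ) ≤ k := fun j hj => hk (by omega)
    simp [this]

/-- The Fourier coefficients of `errPoly · H` are `rSeq`. -/
lemma circMean_errPoly_mul {n μ N : ℕ} {a : ℕ → ℂ} {H : ℝ → ℂ} (hH : IntegrableOn H freq) {φ : ℕ → ℂ}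
    (hHc : ∀ k : ℤ, circMean (fun t => H t * cis (k * t)) =
      if 0 ≤ k then PowerSeries.coeff k.toNat (wSeries n μ * PowerSeries.mk φ) else 0)
    (c : ℕ →₀ ℂ) {j : ℕ} (hj : j ≤ N) :
    circMean (fun t => errPoly n μ N a c t * H t * cis (-(j * t))) = rSeq n μ N a φ j := by
  have hHi : ∀ k : ℤ, IntegrableOn (fun t => H t * cis (k * t)) freq := fun k => hH.mul_bdd (c := 1)
    (by fun_prop : Continuous fun t : ℝ => cis (k * t)).aestronglyMeasurable
    (ae_of_all _ fun t => norm_cis_le_one _)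
  have h1 : ∀ t, errPoly n μ N a c t * H t * cis (-(j * t)) =
      ∑ k ∈ Finset.range (N + 1), bCoef n μ N a k * (H t * cis (((k - j : ℤ) : ℝ) * t)) -
        ∑ i ∈ c.support, c i * (H t * cis (((-(i + 1) - j : ℤ) : ℝ) * t)) := by
    intro t
    rw [errPoly, Finsupp.sum, sub_mul, sub_mul, Finset.sum_mul, Finset.sum_mul, Finset.sum_mul,
      Finset.sum_mul]
    congr 1
    · refine Finset.sum_congr rfl fun k _ => ?_
      have : cis (((k - j : ℤ) : ℝ) * t) = cis (k * t) * cis (-(j * t)) := by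
        rw [← cis_add]
        push_cast
        ring_nf
      rw [this]
      ring
    · refine Finset.sum_congr rfl fun i _ => ?_
      have : cis (((-(i + 1) - j : ℤ) : ℝ) * t) = cis (-((i + 1) * t)) * cis (-(j * t)) := by
        rw [← cis_add]
        push_cast
        ring_nf
      rw [this]
      ring
  simp_rw [h1]
  rw [circMean_sub (integrable_finsetSum _ fun k _ => (hHi _).const_mul _)
    (integrable_finsetSum _ fun k _ => (hHi _).const_mul _),
    circMean_sum _ fun k _ => (hHi _).const_mul _, circMean_sum _ fun k _ => (hHi _).const_mul _]
  simp_rw [circMean_const_mul, hHc]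
  rw [rSeq, coeff_revSeries_mul _ _ _ hj]
  -- The factor `e^{-i(i+1)t}` shifts a function with only nonpositive frequencies strictly below
  -- zero, so the weights `c` cannot influence the coefficient at `e^{ijt}` with `j ≥ 0`.
  have h2 : ∀ i ∈ c.support, c i * (if 0 ≤ (-(i + 1) - j : ℤ) then PowerSeries.coeff
      (-(i + 1) - j : ℤ).toNat (wSeries n μ * PowerSeries.mk φ) else 0) = 0 := fun i _ => by
    rw [if_neg (by omega), mul_zero]
  rw [Finset.sum_eq_zero h2, sub_zero]
  refine Finset.sum_congr rfl fun k _ => ?_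
  by_cases h : j ≤ k
  · rw [if_pos (by omega), if_pos h]
    congr 3
    omega
  · rw [if_neg (by omega), if_neg h, mul_zero]

lemma memLp_mul_of_continuous {u : ℝ → ℂ} (hu : Continuous u) {g : ℝ → ℂ}
    (hg : MemLp g 2 (volume.restrict freq)) :
    MemLp (fun t => u t * g t) 2 (volume.restrict freq) := by
  obtain ⟨C, hC⟩ := (isCompact_Icc (a := -Real.pi) (b := Real.pi)).exists_bound_of_continuousOn
    hu.continuousOn
  refine hg.of_le_mul (c := C) (hu.aestronglyMeasurable.mul hg.1) ?_
  filter_upwards [ae_restrict_mem measurableSet_freq] with t ht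
  rw [norm_mul]
  gcongr
  exact hC t (Set.Ioc_subset_Icc_self ht)

lemma exists_wSeries (n μ : ℕ) (hμ : 1 ≤ μ) : ∃ V V' : PowerSeries ℂ, AbsSummable V ∧
    AbsSummable V' ∧ V * V' = 1 ∧ wSeries n μ = geomPoly μ ^ n * V ∧ AbsSummable (wSeries n μ) ∧
      ∀ᵐ t ∂volume.restrict freq, ‖bdry (wSeries n μ) t‖ ^ 2 = transfer n μ t := by
  obtain ⟨V, V', hV, hV', hVV, hc, hb⟩ := exists_outer n μ hμ
  have : wSeries n μ = geomPoly μ ^ n * V := by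
    ext k
    rw [hc, wSeries, PowerSeries.coeff_mk]
  rw [this]
  exact ⟨V, V', hV, hV', hVV, rfl, ((absSummable_geomPoly μ).pow n).mul hV, hb⟩

/-- The distance between `errPoly · w_μ · g` and the polynomial with coefficients `rSeq`. -/
lemma realMean_errPoly_sub {n μ N : ℕ} (hμ : 1 ≤ μ) {a : ℕ → ℂ} {f : ℝ → ℝ} {φ : ℕ → ℂ} {g : ℝ → ℂ}
    (hg : MemLp g 2 (volume.restrict freq))
    (hgc : ∀ k : ℤ, circMean (fun t => g t * cis (k * t)) = if 0 ≤ k then φ k.toNat else 0)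
    (hfg : ∀ᵐ t ∂volume.restrict freq, f t = ‖g t‖ ^ 2) (c : ℕ →₀ ℂ) :
    realMean (fun t => ‖errPoly n μ N a c t * (bdry (wSeries n μ) t * g t) - rPoly n μ N a φ t‖ ^ 2)
      = spectralError n μ N a f c - objective n μ N a (truncate N φ) := by
  obtain ⟨-, -, -, -, -, -, hW, hWb⟩ := exists_wSeries n μ hμ
  have hH : MemLp (fun t => bdry (wSeries n μ) t * g t) 2 (volume.restrict freq) :=
    memLp_mul_of_continuous hW.continuous_bdry hg
  have h := realMean_norm_sub_sq (memLp_mul_of_continuous (continuous_errPoly n μ N a c) hH) N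
    (rSeq n μ N a φ) fun j hj => circMean_errPoly_mul (hH.integrable one_le_two)
      (hW.circMean_bdry_mul (hg.integrable one_le_two) hgc) c hj
  rw [objective_eq]
  refine h.trans ?_
  congr 1
  rw [spectralError, ← realMean]
  refine realMean_congr_ae ?_
  filter_upwards [hWb, hfg] with t h1 h2
  rw [norm_mul, norm_mul, mul_pow, mul_pow, h1, h2, mul_assoc]

/-- The error exceeds the objective by a squared distance. No condition on zeros enters: any
square-integrable one-sided factor gives a lower bound for all estimates. -/
lemma objective_le_spectralError {n μ N : ℕ} (hμ : 1 ≤ μ) {a : ℕ → ℂ} {f : ℝ → ℝ} {φ : ℕ → ℂ}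
    (h : IsFactor φ f) (c : ℕ →₀ ℂ) :
    objective n μ N a (truncate N φ) ≤ spectralError n μ N a f c := by
  obtain ⟨g, hg, hgc, hfg⟩ := h
  have h1 := realMean_errPoly_sub (n := n) (N := N) (a := a) hμ hg hgc hfg c
  have h2 : 0 ≤ realMean (fun t => ‖errPoly n μ N a c t * (bdry (wSeries n μ) t * g t) -
      rPoly n μ N a φ t‖ ^ 2) := realMean_nonneg (ae_of_all _ fun t => by positivity)
  linarith

/-! ### Canonical factors as invertible power series -/

/-- The power series of a canonical factor. -/
lemma IsCanonicalFactor.absSummable {φ : ℕ → ℂ} {f : ℝ → ℝ} (h : IsCanonicalFactor φ f) :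
    AbsSummable (PowerSeries.mk φ) := by
  obtain ⟨r, hr, hs⟩ := h.radius
  refine Summable.of_nonneg_of_le (fun _ => norm_nonneg _) (fun k => ?_) hs
  rw [PowerSeries.coeff_mk]
  exact le_mul_of_one_le_right (norm_nonneg _) (one_le_pow₀ hr.le)

lemma ev_mk (φ : ℕ → ℂ) (z : ℂ) : ev (PowerSeries.mk φ) z = ∑' k, φ k * z ^ k := by
  simp [ev]

lemma IsCanonicalFactor.density_bdry {φ : ℕ → ℂ} {f : ℝ → ℝ} (h : IsCanonicalFactor φ f) :
    ∀ᵐ t ∂volume.restrict freq, f t = ‖bdry (PowerSeries.mk φ) t‖ ^ 2 := by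
  filter_upwards [h.density] with t ht
  rw [ht, bdry, ev_mk]

lemma IsCanonicalFactor.exists_inverse {φ : ℕ → ℂ} {f : ℝ → ℝ} (h : IsCanonicalFactor φ f) :
    ∃ q : PowerSeries ℂ, AbsSummable q ∧ PowerSeries.mk φ * q = 1 ∧
      ∃ r : ℝ, 1 < r ∧ Summable fun k => ‖PowerSeries.coeff k q‖ * r ^ k := by
  obtain ⟨r, hr, hs⟩ := h.radius
  obtain ⟨q, hq, r', hr', hs'⟩ := RobustExtrapolation.exists_inverse (p := PowerSeries.mk φ) hr
    (by simpa using hs) fun z hz => by rw [ev_mk]; exact h.zero_free z hz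
  refine ⟨q, ?_, hq, r', hr', hs'⟩
  refine Summable.of_nonneg_of_le (fun _ => norm_nonneg _) (fun k => ?_) hs'
  exact le_mul_of_one_le_right (norm_nonneg _) (one_le_pow₀ hr'.le)

lemma AbsSummable.memLp_bdry {p : PowerSeries ℂ} (hp : AbsSummable p) :
    MemLp (bdry p) 2 (volume.restrict freq) := by
  rw [memLp_two_iff_integrable_sq_norm hp.continuous_bdry.aestronglyMeasurable]
  have := hp.continuous_bdry
  exact integrable_freq_of_continuous (by fun_prop)

lemma IsCanonicalFactor.circMean_bdry {φ : ℕ → ℂ} {f : ℝ → ℝ} (h : IsCanonicalFactor φ f) (k : ℤ) :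
    circMean (fun t => bdry (PowerSeries.mk φ) t * cis (k * t)) =
      if 0 ≤ k then φ k.toNat else 0 := by
  rw [h.absSummable.circMean_bdry_mul_cis k, PowerSeries.coeff_mk]

lemma IsCanonicalFactor.isFactor {φ : ℕ → ℂ} {f : ℝ → ℝ} (h : IsCanonicalFactor φ f) :
    IsFactor φ f :=
  ⟨bdry (PowerSeries.mk φ), h.absSummable.memLp_bdry, h.circMean_bdry, h.density_bdry⟩

/-! ### Approximation of the optimal estimate -/

/-- The trigonometric polynomials of the form `∑_k r(k) e^{ikt} · ∑_{i<L} y(i) e^{-it}` are, up to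
their part with nonnegative frequencies, among the `errPoly`. -/
lemma exists_errPoly_eq (n μ N : ℕ) (a r y : ℕ → ℂ) (L : ℕ) :
    ∃ c : ℕ →₀ ℂ, ∀ t, errPoly n μ N a c t =
      (∑ k ∈ Finset.range (N + 1), r k * cis (k * t)) * (∑ i ∈ Finset.range L, y i * cis (-t) ^ i) +
      ∑ j ∈ Finset.range (N + 1), (bCoef n μ N a j - ∑ k ∈ Finset.range (N + 1),
        if j ≤ k ∧ k - j < L then r k * y (k - j) else 0) * cis (j * t) := by
  -- The product of the `k`th and `i`th terms with `k < i` has the frequency `k - i = -((i - k - 1)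
  -- + 1)`, hence the index `i - k - 1`; the sign compensates for the minus in `errPoly`.
  refine ⟨∑ k ∈ Finset.range (N + 1), ∑ i ∈ Finset.range L,
    if k < i then Finsupp.single (i - k - 1) (-(r k * y i)) else 0, fun t => ?_⟩
  have hlin : ∀ c : ℕ →₀ ℂ, (c.sum fun j x => x * cis (-((j + 1) * t))) =
      Finsupp.linearCombination ℂ (fun j : ℕ => cis (-((j + 1) * t))) c := fun c => by
    simp [Finsupp.linearCombination_apply]
  have hprod : ∀ k i : ℕ, r k * cis (k * t) * (y i * cis (-t) ^ i) =
      (if k < i then (r k * y i) * cis (-(((i - k - 1 : ℕ) + 1) * t)) else 0) +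
        if k < i then 0 else r k * y i * cis ((k - i : ℕ) * t) := by
    intro k i
    have h0 : cis (k * t) * cis (-t) ^ i = cis (((k : ℝ) - i) * t) := by
      rw [← cis_nat_mul, ← cis_add]
      ring_nf
    have h1 : r k * cis (k * t) * (y i * cis (-t) ^ i) = r k * y i * cis (((k : ℝ) - i) * t) := by
      rw [← h0]
      ring
    rw [h1]
    by_cases h : k < i
    · rw [if_pos h, if_pos h, add_zero]
      congr 2
      have : ((i - k - 1 : ℕ) : ℝ) = i - k - 1 := by
        rw [Nat.cast_sub (by omega), Nat.cast_sub h.le]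
        simp
      rw [this]
      ring
    · rw [if_neg h, if_neg h, zero_add, Nat.cast_sub (by omega)]
  have hsplit : (∑ k ∈ Finset.range (N + 1), r k * cis (k * t)) *
      (∑ i ∈ Finset.range L, y i * cis (-t) ^ i) =
      (∑ k ∈ Finset.range (N + 1), ∑ i ∈ Finset.range L,
        if k < i then (r k * y i) * cis (-(((i - k - 1 : ℕ) + 1) * t)) else 0) +
      ∑ k ∈ Finset.range (N + 1), ∑ i ∈ Finset.range L,
        if k < i then 0 else r k * y i * cis ((k - i : ℕ) * t) := by
    rw [Finset.sum_mul_sum, ← Finset.sum_add_distrib]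
    refine Finset.sum_congr rfl fun k _ => ?_
    rw [← Finset.sum_add_distrib]
    exact Finset.sum_congr rfl fun i _ => hprod k i
  have hpos : ∑ j ∈ Finset.range (N + 1), (∑ k ∈ Finset.range (N + 1),
        if j ≤ k ∧ k - j < L then r k * y (k - j) else 0) * cis (j * t) =
      ∑ k ∈ Finset.range (N + 1), ∑ i ∈ Finset.range L,
        if k < i then 0 else r k * y i * cis ((k - i : ℕ) * t) := by
    simp_rw [Finset.sum_mul]
    rw [Finset.sum_comm]
    refine Finset.sum_congr rfl fun k hk => ?_
    have hk' : k < N + 1 := Finset.mem_range.1 hk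
    have e1 : ∀ j : ℕ, (if j ≤ k ∧ k - j < L then r k * y (k - j) else 0) * cis (j * t) =
        if j ≤ k ∧ k - j < L then r k * y (k - j) * cis (j * t) else 0 := fun j => by
      rw [ite_mul, zero_mul]
    have e2 : ∀ i : ℕ, (if k < i then 0 else r k * y i * cis ((k - i : ℕ) * t)) =
        if i ≤ k then r k * y i * cis ((k - i : ℕ) * t) else 0 := fun i => by
      by_cases h : k < i
      · rw [if_pos h, if_neg (by omega)]
      · rw [if_neg h, if_pos (by omega)]
    simp_rw [e1, e2]
    rw [← Finset.sum_filter, ← Finset.sum_filter]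
    refine Finset.sum_nbij' (fun j => k - j) (fun i => k - i) ?_ ?_ ?_ ?_ ?_
    · intro j hj
      simp only [Finset.mem_range, Finset.mem_filter] at hj ⊢
      omega
    · intro j hj
      simp only [Finset.mem_range, Finset.mem_filter] at hj ⊢
      omega
    · intro j hj
      simp only [Finset.mem_range, Finset.mem_filter] at hj
      omega
    · intro j hj
      simp only [Finset.mem_range, Finset.mem_filter] at hj
      omega
    · intro j hj
      simp only [Finset.mem_range, Finset.mem_filter] at hj
      rw [Nat.sub_sub_self hj.2.1]
  rw [errPoly, hlin, map_sum, hsplit]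
  simp_rw [sub_mul, Finset.sum_sub_distrib]
  rw [hpos]
  have hneg : ∑ k ∈ Finset.range (N + 1), (Finsupp.linearCombination ℂ
      fun j : ℕ => cis (-((j + 1) * t))) (∑ i ∈ Finset.range L,
        if k < i then Finsupp.single (i - k - 1) (-(r k * y i)) else 0) =
      -∑ k ∈ Finset.range (N + 1), ∑ i ∈ Finset.range L,
        if k < i then (r k * y i) * cis (-(((i - k - 1 : ℕ) + 1) * t)) else 0 := by
    rw [← Finset.sum_neg_distrib]
    refine Finset.sum_congr rfl fun k _ => ?_
    rw [map_sum, ← Finset.sum_neg_distrib]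
    refine Finset.sum_congr rfl fun i _ => ?_
    split_ifs
    · rw [Finsupp.linearCombination_single, smul_eq_mul, neg_mul]
    · simp
  rw [hneg]
  ring

/-- Coefficientwise convergence is compatible with products. -/
lemma tendsto_coeff_mul {p q : ℕ → PowerSeries ℂ} {p' q' : PowerSeries ℂ}
    (hp : ∀ i, Tendsto (fun m => PowerSeries.coeff i (p m)) atTop (𝓝 (PowerSeries.coeff i p')))
    (hq : ∀ i, Tendsto (fun m => PowerSeries.coeff i (q m)) atTop (𝓝 (PowerSeries.coeff i q')))
    (i : ℕ) : Tendsto (fun m => PowerSeries.coeff i (p m * q m)) atTop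
      (𝓝 (PowerSeries.coeff i (p' * q'))) := by
  simp_rw [PowerSeries.coeff_mul]
  exact tendsto_finsetSum _ fun x _ => (hp x.1).mul (hq x.2)

lemma tendsto_coeff_pow {p : ℕ → PowerSeries ℂ} {p' : PowerSeries ℂ}
    (hp : ∀ i, Tendsto (fun m => PowerSeries.coeff i (p m)) atTop (𝓝 (PowerSeries.coeff i p')))
    (n : ℕ) : ∀ i, Tendsto (fun m => PowerSeries.coeff i (p m ^ n)) atTop
      (𝓝 (PowerSeries.coeff i (p' ^ n))) := by
  induction n with
  | zero => simp
  | succ n ih =>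
    intro i
    simp_rw [pow_succ]
    exact tendsto_coeff_mul ih hp i

lemma ev_geomSeries_mul {μ : ℕ} (hμ : 1 ≤ μ) {s : ℝ} (hs0 : 0 < s) (hs1 : s < 1) {z : ℂ}
    (hz : ‖z‖ ≤ 1) : ev (geomSeries μ s) z * (1 - s * z ^ μ) = 1 := by
  have h1 := geomSeries_mul μ hμ (s : ℂ)
  set p : Polynomial ℂ := 1 - Polynomial.C (s : ℂ) * Polynomial.X ^ μ with hp
  have h2 : (p : PowerSeries ℂ) = 1 - PowerSeries.C (s : ℂ) * PowerSeries.X ^ μ := by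
    simp [hp]
  rw [← h2] at h1
  have h3 := (absSummable_geomSeries μ hμ hs0 hs1).ev_mul (absSummable_coe p) hz
  rw [h1, ev_one, ev_coe] at h3
  have h4 : p.eval z = 1 - s * z ^ μ := by simp [hp]
  rw [h4] at h3
  exact h3.symm

lemma AbsSummable.exists_trunc {p : PowerSeries ℂ} (hp : AbsSummable p) {ε : ℝ} (hε : 0 < ε)
    (L₀ : ℕ) : ∃ L ≥ L₀, ∀ z : ℂ, ‖z‖ ≤ 1 →
      ‖ev p z - ∑ i ∈ Finset.range L, PowerSeries.coeff i p * z ^ i‖ ≤ ε := by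
  have h1 := hp.summable.hasSum.tendsto_sum_nat
  have h2 : ∀ᶠ L in atTop, coeffNorm p - ∑ i ∈ Finset.range L, ‖PowerSeries.coeff i p‖ < ε := by
    have h3 := (tendsto_const_nhds (x := coeffNorm p)).sub h1
    rw [← coeffNorm, sub_self] at h3
    exact h3.eventually (gt_mem_nhds hε)
  obtain ⟨L, hL0, hL⟩ := ((eventually_ge_atTop L₀).and h2).exists
  refine ⟨L, hL0, fun z hz => ?_⟩
  have h4 : ∑ i ∈ Finset.range L, PowerSeries.coeff i p * z ^ i +
      ∑' i, PowerSeries.coeff (i + L) p * z ^ (i + L) = ev p z :=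
    Summable.sum_add_tsum_nat_add (f := fun i => PowerSeries.coeff i p * z ^ i) L
      (hp.norm_term hz).of_norm
  have h5 : ∑ i ∈ Finset.range L, ‖PowerSeries.coeff i p‖ +
      ∑' i, ‖PowerSeries.coeff (i + L) p‖ = coeffNorm p :=
    Summable.sum_add_tsum_nat_add (f := fun i => ‖PowerSeries.coeff i p‖) L hp.summable
  have h6 : Summable fun i => ‖PowerSeries.coeff (i + L) p * z ^ (i + L)‖ :=
    (summable_nat_add_iff (f := fun i => ‖PowerSeries.coeff i p * z ^ i‖) L).2 (hp.norm_term hz)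
  have h7 : Summable fun i => ‖PowerSeries.coeff (i + L) p‖ :=
    (summable_nat_add_iff (f := fun i => ‖PowerSeries.coeff i p‖) L).2 hp.summable
  rw [← h4, add_sub_cancel_left]
  have h8 : ‖∑' i, PowerSeries.coeff (i + L) p * z ^ (i + L)‖ ≤
      ∑' i, ‖PowerSeries.coeff (i + L) p‖ :=
    (norm_tsum_le_tsum_norm h6).trans (h6.tsum_le_tsum (fun i => norm_term_le p hz _) h7)
  linarith

/-- The error polynomials of suitable estimates, multiplied by `w_μ`, converge boundedly to the
quotient of `rPoly` by the canonical factor. -/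
lemma exists_tendsto_errPoly (n μ N : ℕ) (hμ : 1 ≤ μ) (a φ : ℕ → ℂ) {q : PowerSeries ℂ}
    (hq : AbsSummable q) (hφq : PowerSeries.mk φ * q = 1) :
    ∃ (c : ℕ → ℕ →₀ ℂ) (C : ℝ), (∀ m t, ‖errPoly n μ N a (c m) t * bdry (wSeries n μ) t‖ ≤ C) ∧
      ∀ᵐ t ∂volume.restrict freq, Tendsto (fun m => errPoly n μ N a (c m) t * bdry (wSeries n μ) t)
        atTop (𝓝 (rPoly n μ N a φ t * bdry q t)) := by
  obtain ⟨V, V', hV, hV', hVV, hWV, hW, -⟩ := exists_wSeries n μ hμ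
  have hP := absSummable_geomPoly μ
  -- The inverse of `w_μ` contains `(1 - z^μ)^{-n}`, which is singular on the circle. It is replaced
  -- by `(1 - s z^μ)^{-n}` with `s < 1` tending to `1`.
  set s : ℕ → ℝ := fun m => 1 - 1 / ((m : ℝ) + 2) with hs
  have hs0 : ∀ m, 0 < s m := fun m => by
    have : 1 / ((m : ℝ) + 2) < 1 := by
      rw [div_lt_one (by positivity)]
      have : (0 : ℝ) ≤ m := by positivity
      linarith
    simp only [hs]
    linarith
  have hs1 : ∀ m, s m < 1 := fun m => by
    have : 0 < 1 / ((m : ℝ) + 2) := by positivity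
    simp only [hs]
    linarith
  have hslim : Tendsto s atTop (𝓝 1) := by
    have h1 : Tendsto (fun m : ℕ => 1 / ((m : ℝ) + 2)) atTop (𝓝 0) := by
      have := (tendsto_add_atTop_iff_nat 2).2 (tendsto_one_div_atTop_nhds_zero_nat (𝕜 := ℝ))
      refine this.congr fun m => ?_
      push_cast
      rfl
    have h2 := (tendsto_const_nhds (x := (1 : ℝ))).sub h1
    rw [sub_zero] at h2
    exact h2
  set x1 : PowerSeries ℂ := ((1 - Polynomial.X : Polynomial ℂ) : PowerSeries ℂ) with hx1
  have hx1s : AbsSummable x1 := absSummable_coe _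
  have hx1e : ∀ z, ev x1 z = 1 - z := fun z => by rw [hx1, ev_coe]; simp
  have hg := fun m => absSummable_geomSeries μ hμ (hs0 m) (hs1 m)
  -- `Y m` approximates `1 / (w_μ Φ)`, since `w_μ = ((1 - z^μ) / (1 - z))^n V` and `V'`, `q` invert
  -- `V`, `Φ`. Its formal limit `Y'` is the exact inverse.
  set Y : ℕ → PowerSeries ℂ := fun m => x1 ^ n * geomSeries μ (s m) ^ n * V' * q with hY
  have hYs : ∀ m, AbsSummable (Y m) := fun m =>
    (((hx1s.pow n).mul ((hg m).pow n)).mul hV').mul hq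
  set Y' : PowerSeries ℂ := x1 ^ n * geomSeries μ 1 ^ n * V' * q with hY'
  have hYlim : ∀ i, Tendsto (fun m => PowerSeries.coeff i (Y m)) atTop
      (𝓝 (PowerSeries.coeff i Y')) := by
    have hc : ∀ p : PowerSeries ℂ, ∀ i, Tendsto (fun _ : ℕ => PowerSeries.coeff i p) atTop
        (𝓝 (PowerSeries.coeff i p)) := fun p i => tendsto_const_nhds
    refine tendsto_coeff_mul (tendsto_coeff_mul (tendsto_coeff_mul (hc _)
      (tendsto_coeff_pow (fun i => ?_) n)) (hc _)) (hc _)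
    simp only [geomSeries, PowerSeries.coeff_mk]
    split_ifs
    · have h1 : Tendsto (fun m => ((s m : ℝ) : ℂ)) atTop (𝓝 1) := by
        have h := (Complex.continuous_ofReal.tendsto 1).comp hslim
        rw [Complex.ofReal_one] at h
        exact h
      exact h1.pow _
    · exact tendsto_const_nhds
  have hGY : wSeries n μ * PowerSeries.mk φ * Y' = 1 := by
    have h1 : x1 * geomPoly μ * geomSeries μ 1 = 1 := by
      have h2 : x1 * geomPoly μ = 1 - PowerSeries.C 1 * PowerSeries.X ^ μ := by
        have h3 := congrArg (fun p : Polynomial ℂ => (p : PowerSeries ℂ))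
          (mul_neg_geom_sum (Polynomial.X : Polynomial ℂ) μ)
        simp only [Polynomial.coe_mul] at h3
        rw [hx1, geomPoly, h3]
        simp
      rw [h2, mul_comm, geomSeries_mul μ hμ 1]
    calc wSeries n μ * PowerSeries.mk φ * Y' =
        (x1 * geomPoly μ * geomSeries μ 1) ^ n * (V * V') * (PowerSeries.mk φ * q) := by
          rw [hWV, hY']
          ring
      _ = 1 := by rw [h1, hVV, hφq, one_pow, one_mul, one_mul]
  set b := bCoef n μ N a with hb
  set r := rSeq n μ N a φ with hr
  -- With the exact inverse the part of `R Y'` at the frequencies `0, …, N` is precisely `∑ b(j)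
  -- e^{ijt}`, so in the limit no correction is needed to obtain an admissible error polynomial.
  have hrY : ∀ j ≤ N, ∑ k ∈ Finset.range (N + 1),
      (if j ≤ k then r k * PowerSeries.coeff (k - j) Y' else 0) = b j := by
    intro j hj
    rw [← coeff_revSeries_mul N r Y' hj,
      coeff_mul_congr (p := revSeries N r) (p' := revSeries N b * (wSeries n μ * PowerSeries.mk φ)) Y' fun i hi =>
        coeff_revSeries_congr (fun _ _ => rfl) (hi.trans (Nat.sub_le _ _)),
      mul_assoc, hGY, mul_one, coeff_revSeries N b hj]
  -- The length at least `N + 1` makes the condition `k - j < L` automatic for all `k ≤ N`.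
  have htrunc : ∀ m : ℕ, ∃ L ≥ N + 1, ∀ z : ℂ, ‖z‖ ≤ 1 →
      ‖ev (Y m) z - ∑ i ∈ Finset.range L, PowerSeries.coeff i (Y m) * z ^ i‖ ≤ 1 / ((m : ℝ) + 1) :=
    fun m => (hYs m).exists_trunc (by positivity) (N + 1)
  choose L hLN hL using htrunc
  choose c hc using fun m => exists_errPoly_eq n μ N a r (fun i => PowerSeries.coeff i (Y m)) (L m)
  -- `D m j` is the mismatch with `b(j)` at frequency `j`. Only finitely many coefficients of `Y m`
  -- enter, so coefficientwise convergence makes it vanish in the limit.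
  set D : ℕ → ℕ → ℂ := fun m j => b j - ∑ k ∈ Finset.range (N + 1),
    if j ≤ k then r k * PowerSeries.coeff (k - j) (Y m) else 0 with hD
  have hDlim : ∀ j ≤ N, Tendsto (fun m => D m j) atTop (𝓝 0) := by
    intro j hj
    have h1 : Tendsto (fun m => D m j) atTop (𝓝 (b j - ∑ k ∈ Finset.range (N + 1),
        if j ≤ k then r k * PowerSeries.coeff (k - j) Y' else 0)) := by
      refine tendsto_const_nhds.sub (tendsto_finsetSum _ fun k _ => ?_)
      split_ifs
      · exact (hYlim _).const_mul _
      · exact tendsto_const_nhds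
    rwa [hrY j hj, sub_self] at h1
  set K : ℝ := ∑ k ∈ Finset.range (N + 1), ‖r k‖ with hK
  have hR : ∀ t, ‖rPoly n μ N a φ t‖ ≤ K := fun t => by
    rw [rPoly]
    refine (norm_sum_le _ _).trans (Finset.sum_le_sum fun k _ => ?_)
    rw [norm_mul, norm_cis, mul_one]
  have hK0 : 0 ≤ K := Finset.sum_nonneg fun _ _ => norm_nonneg _
  set d : ℕ → ℝ := fun m => K * (1 / ((m : ℝ) + 1)) + ∑ j ∈ Finset.range (N + 1), ‖D m j‖ with hd
  have hdlim : Tendsto d atTop (𝓝 0) := by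
    have h1 := (tendsto_one_div_add_atTop_nhds_zero_nat (𝕜 := ℝ)).const_mul K
    have h2 : Tendsto (fun m => ∑ j ∈ Finset.range (N + 1), ‖D m j‖) atTop
        (𝓝 (∑ _j ∈ Finset.range (N + 1), (0 : ℝ))) :=
      tendsto_finsetSum _ fun j hj => by
        simpa using (hDlim j (Nat.lt_succ_iff.1 (Finset.mem_range.1 hj))).norm
    have h3 := h1.add h2
    rw [mul_zero, Finset.sum_const_zero, add_zero] at h3
    exact h3
  have herr : ∀ m t, ‖errPoly n μ N a (c m) t - rPoly n μ N a φ t * bdry (Y m) t‖ ≤ d m := by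
    intro m t
    have h1 : errPoly n μ N a (c m) t - rPoly n μ N a φ t * bdry (Y m) t =
        -(rPoly n μ N a φ t * (ev (Y m) (cis (-t)) - ∑ i ∈ Finset.range (L m),
          PowerSeries.coeff i (Y m) * cis (-t) ^ i)) +
        ∑ j ∈ Finset.range (N + 1), D m j * cis (j * t) := by
      have h2 : ∀ j ∈ Finset.range (N + 1), (bCoef n μ N a j - ∑ k ∈ Finset.range (N + 1),
          if j ≤ k ∧ k - j < L m then r k * PowerSeries.coeff (k - j) (Y m) else 0) * cis (j * t)
            = D m j * cis (j * t) := by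
        intro j _
        congr 1
        simp only [hD]
        congr 1
        refine Finset.sum_congr rfl fun k hk => ?_
        have hk' : k < N + 1 := Finset.mem_range.1 hk
        have h3 : k - j < L m := lt_of_le_of_lt (Nat.sub_le _ _) (hk'.trans_le (hLN m))
        simp [h3]
      rw [hc, Finset.sum_congr rfl h2, bdry, rPoly]
      ring
    rw [h1]
    refine (norm_add_le _ _).trans ?_
    simp only [hd]
    refine add_le_add ?_ ?_
    · rw [norm_neg, norm_mul]
      exact mul_le_mul (hR t) (hL m _ (norm_cis_le_one _)) (norm_nonneg _) hK0
    · refine (norm_sum_le _ _).trans (Finset.sum_le_sum fun k _ => ?_)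
      rw [norm_mul, norm_cis, mul_one]
  -- On the circle `Y m · w_μ` equals `((1 - z^μ) / (1 - s z^μ))^n / Φ`: the zeros of `w_μ` keep it
  -- bounded, although `Y m` alone is not uniformly controlled.
  have hWY : ∀ m t, bdry (Y m) t * bdry (wSeries n μ) t * (1 - s m * cis (-t) ^ μ) ^ n =
      (1 - cis (-t) ^ μ) ^ n * bdry q t := by
    intro m t
    have hz := norm_cis_le_one (-t)
    simp only [bdry]
    rw [hWV, (hP.pow n).ev_mul hV hz, hP.ev_pow n hz, ← ev_geomPoly_mul]
    simp only [hY]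
    rw [(((hx1s.pow n).mul ((hg m).pow n)).mul hV').ev_mul hq hz,
      ((hx1s.pow n).mul ((hg m).pow n)).ev_mul hV' hz, (hx1s.pow n).ev_mul ((hg m).pow n) hz,
      hx1s.ev_pow n hz, (hg m).ev_pow n hz, hx1e]
    have h1 := ev_geomSeries_mul hμ (hs0 m) (hs1 m) hz
    have h2 : ev V (cis (-t)) * ev V' (cis (-t)) = 1 := by rw [← hV.ev_mul hV' hz, hVV, ev_one]
    calc _ = (ev (geomSeries μ (s m)) (cis (-t)) * (1 - s m * cis (-t) ^ μ)) ^ n *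
        (ev V (cis (-t)) * ev V' (cis (-t))) *
        ((ev (geomPoly μ) (cis (-t)) * (1 - cis (-t))) ^ n * ev q (cis (-t))) := by
            rw [mul_pow, mul_pow]; ring
      _ = _ := by rw [h1, h2, one_pow, one_mul, one_mul]
  have hne : ∀ m t, 1 - (s m : ℂ) * cis (-t) ^ μ ≠ 0 := by
    intro m t h
    have h1 : ‖(s m : ℂ) * cis (-t) ^ μ‖ = 1 := by rw [← sub_eq_zero.1 h, norm_one]
    rw [norm_mul, norm_pow, norm_cis, one_pow, mul_one, Complex.norm_real,
      Real.norm_of_nonneg (hs0 m).le] at h1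
    exact (hs1 m).ne h1
  have hWY' : ∀ m t, bdry (Y m) t * bdry (wSeries n μ) t =
      ((1 - cis (-t) ^ μ) / (1 - s m * cis (-t) ^ μ)) ^ n * bdry q t := by
    intro m t
    have := hWY m t
    rw [div_pow, div_mul_eq_mul_div, eq_div_iff (pow_ne_zero _ (hne m t)), this]
  have hdb := hdlim.bddAbove_range
  obtain ⟨dmax, hdmax⟩ := hdb
  have hdm : ∀ m, d m ≤ dmax := fun m => hdmax ⟨m, rfl⟩
  have hd0 : ∀ m, 0 ≤ d m := fun m => (norm_nonneg _).trans (herr m 0)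
  -- The quotient `(1 - z^μ) / (1 - s z^μ)` has modulus at most `2`, which accounts for `2 ^ n`; the
  -- second summand bounds the truncation and mismatch errors times `w_μ`.
  refine ⟨c, K * (2 ^ n * coeffNorm q) + dmax * coeffNorm (wSeries n μ), fun m t => ?_, ?_⟩
  · have h1 : errPoly n μ N a (c m) t * bdry (wSeries n μ) t =
        rPoly n μ N a φ t * (bdry (Y m) t * bdry (wSeries n μ) t) +
        (errPoly n μ N a (c m) t - rPoly n μ N a φ t * bdry (Y m) t) * bdry (wSeries n μ) t := by ring
    rw [h1]
    refine (norm_add_le _ _).trans (add_le_add ?_ ?_)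
    · rw [norm_mul, hWY', norm_mul, norm_pow]
      refine mul_le_mul (hR t) (mul_le_mul ?_ (hq.norm_bdry_le t) (norm_nonneg _) (by positivity))
        (by positivity) hK0
      refine pow_le_pow_left₀ (norm_nonneg _) ?_ n
      rw [norm_div, div_le_iff₀ (norm_pos_iff.2 (hne m t))]
      exact norm_one_sub_le_two_mul (hs0 m).le (hs1 m).le (by rw [norm_pow, norm_cis, one_pow])
    · rw [norm_mul]
      exact mul_le_mul ((herr m t).trans (hdm m)) (hW.norm_bdry_le t) (norm_nonneg _)
        ((hd0 m).trans (hdm m))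
  · filter_upwards [ae_restrict_of_ae (ae_cis_ne_one μ hμ)] with t ht
    have hz1 : 1 - cis (-t) ^ μ ≠ 0 := by
      intro h
      apply ht
      rw [sub_eq_zero, cis_neg, inv_pow, eq_comm, inv_eq_one] at h
      exact h
    have h1 : ∀ m, errPoly n μ N a (c m) t * bdry (wSeries n μ) t =
        rPoly n μ N a φ t * (((1 - cis (-t) ^ μ) / (1 - s m * cis (-t) ^ μ)) ^ n * bdry q t) +
        (errPoly n μ N a (c m) t - rPoly n μ N a φ t * bdry (Y m) t) * bdry (wSeries n μ) t := by
      intro m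
      rw [← hWY']
      ring
    simp_rw [h1]
    have h2 : Tendsto (fun m => (errPoly n μ N a (c m) t - rPoly n μ N a φ t * bdry (Y m) t))
        atTop (𝓝 0) := squeeze_zero_norm (fun m => herr m t) hdlim
    have h3 : Tendsto (fun m => ((1 - cis (-t) ^ μ) / (1 - (s m : ℂ) * cis (-t) ^ μ)) ^ n) atTop
        (𝓝 1) := by
      have h4 : Tendsto (fun m => ((s m : ℝ) : ℂ)) atTop (𝓝 1) := by
        have h := (Complex.continuous_ofReal.tendsto 1).comp hslim
        rw [Complex.ofReal_one] at h
        exact h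
      have h5 : Tendsto (fun m => (1 - (s m : ℂ) * cis (-t) ^ μ)) atTop
          (𝓝 (1 - 1 * cis (-t) ^ μ)) := tendsto_const_nhds.sub (h4.mul_const _)
      rw [one_mul] at h5
      have h6 := (tendsto_const_nhds (x := 1 - cis (-t) ^ μ)).div h5 hz1
      rw [div_self hz1] at h6
      simpa using h6.pow n
    have h7 := ((h3.mul_const (bdry q t)).const_mul (rPoly n μ N a φ t)).add
      (h2.mul_const (bdry (wSeries n μ) t))
    simpa using h7

/-! ### Optimality of the canonical factor and of the rational solutions -/

lemma realMean_const_mul (c : ℝ) (F : ℝ → ℝ) :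
    realMean (fun t => c * F t) = c * realMean F := by
  rw [realMean, realMean, integral_const_mul, mul_left_comm]

lemma spectralError_nonneg {n μ N : ℕ} {a : ℕ → ℂ} {f : ℝ → ℝ}
    (hf0 : ∀ᵐ t ∂volume.restrict freq, 0 ≤ f t) (c : ℕ →₀ ℂ) : 0 ≤ spectralError n μ N a f c := by
  refine realMean_nonneg ?_
  filter_upwards [hf0] with t ht
  exact mul_nonneg (mul_nonneg (by positivity) (transfer_nonneg n μ t)) ht

lemma bddBelow_spectralError {n μ N : ℕ} {a : ℕ → ℂ} {f : ℝ → ℝ}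
    (hf0 : ∀ᵐ t ∂volume.restrict freq, 0 ≤ f t) : BddBelow (Set.range (spectralError n μ N a f)) :=
  ⟨0, by rintro _ ⟨c, rfl⟩; exact spectralError_nonneg hf0 c⟩

/-- The bound `C` is independent of the density, so one sequence of estimates has convergent errors
under every integrable `f` at once. Convergence in the norm weighted by a single density would not
allow the comparison over the whole class. -/
lemma tendsto_spectralError {n μ N : ℕ} (hμ : 1 ≤ μ) {a : ℕ → ℂ} {c : ℕ → ℕ →₀ ℂ} {C : ℝ}
    (hC : ∀ m t, ‖errPoly n μ N a (c m) t * bdry (wSeries n μ) t‖ ≤ C) {G : ℝ → ℂ}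
    (hG : ∀ᵐ t ∂volume.restrict freq,
      Tendsto (fun m => errPoly n μ N a (c m) t * bdry (wSeries n μ) t) atTop (𝓝 (G t)))
    {f : ℝ → ℝ} (hf : IntegrableOn f freq) :
    Tendsto (fun m => spectralError n μ N a f (c m)) atTop
      (𝓝 (realMean fun t => ‖G t‖ ^ 2 * f t)) := by
  obtain ⟨-, -, -, -, -, -, hW, hWb⟩ := exists_wSeries n μ hμ
  have h1 : ∀ m, spectralError n μ N a f (c m) = realMean fun t =>
      ‖errPoly n μ N a (c m) t * bdry (wSeries n μ) t‖ ^ 2 * f t := fun m => by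
    rw [spectralError, ← realMean]
    refine realMean_congr_ae ?_
    filter_upwards [hWb] with t ht
    rw [norm_mul, mul_pow, ht]
  simp_rw [h1]
  refine tendsto_realMean (B := fun t => C ^ 2 * ‖f t‖) (fun m => ?_) (hf.norm.const_mul _)
    (fun m => ae_of_all _ fun t => ?_) ?_
  · exact ((((continuous_errPoly n μ N a (c m)).mul
      hW.continuous_bdry).norm.pow 2).aestronglyMeasurable).mul hf.1
  · rw [norm_mul, norm_pow, norm_norm]
    gcongr
    exact hC m t
  · filter_upwards [hG] with t ht
    exact (ht.norm.pow 2).mul_const _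

lemma realMean_norm_rPoly_sq (n μ N : ℕ) (a φ : ℕ → ℂ) :
    realMean (fun t => ‖rPoly n μ N a φ t‖ ^ 2) = objective n μ N a (truncate N φ) := by
  have hc := continuous_rPoly n μ N a φ
  have hL : MemLp (rPoly n μ N a φ) 2 (volume.restrict freq) := by
    rw [memLp_two_iff_integrable_sq_norm hc.aestronglyMeasurable]
    exact integrable_freq_of_continuous (by fun_prop)
  have h := realMean_norm_sub_sq hL N (rSeq n μ N a φ) fun j hj => ?_
  · have h0 : realMean (fun t => ‖rPoly n μ N a φ t -
        ∑ j ∈ Finset.range (N + 1), rSeq n μ N a φ j * cis (j * t)‖ ^ 2) = 0 := by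
      simp [rPoly, realMean]
    rw [objective_eq]
    linarith
  · have h1 : ∀ t, rPoly n μ N a φ t * cis (-(j * t)) = ∑ k ∈ Finset.range (N + 1),
        rSeq n μ N a φ k * cis (((k - j : ℤ) : ℝ) * t) := fun t => by
      rw [rPoly, Finset.sum_mul]
      refine Finset.sum_congr rfl fun k _ => ?_
      rw [mul_assoc, ← cis_add]
      congr 2
      push_cast
      ring
    simp_rw [h1]
    rw [circMean_sum _ fun k _ => integrable_freq_of_continuous (by fun_prop)]
    simp_rw [circMean_const_mul, circMean_cis]
    rw [Finset.sum_eq_single j]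
    · simp
    · intro k _ hk
      rw [if_neg (by omega), mul_zero]
    · intro h
      exact absurd (Finset.mem_range.2 (Nat.lt_succ_iff.2 hj)) h

lemma bdry_mul_bdry_inverse {p q : PowerSeries ℂ} (hp : AbsSummable p) (hq : AbsSummable q)
    (h : p * q = 1) (t : ℝ) : bdry p t * bdry q t = 1 := by
  rw [← hp.bdry_mul hq, h, bdry, ev_one]

lemma IsCanonicalFactor.ae_nonneg {φ : ℕ → ℂ} {f : ℝ → ℝ} (h : IsCanonicalFactor φ f) :
    ∀ᵐ t ∂volume.restrict freq, 0 ≤ f t := by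
  filter_upwards [h.density] with t ht
  rw [ht]
  positivity

lemma IsCanonicalFactor.integrableOn {φ : ℕ → ℂ} {f : ℝ → ℝ} (h : IsCanonicalFactor φ f) :
    IntegrableOn f freq := by
  have hc := h.absSummable.continuous_bdry
  refine (integrable_freq_of_continuous (g := fun t => ‖bdry (PowerSeries.mk φ) t‖ ^ 2)
    (by fun_prop)).congr ?_
  filter_upwards [h.density_bdry] with t ht
  exact ht.symm

/-- For a canonical factor the error of the optimal estimate is the value of the objective. -/
lemma IsCanonicalFactor.iInf_spectralError {n μ N : ℕ} (hμ : 1 ≤ μ) {a φ : ℕ → ℂ} {f : ℝ → ℝ}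
    (h : IsCanonicalFactor φ f) :
    ⨅ c, spectralError n μ N a f c = objective n μ N a (truncate N φ) := by
  refine le_antisymm ?_ (le_ciInf fun c => objective_le_spectralError hμ h.isFactor c)
  obtain ⟨q, hq, hφq, -⟩ := h.exists_inverse
  obtain ⟨c, C, hC, hG⟩ := exists_tendsto_errPoly n μ N hμ a φ hq hφq
  have h1 := tendsto_spectralError hμ hC hG h.integrableOn
  have h2 : realMean (fun t => ‖rPoly n μ N a φ t * bdry q t‖ ^ 2 * f t) =
      objective n μ N a (truncate N φ) := by
    rw [← realMean_norm_rPoly_sq]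
    refine realMean_congr_ae ?_
    filter_upwards [h.density_bdry] with t ht
    rw [ht, ← mul_pow, ← norm_mul, mul_assoc, mul_comm (bdry q t),
      bdry_mul_bdry_inverse h.absSummable hq hφq, mul_one]
  rw [h2] at h1
  exact ge_of_tendsto' h1 fun m => ciInf_le (bddBelow_spectralError h.ae_nonneg) (c m)

/-- The mean of a density against the squared modulus of a real polynomial of degree `M` is
determined by its moments. -/
lemma realMean_norm_sq_mul {M : ℕ} {ρ : ℕ → ℝ} {f : ℝ → ℝ} (hf : f ∈ momentClass M ρ) (d : ℕ → ℝ) :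
    realMean (fun t => ‖∑ k ∈ Finset.range (M + 1), (d k : ℂ) * cis (-t) ^ k‖ ^ 2 * f t) =
      ∑ k ∈ Finset.range (M + 1), ∑ l ∈ Finset.range (M + 1),
        d k * d l * ρ ((k : ℤ) - l).natAbs := by
  have hint : ∀ m : ℕ, IntegrableOn (fun t => f t * Real.cos (m * t)) freq := fun m =>
    hf.1.mul_bdd (c := 1) (by fun_prop : Continuous fun t : ℝ =>
      Real.cos (m * t)).aestronglyMeasurable (ae_of_all _ fun t => Real.abs_cos_le_one _)
  have hexp : ∀ t, ‖∑ k ∈ Finset.range (M + 1), (d k : ℂ) * cis (-t) ^ k‖ ^ 2 * f t =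
      ∑ k ∈ Finset.range (M + 1), ∑ l ∈ Finset.range (M + 1),
        d k * d l * (f t * Real.cos ((((k : ℤ) - l).natAbs : ℕ) * t)) := by
    intro t
    have h1 : ‖∑ k ∈ Finset.range (M + 1), (d k : ℂ) * cis (-t) ^ k‖ ^ 2 =
        ∑ k ∈ Finset.range (M + 1), ∑ l ∈ Finset.range (M + 1),
          d k * d l * Real.cos ((((k : ℤ) - l).natAbs : ℕ) * t) := by
      have h2 : ((‖∑ k ∈ Finset.range (M + 1), (d k : ℂ) * cis (-t) ^ k‖ ^ 2 : ℝ) : ℂ) =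
          ∑ k ∈ Finset.range (M + 1), ∑ l ∈ Finset.range (M + 1),
            (d k : ℂ) * d l * cis (-(((k : ℝ) - l) * t)) := by
        rw [ofReal_norm_sq, star_sum, Finset.sum_mul_sum]
        refine Finset.sum_congr rfl fun k _ => Finset.sum_congr rfl fun l _ => ?_
        rw [star_mul', star_pow, star_cis, ← cis_nat_mul, ← cis_nat_mul,
          ← starRingEnd_apply, Complex.conj_ofReal]
        rw [show (d k : ℂ) * cis (k * -t) * (d l * cis (l * -(-t))) =
          d k * d l * (cis (k * -t) * cis (l * -(-t))) by ring, ← cis_add]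
        congr 2
        ring
      have h3 := congrArg Complex.re h2
      rw [Complex.ofReal_re] at h3
      rw [h3, Complex.re_sum]
      refine Finset.sum_congr rfl fun k _ => ?_
      rw [Complex.re_sum]
      refine Finset.sum_congr rfl fun l _ => ?_
      rw [← Complex.ofReal_mul, Complex.re_ofReal_mul, cis, Complex.exp_ofReal_mul_I_re,
        Real.cos_neg]
      congr 1
      rw [Nat.cast_natAbs]
      push_cast
      rcases le_total 0 ((k : ℝ) - l) with h | h
      · rw [abs_of_nonneg h]
      · rw [abs_of_nonpos h, neg_mul, Real.cos_neg]
    rw [h1, Finset.sum_mul]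
    refine Finset.sum_congr rfl fun k _ => ?_
    rw [Finset.sum_mul]
    refine Finset.sum_congr rfl fun l _ => ?_
    ring
  simp_rw [hexp]
  rw [realMean, integral_finsetSum _ fun k _ => integrable_finsetSum _ fun l _ =>
    (hint _).const_mul _, Finset.mul_sum]
  refine Finset.sum_congr rfl fun k hk => ?_
  rw [integral_finsetSum _ fun l _ => (hint _).const_mul _, Finset.mul_sum]
  refine Finset.sum_congr rfl fun l hl => ?_
  rw [integral_const_mul, mul_left_comm, hf.2.2 _ (by simp only [Finset.mem_range] at hk hl; omega)]

/-- The denominator of a rational density as a polynomial with leading coefficient one. -/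
lemma one_add_sum_Icc (M : ℕ) (c : ℕ → ℝ) (z : ℂ) :
    1 + ∑ k ∈ Finset.Icc 1 M, (c k : ℂ) * z ^ k =
      ∑ k ∈ Finset.range (M + 1), ((if k = 0 then 1 else c k : ℝ) : ℂ) * z ^ k := by
  rw [Finset.sum_range_succ', add_comm]
  have h := Finset.sum_bij (s := Finset.range M) (t := Finset.Icc 1 M)
    (f := fun k => ((if k + 1 = 0 then 1 else c (k + 1) : ℝ) : ℂ) * z ^ (k + 1))
    (g := fun k => (c k : ℂ) * z ^ k) (fun k _ => k + 1)
    (fun k hk => by simp only [Finset.mem_range, Finset.mem_Icc] at hk ⊢; omega)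
    (fun _ _ _ _ h => by omega)
    (fun k hk => ⟨k - 1, by simp only [Finset.mem_range, Finset.mem_Icc] at hk ⊢; omega,
      by simp only [Finset.mem_Icc] at hk; omega⟩)
    (fun k _ => by simp)
  rw [h]
  simp

lemma rationalDensity_eq (n μ N M : ℕ) (a φ : ℕ → ℂ) (c : ℕ → ℝ) (t : ℝ) :
    rationalDensity n μ N M a (phiMu n μ N (truncate N φ)) c t =
      c 0 ^ 2 * ‖rPoly n μ N a φ t‖ ^ 2 /
        ‖1 + ∑ k ∈ Finset.Icc 1 M, (c k : ℂ) * cis (-t) ^ k‖ ^ 2 := by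
  rw [rationalDensity, rPoly_eq, norm_mul, mul_pow, Complex.norm_real, Real.norm_eq_abs, sq_abs]

/-- The interval has positive measure, so a property valid almost everywhere holds at some point. -/
instance neBot_ae_freq : (ae (volume.restrict freq)).NeBot := by
  rw [ae_neBot, Ne, Measure.restrict_eq_zero, volume_freq]
  have : (0 : ℝ) < 2 * Real.pi := by positivity
  simpa using this

/-! ### Rational solutions as saddle points -/

section

variable {n μ N M : ℕ} {a : ℕ → ℂ} {ρ : ℕ → ℝ} {φ : ℕ → ℂ} {c : ℕ → ℝ} {f : ℝ → ℝ}

/-- A canonical factor has no zeros on the circle, so `f` is nonzero almost everywhere. If `c 0`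
vanished, or the denominator vanished at `t`, where division by zero returns zero, the rational form
would give the value zero. -/
lemma IsRationalSolution.ne_zero (h : IsRationalSolution n μ N M a ρ φ c f) : c 0 ≠ 0 ∧
    ∀ᵐ t ∂volume.restrict freq, 1 + ∑ k ∈ Finset.Icc 1 M, (c k : ℂ) * cis (-t) ^ k ≠ 0 := by
  have hpos : ∀ᵐ t ∂volume.restrict freq, f t ≠ 0 := by
    filter_upwards [h.canonical.density] with t ht
    rw [ht]
    exact pow_ne_zero _ (norm_ne_zero_iff.2 (h.canonical.zero_free _ (norm_cis_le_one _)))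
  constructor
  · intro h0
    obtain ⟨t, h1, h2⟩ := (hpos.and h.form).exists
    rw [rationalDensity_eq, h0] at h2
    exact h1 (by simpa using h2)
  · filter_upwards [hpos, h.form] with t h1 h2 h3
    rw [rationalDensity_eq, h3] at h2
    exact h1 (by simpa using h2)

/-- Dividing (53) by `|Φ|² = f` leaves a trigonometric polynomial of degree at most `M` for `|R /
Φ|²`; this is the multiplier form of optimality under `M + 1` moment constraints. -/
lemma IsRationalSolution.norm_quotient (h : IsRationalSolution n μ N M a ρ φ c f)
    {q : PowerSeries ℂ} (hq : AbsSummable q) (hφq : PowerSeries.mk φ * q = 1) :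
    ∀ᵐ t ∂volume.restrict freq, ‖rPoly n μ N a φ t * bdry q t‖ ^ 2 =
      (c 0 ^ 2)⁻¹ * ‖1 + ∑ k ∈ Finset.Icc 1 M, (c k : ℂ) * cis (-t) ^ k‖ ^ 2 := by
  obtain ⟨h0, h1⟩ := h.ne_zero
  filter_upwards [h1, h.form, h.canonical.density_bdry] with t h2 h3 h4
  rw [rationalDensity_eq, h4] at h3
  have h5 : ‖bdry (PowerSeries.mk φ) t‖ ^ 2 * ‖bdry q t‖ ^ 2 = 1 := by
    rw [← mul_pow, ← norm_mul, bdry_mul_bdry_inverse h.canonical.absSummable hq hφq]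
    simp
  have h6 := norm_ne_zero_iff.2 h2
  rw [eq_div_iff (pow_ne_zero 2 h6)] at h3
  rw [norm_mul, mul_pow]
  have h7 : ‖rPoly n μ N a φ t‖ ^ 2 = (c 0 ^ 2)⁻¹ * (‖bdry (PowerSeries.mk φ) t‖ ^ 2 *
      ‖1 + ∑ k ∈ Finset.Icc 1 M, (c k : ℂ) * cis (-t) ^ k‖ ^ 2) := by
    rw [h3, ← mul_assoc, inv_mul_cancel₀ (pow_ne_zero 2 h0), one_mul]
  rw [h7]
  linear_combination (c 0 ^ 2)⁻¹ *
      ‖1 + ∑ k ∈ Finset.Icc 1 M, (c k : ℂ) * cis (-t) ^ k‖ ^ 2 * h5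

/-- The mean of `‖R / Φ‖² f'` is the same for all densities `f'` with the given moments. -/
lemma IsRationalSolution.realMean_quotient (h : IsRationalSolution n μ N M a ρ φ c f)
    {q : PowerSeries ℂ} (hq : AbsSummable q) (hφq : PowerSeries.mk φ * q = 1) {f' : ℝ → ℝ}
    (hf' : f' ∈ momentClass M ρ) :
    realMean (fun t => ‖rPoly n μ N a φ t * bdry q t‖ ^ 2 * f' t) =
      objective n μ N a (truncate N φ) := by
  have key : ∀ g ∈ momentClass M ρ,
      realMean (fun t => ‖rPoly n μ N a φ t * bdry q t‖ ^ 2 * g t) =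
        (c 0 ^ 2)⁻¹ * ∑ k ∈ Finset.range (M + 1), ∑ l ∈ Finset.range (M + 1),
          (if k = 0 then 1 else c k) * (if l = 0 then 1 else c l) * ρ ((k : ℤ) - l).natAbs := by
    intro g hg
    rw [← realMean_norm_sq_mul hg (fun k => if k = 0 then 1 else c k), ← realMean_const_mul]
    refine realMean_congr_ae ?_
    filter_upwards [h.norm_quotient hq hφq] with t ht
    rw [ht, one_add_sum_Icc, mul_assoc]
  rw [key f' hf', ← key f h.mem, ← realMean_norm_rPoly_sq]
  refine realMean_congr_ae ?_
  filter_upwards [h.canonical.density_bdry] with t ht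
  rw [ht, ← mul_pow, ← norm_mul, mul_assoc, mul_comm (bdry q t),
    bdry_mul_bdry_inverse h.canonical.absSummable hq hφq, mul_one]

/-- The approximating estimates for `f` are used under `f'`: their limiting error depends only on
the moments, hence equals the value at `f`. This is the saddle point inequality. -/
lemma IsRationalSolution.iInf_spectralError_le (hμ : 1 ≤ μ)
    (h : IsRationalSolution n μ N M a ρ φ c f) {f' : ℝ → ℝ} (hf' : f' ∈ momentClass M ρ) :
    ⨅ c, spectralError n μ N a f' c ≤ objective n μ N a (truncate N φ) := by
  obtain ⟨q, hq, hφq, -⟩ := h.canonical.exists_inverse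
  obtain ⟨c, C, hC, hG⟩ := exists_tendsto_errPoly n μ N hμ a φ hq hφq
  have h1 := tendsto_spectralError hμ hC hG hf'.1
  rw [h.realMean_quotient hq hφq hf'] at h1
  exact ge_of_tendsto' h1 fun m => ciInf_le (bddBelow_spectralError hf'.2.1) (c m)

/-- All rational solutions have the same value of the objective. -/
lemma IsRationalSolution.objective_eq (hμ : 1 ≤ μ) (h : IsRationalSolution n μ N M a ρ φ c f)
    {φ' : ℕ → ℂ} {c' : ℕ → ℝ} {f' : ℝ → ℝ} (h' : IsRationalSolution n μ N M a ρ φ' c' f') :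
    objective n μ N a (truncate N φ) = objective n μ N a (truncate N φ') := by
  have h1 := h.iInf_spectralError_le hμ h'.mem
  have h2 := h'.iInf_spectralError_le hμ h.mem
  rw [h.canonical.iInf_spectralError hμ] at h2
  rw [h'.canonical.iInf_spectralError hμ] at h1
  exact le_antisymm h2 h1

/-- The objective at a factor bounds the optimal error at `f'` from below, so it suffices that the
same number bounds the optimal errors of the whole class from above. -/
lemma IsFactor.isLeastFavorable (hμ : 1 ≤ μ) {φ' : ℕ → ℂ} {f' : ℝ → ℝ} (hφ : IsFactor φ' f')
    (hf' : f' ∈ momentClass M ρ) (hle : ∀ g ∈ momentClass M ρ,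
      ⨅ c, spectralError n μ N a g c ≤ objective n μ N a (truncate N φ')) :
    IsLeastFavorable.{u} n μ N a (momentClass M ρ) f' := by
  refine ⟨hf', fun g hg Ω₀ Ω _ _ P₀ P _ _ ξ₀ ξ h0 h1 => ?_⟩
  rw [optimalError_eq hμ h0 hf'.1, optimalError_eq hμ h1 hg.1]
  exact (hle g hg).trans (le_ciInf fun c => objective_le_spectralError hμ hφ c)

/-- Least favorability speaks of sequences; realizing both densities by sequences makes it a
comparison of spectral infima. -/
lemma IsLeastFavorable.iInf_spectralError_le (hμ : 1 ≤ μ) {D : Set (ℝ → ℝ)} {f₀ f' : ℝ → ℝ}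
    (h : IsLeastFavorable.{u} n μ N a D f₀) (hD : D ⊆ momentClass M ρ) (hf' : f' ∈ D) :
    ⨅ c, spectralError n μ N a f' c ≤ ⨅ c, spectralError n μ N a f₀ c := by
  obtain ⟨Ω₀, _, P₀, _, ξ₀, h0⟩ := exists_hasSpectralDensity.{u} n (hD h.1).1 (hD h.1).2.1
  obtain ⟨Ω, _, P, _, ξ, h1⟩ := exists_hasSpectralDensity.{u} n (hD hf').1 (hD hf').2.1
  have := h.2 f' hf' Ω₀ Ω P₀ P ξ₀ ξ h0 h1
  rwa [optimalError_eq hμ h0 (hD h.1).1, optimalError_eq hμ h1 (hD hf').1] at this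

lemma AbsSummable.hasSum_norm_sq {p : PowerSeries ℂ} (hp : AbsSummable p) :
    HasSum (fun k => ‖PowerSeries.coeff k p‖ ^ 2) (realMean fun t => ‖bdry p t‖ ^ 2) := by
  have hc := hp.continuous_bdry
  have h := hp.hasSum_circMean_bdry (g := fun t => star (bdry p t))
    (integrable_freq_of_continuous (by fun_prop))
  have h1 : ∀ k : ℕ, circMean (fun t => cis (-(k * t)) * star (bdry p t)) =
      star (PowerSeries.coeff k p) := fun k => by
    have h2 := hp.circMean_bdry_mul_cis k
    rw [if_pos (Int.natCast_nonneg k), Int.toNat_natCast] at h2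
    rw [← h2, circMean_star]
    congr 1
    ext t
    rw [star_mul', star_cis, mul_comm]
    simp
  simp_rw [h1, ← ofReal_norm_sq] at h
  rw [← ofReal_realMean] at h
  exact Complex.hasSum_ofReal.1 h

lemma IsCanonicalFactor.hasSum_norm_sq {φ : ℕ → ℂ} {f : ℝ → ℝ} (h : IsCanonicalFactor φ f)
    (hf : f ∈ momentClass M ρ) : HasSum (fun k => ‖φ k‖ ^ 2) (ρ 0) := by
  have h1 := h.absSummable.hasSum_norm_sq
  rw [← realMean_congr_ae h.density_bdry] at h1
  have h2 := hf.2.2 0 (Nat.zero_le _)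
  simp only [Nat.cast_zero, zero_mul, Real.cos_zero, mul_one] at h2
  rw [realMean, h2] at h1
  simpa using h1

/-- A canonical factor with the extremal value of the objective belongs to a rational solution with
the same parameters. -/
lemma IsRationalSolution.of_objective_eq (hμ : 1 ≤ μ) (h : IsRationalSolution n μ N M a ρ φ c f)
    {φ' : ℕ → ℂ} {f' : ℝ → ℝ} (hφ' : IsCanonicalFactor φ' f') (hf' : f' ∈ momentClass M ρ)
    (hobj : objective n μ N a (truncate N φ') = objective n μ N a (truncate N φ)) :
    IsRationalSolution n μ N M a ρ φ' c f' := by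
  refine ⟨?_, hφ'.hasSum_norm_sq hf', hφ', hf'⟩
  obtain ⟨-, -, -, -, -, -, hW, hWb⟩ := exists_wSeries n μ hμ
  obtain ⟨q, hq, hφq, -⟩ := h.canonical.exists_inverse
  obtain ⟨e, C, hC, hG⟩ := exists_tendsto_errPoly n μ N hμ a φ hq hφq
  have h1 := tendsto_spectralError hμ hC hG hf'.1
  rw [h.realMean_quotient hq hφq hf', ← hobj] at h1
  have hb := hφ'.absSummable
  have hbc := hb.continuous_bdry
  have hwc := hW.continuous_bdry
  have hRc := continuous_rPoly n μ N a φ'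
  -- Under `f'` the estimates built for `φ` have errors tending to the objective at `φ'`; by
  -- Pythagoras the error functions multiplied by `Φ'` converge in mean square to `R'`. Bounded
  -- convergence gives the other limit `R Φ' / Φ`, so `R' = R Φ' / Φ`.
  have h2 : Tendsto (fun m => realMean (fun t => ‖errPoly n μ N a (e m) t *
      (bdry (wSeries n μ) t * bdry (PowerSeries.mk φ') t) - rPoly n μ N a φ' t‖ ^ 2)) atTop
      (𝓝 0) := by
    simp_rw [realMean_errPoly_sub hμ hb.memLp_bdry hφ'.circMean_bdry hφ'.density_bdry]
    have := h1.sub_const (objective n μ N a (truncate N φ'))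
    rwa [sub_self] at this
  have hR2 : IntegrableOn (fun t => (C * coeffNorm (PowerSeries.mk φ') +
      ‖rPoly n μ N a φ' t‖) ^ 2) freq := integrable_freq_of_continuous (by fun_prop)
  have h3 : Tendsto (fun m => realMean (fun t => ‖errPoly n μ N a (e m) t *
      (bdry (wSeries n μ) t * bdry (PowerSeries.mk φ') t) - rPoly n μ N a φ' t‖ ^ 2)) atTop
      (𝓝 (realMean fun t => ‖rPoly n μ N a φ t * bdry q t * bdry (PowerSeries.mk φ') t -
        rPoly n μ N a φ' t‖ ^ 2)) := by
    refine tendsto_realMean (fun m => ?_) hR2 (fun m => ae_of_all _ fun t => ?_) ?_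
    · have := continuous_errPoly n μ N a (e m)
      exact (by fun_prop : Continuous _).aestronglyMeasurable
    · rw [norm_pow, norm_norm]
      gcongr
      refine (norm_sub_le _ _).trans (add_le_add_left ?_ _)
      rw [← mul_assoc, norm_mul]
      exact mul_le_mul (hC m t) (hb.norm_bdry_le t) (norm_nonneg _)
        ((norm_nonneg _).trans (hC m t))
    · filter_upwards [hG] with t ht
      simp_rw [← mul_assoc]
      exact ((ht.mul_const _).sub_const _).norm.pow 2
  have h4 := tendsto_nhds_unique h3 h2
  have hqc := hq.continuous_bdry
  have hRc' := continuous_rPoly n μ N a φ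
  have h5 := ae_eq_zero_of_realMean_nonpos (integrable_freq_of_continuous (by fun_prop))
    (ae_of_all _ fun t => by positivity) h4.le
  obtain ⟨h0, h6⟩ := h.ne_zero
  filter_upwards [h5, h6, h.norm_quotient hq hφq, hφ'.density_bdry] with t h7 h8 h9 h10
  have h11 : rPoly n μ N a φ t * bdry q t * bdry (PowerSeries.mk φ') t = rPoly n μ N a φ' t := by
    simpa [sub_eq_zero] using h7
  rw [rationalDensity_eq, ← h11, norm_mul, mul_pow, h9, ← h10]
  have h12 := norm_ne_zero_iff.2 h8
  field_simp

/-- The saddle point bounds the objective at `φ'` by that at `φ`, and least favorability gives the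
reverse inequality; equality transfers the parameters `c`. -/
lemma IsLeastFavorable.isRationalSolution (hμ : 1 ≤ μ) (h : IsRationalSolution n μ N M a ρ φ c f)
    {φ' : ℕ → ℂ} {f' : ℝ → ℝ} (hφ' : IsCanonicalFactor φ' f')
    (hl : IsLeastFavorable.{u} n μ N a (momentClass M ρ) f') :
    IsRationalSolution n μ N M a ρ φ' c f' := by
  refine h.of_objective_eq hμ hφ' hl.1 (le_antisymm ?_ ?_)
  · rw [← hφ'.iInf_spectralError hμ]
    exact h.iInf_spectralError_le hμ hl.1
  · rw [← hφ'.iInf_spectralError hμ, ← h.canonical.iInf_spectralError hμ]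
    exact hl.iInf_spectralError_le hμ subset_rfl h.mem

lemma IsRationalSolution.isLeastFavorable (hμ : 1 ≤ μ) (h : IsRationalSolution n μ N M a ρ φ c f) :
    IsLeastFavorable.{u} n μ N a (momentClass M ρ) f :=
  h.canonical.isFactor.isLeastFavorable hμ h.mem fun _ hg => h.iInf_spectralError_le hμ hg

end

/-! ### Polynomials with the same modulus on the unit circle -/

lemma exists_cis_neg_eq {z : ℂ} (hz : ‖z‖ = 1) : ∃ t ∈ freq, cis (-t) = z := by
  refine ⟨Complex.arg (star z), Complex.arg_mem_Ioc _, ?_⟩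
  have h := Complex.norm_mul_exp_arg_mul_I (star z)
  rw [norm_star, hz, Complex.ofReal_one, one_mul] at h
  rw [← star_cis, cis, h, star_star]

lemma eq_of_ae_circle {u v : ℂ → ℝ} (hu : ContinuousOn u (Metric.closedBall 0 1))
    (hv : ContinuousOn v (Metric.closedBall 0 1))
    (h : ∀ᵐ t ∂volume.restrict freq, u (cis (-t)) = v (cis (-t))) {z : ℂ} (hz : ‖z‖ = 1) :
    u z = v z := by
  have hc : ∀ w : ℂ → ℝ, ContinuousOn w (Metric.closedBall 0 1) →
      Continuous fun t => w (cis (-t)) := fun w hw =>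
    hw.comp_continuous (by fun_prop) fun t => by simpa using norm_cis_le_one (-t)
  obtain ⟨t, ht, rfl⟩ := exists_cis_neg_eq hz
  exact Measure.eqOn_Ioc_of_ae_eq volume h (hc u hu).continuousOn
    (hc v hv).continuousOn ht

lemma ae_cis_neg_ne (a : ℂ) : ∀ᵐ t ∂volume.restrict freq, cis (-t) ≠ a := by
  by_cases ha : ‖a‖ = 1
  · obtain ⟨t₀, -, rfl⟩ := exists_cis_neg_eq ha
    have h := (measurePreserving_sub_right volume t₀).quasiMeasurePreserving.ae
      (ae_cis_ne_one 1 le_rfl)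
    refine ae_restrict_of_ae ?_
    filter_upwards [h] with t ht h0
    apply ht
    rw [pow_one, cis_sub, ← h0, cis_mul_neg]
  · refine ae_of_all _ fun t h => ha ?_
    rw [← h, norm_cis]

/-- Reflection of the zeros inside the unit disk. -/
lemma exists_reflect (d : ℕ) : ∀ q : Polynomial ℂ, q.natDegree = d →
    (∀ z : ℂ, ‖z‖ = 1 → q.eval z ≠ 0) → ∃ θ : Polynomial ℂ, θ.natDegree ≤ q.natDegree ∧
      (∀ z : ℂ, ‖z‖ ≤ 1 → θ.eval z ≠ 0) ∧ ∀ z : ℂ, ‖z‖ = 1 → ‖θ.eval z‖ = ‖q.eval z‖ := by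
  induction d with
  | zero =>
    intro q hd hq
    refine ⟨q, le_rfl, fun z _ => ?_, fun _ _ => rfl⟩
    have h1 := hq 1 (by simp)
    rw [Polynomial.eq_C_of_natDegree_eq_zero hd] at h1 ⊢
    simpa using h1
  | succ d ih =>
    intro q hd hq
    by_cases h : ∃ w : ℂ, ‖w‖ ≤ 1 ∧ q.eval w = 0
    · obtain ⟨w, hw1, hw⟩ := h
      have hw1 : ‖w‖ < 1 := lt_of_le_of_ne hw1 fun h => hq w h hw
      obtain ⟨q', rfl⟩ := Polynomial.dvd_iff_isRoot.2 hw
      have hq'0 : q' ≠ 0 := by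
        rintro rfl
        simp at hd
      have hdeg : ((Polynomial.X - Polynomial.C w) * q').natDegree = 1 + q'.natDegree := by
        rw [Polynomial.natDegree_mul (Polynomial.X_sub_C_ne_zero w) hq'0,
          Polynomial.natDegree_X_sub_C]
      obtain ⟨θ, h1, h2, h3⟩ := ih q' (by omega) fun z hz h0 => hq z hz (by simp [h0])
      -- A zero `w` inside is moved to `1 / conj w`: on the circle `|z - w| = |1 - conj w · z|`. For
      -- `w = 0` the new factor is constant, so the degree may drop.
      refine ⟨(1 - Polynomial.C (star w) * Polynomial.X) * θ, ?_, fun z hz => ?_, fun z hz => ?_⟩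
      · rw [hdeg]
        refine Polynomial.natDegree_mul_le.trans (add_le_add ?_ h1)
        refine (Polynomial.natDegree_sub_le _ _).trans (max_le (by simp) ?_)
        exact (Polynomial.natDegree_C_mul_le _ _).trans Polynomial.natDegree_X_le
      · rw [Polynomial.eval_mul]
        refine mul_ne_zero (fun h0 => ?_) (h2 z hz)
        simp only [Polynomial.eval_sub, Polynomial.eval_one, Polynomial.eval_mul,
          Polynomial.eval_C, Polynomial.eval_X] at h0
        have h4 : ‖star w * z‖ = 1 := by rw [← sub_eq_zero.1 h0, norm_one]
        rw [norm_mul, norm_star] at h4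
        nlinarith [norm_nonneg w, norm_nonneg z]
      · rw [Polynomial.eval_mul, Polynomial.eval_mul, norm_mul, norm_mul, h3 z hz]
        congr 1
        simp only [Polynomial.eval_sub, Polynomial.eval_one, Polynomial.eval_mul,
          Polynomial.eval_C, Polynomial.eval_X]
        have h4 : z * star z = 1 := by rw [← ofReal_norm_sq, hz]; simp
        have h5 : z - w = z * star (1 - star w * z) := by
          rw [star_sub, star_one, star_mul', star_star]
          linear_combination w * h4
        rw [h5, norm_mul, norm_star, hz, one_mul]
    · push Not at h
      exact ⟨q, le_rfl, h, fun _ _ => rfl⟩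

/-- Cancellation of the common zeros on the unit circle. -/
lemma exists_cancel {u : ℂ → ℂ} (hu : ContinuousOn u (Metric.closedBall 0 1))
    (hu0 : ∀ z : ℂ, ‖z‖ ≤ 1 → u z ≠ 0) (d : ℕ) : ∀ p q : Polynomial ℂ, p.natDegree = d → p ≠ 0 →
    q ≠ 0 → (∀ z : ℂ, ‖z‖ = 1 → ‖u z * p.eval z‖ = ‖q.eval z‖) →
    ∃ p' q' : Polynomial ℂ, p'.natDegree ≤ p.natDegree ∧ q'.natDegree ≤ q.natDegree ∧
      (∀ z : ℂ, ‖z‖ = 1 → p'.eval z ≠ 0) ∧ (∀ z : ℂ, ‖z‖ = 1 → q'.eval z ≠ 0) ∧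
      ∀ z : ℂ, ‖z‖ = 1 → ‖u z * p'.eval z‖ = ‖q'.eval z‖ := by
  -- Since `u` has no zeros, `p` and `q` vanish at the same points of the circle and a linear factor
  -- can be removed from both.
  have key : ∀ p q : Polynomial ℂ, (∀ z : ℂ, ‖z‖ = 1 → ‖u z * p.eval z‖ = ‖q.eval z‖) →
      ∀ z : ℂ, ‖z‖ = 1 → (p.eval z = 0 ↔ q.eval z = 0) := by
    intro p q h z hz
    rw [← norm_eq_zero (a := q.eval z), ← h z hz, norm_eq_zero, mul_eq_zero,
      or_iff_right (hu0 z hz.le)]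
  induction d with
  | zero =>
    intro p q hd hp hq h
    have h1 : ∀ z : ℂ, ‖z‖ = 1 → p.eval z ≠ 0 := by
      intro z _
      rw [Polynomial.eq_C_of_natDegree_eq_zero hd] at hp ⊢
      simpa using hp
    exact ⟨p, q, le_rfl, le_rfl, h1, fun z hz h0 => h1 z hz ((key p q h z hz).2 h0), h⟩
  | succ d ih =>
    intro p q hd hp hq h
    by_cases hr : ∃ w : ℂ, ‖w‖ = 1 ∧ p.eval w = 0
    · obtain ⟨w, hw1, hw⟩ := hr
      have hw' := (key p q h w hw1).1 hw
      obtain ⟨p', rfl⟩ := Polynomial.dvd_iff_isRoot.2 hw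
      obtain ⟨q', rfl⟩ := Polynomial.dvd_iff_isRoot.2 hw'
      have hp' : p' ≠ 0 := right_ne_zero_of_mul hp
      have hq' : q' ≠ 0 := right_ne_zero_of_mul hq
      have hdp : ((Polynomial.X - Polynomial.C w) * p').natDegree = 1 + p'.natDegree := by
        rw [Polynomial.natDegree_mul (Polynomial.X_sub_C_ne_zero w) hp',
          Polynomial.natDegree_X_sub_C]
      have hdq : ((Polynomial.X - Polynomial.C w) * q').natDegree = 1 + q'.natDegree := by
        rw [Polynomial.natDegree_mul (Polynomial.X_sub_C_ne_zero w) hq',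
          Polynomial.natDegree_X_sub_C]
      -- Dividing by `|z - w|` gives the identity off the point `w`; continuity restores it there,
      -- as required when zeros are multiple.
      obtain ⟨p₁, q₁, h1, h2, h3⟩ := ih p' q' (by omega) hp' hq' fun z hz => by
        refine eq_of_ae_circle (u := fun z => ‖u z * p'.eval z‖) (v := fun z => ‖q'.eval z‖)
          (hu.mul p'.continuous.continuousOn).norm q'.continuous.norm.continuousOn ?_ hz
        filter_upwards [ae_cis_neg_ne w] with t ht
        have h4 := h _ (norm_cis (-t))
        rw [Polynomial.eval_mul, Polynomial.eval_mul, mul_left_comm, norm_mul,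
          norm_mul _ (Polynomial.eval _ q')] at h4
        refine mul_left_cancel₀ (norm_ne_zero_iff.2 ?_) h4
        simpa [sub_eq_zero] using ht
      exact ⟨p₁, q₁, by omega, by omega, h3⟩
    · push Not at hr
      exact ⟨p, q, le_rfl, le_rfl, hr, fun z hz h0 => hr z hz ((key p q h z hz).2 h0), h⟩

/-- Zero-free functions with the same modulus on the unit circle are proportional. -/
lemma exists_const_mul_eq {u v : ℂ → ℂ} (hu : DiffContOnCl ℂ u (Metric.ball 0 1))
    (hv : DiffContOnCl ℂ v (Metric.ball 0 1)) (hu0 : ∀ z : ℂ, ‖z‖ ≤ 1 → u z ≠ 0)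
    (hv0 : ∀ z : ℂ, ‖z‖ ≤ 1 → v z ≠ 0) (h : ∀ z : ℂ, ‖z‖ = 1 → ‖u z‖ = ‖v z‖) :
    ∃ c : ℂ, c ≠ 0 ∧ ∀ z : ℂ, ‖z‖ ≤ 1 → u z = c * v z := by
  have hcl : closure (Metric.ball (0 : ℂ) 1) = Metric.closedBall 0 1 :=
    closure_ball 0 one_ne_zero
  -- The maximum principle bounds both `u / v` and `v / u` by one, so `|u / v| = 1` at the centre; a
  -- maximum at an interior point makes the quotient constant.
  have hle : ∀ {u v : ℂ → ℂ}, DiffContOnCl ℂ u (Metric.ball 0 1) →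
      DiffContOnCl ℂ v (Metric.ball 0 1) → (∀ z : ℂ, ‖z‖ ≤ 1 → v z ≠ 0) →
      (∀ z : ℂ, ‖z‖ = 1 → ‖u z‖ = ‖v z‖) → DiffContOnCl ℂ (fun z => (v z)⁻¹ * u z)
        (Metric.ball 0 1) ∧ ∀ z : ℂ, ‖z‖ ≤ 1 → ‖(v z)⁻¹ * u z‖ ≤ 1 := by
    intro u v hu hv hv0 h
    have hd : DiffContOnCl ℂ (fun z => (v z)⁻¹ * u z) (Metric.ball 0 1) :=
      (hv.inv fun z hz => hv0 z (by rw [hcl] at hz; simpa using hz)).smul hu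
    refine ⟨hd, fun z hz => ?_⟩
    refine Complex.norm_le_of_forall_mem_frontier_norm_le Metric.isBounded_ball hd
      (fun w hw => ?_) (by rw [hcl]; simpa using hz)
    rw [frontier_ball _ one_ne_zero] at hw
    have hw1 : ‖w‖ = 1 := by simpa using hw
    rw [norm_mul, norm_inv, h w hw1, inv_mul_cancel₀ (norm_ne_zero_iff.2 (hv0 w hw1.le))]
  obtain ⟨h1, h2⟩ := hle hu hv hv0 h
  obtain ⟨-, h3⟩ := hle hv hu hu0 fun z hz => (h z hz).symm
  have h4 := h3 0 (by simp)
  have h5 : 1 ≤ ‖(v 0)⁻¹ * u 0‖ := by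
    have hu := norm_pos_iff.2 (hu0 0 (by simp))
    have hv := norm_pos_iff.2 (hv0 0 (by simp))
    rw [norm_mul, norm_inv] at h4 ⊢
    rw [inv_mul_le_iff₀ hu, mul_one] at h4
    rwa [le_inv_mul_iff₀ hv, mul_one]
  have h6 := Complex.eqOn_closedBall_of_isMaxOn_norm h1 fun z hz =>
    (h2 z (by simpa using (Metric.ball_subset_closedBall hz))).trans h5
  refine ⟨(v 0)⁻¹ * u 0, mul_ne_zero (inv_ne_zero (hv0 0 (by simp))) (hu0 0 (by simp)),
    fun z hz => ?_⟩
  have h7 : (v z)⁻¹ * u z = (v 0)⁻¹ * u 0 := h6 (by simpa using hz)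
  rw [← h7, mul_right_comm, inv_mul_cancel₀ (hv0 z hz), one_mul]

lemma diffContOnCl_eval (p : Polynomial ℂ) (s : Set ℂ) :
    DiffContOnCl ℂ (fun z => p.eval z) s :=
  p.differentiable.diffContOnCl

lemma IsCanonicalFactor.diffContOnCl {φ : ℕ → ℂ} {f : ℝ → ℝ} (h : IsCanonicalFactor φ f) :
    DiffContOnCl ℂ (ev (PowerSeries.mk φ)) (Metric.ball 0 1) := by
  obtain ⟨r, hr, hs⟩ := h.radius
  have hd : ∀ z : ℂ, ‖z‖ < r → DifferentiableAt ℂ (ev (PowerSeries.mk φ)) z := fun z hz =>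
    (analyticAt_ev (zero_lt_one.trans hr) (by simpa using hs) hz).differentiableAt
  refine DifferentiableOn.diffContOnCl fun z hz => ?_
  rw [closure_ball _ one_ne_zero] at hz
  exact (hd z (lt_of_le_of_lt (by simpa using hz) hr)).differentiableWithinAt

/-- A canonical factor whose modulus on the unit circle is that of a rational function is rational,
with numerator and denominator free of zeros in the closed unit disk. -/
lemma IsCanonicalFactor.exists_zeroFree_quotient {φ : ℕ → ℂ} {f : ℝ → ℝ}
    (h : IsCanonicalFactor φ f) {p q : Polynomial ℂ} (hp : p ≠ 0) (hq : q ≠ 0)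
    (heq : ∀ᵐ t ∂volume.restrict freq,
      ‖bdry (PowerSeries.mk φ) t * p.eval (cis (-t))‖ = ‖q.eval (cis (-t))‖) :
    ∃ γ θ : Polynomial ℂ, γ.natDegree ≤ p.natDegree ∧ θ.natDegree ≤ q.natDegree ∧
      γ.coeff 0 = 1 ∧ ∀ z : ℂ, ‖z‖ ≤ 1 → γ.eval z ≠ 0 ∧ θ.eval z ≠ 0 ∧
        ev (PowerSeries.mk φ) z * γ.eval z = θ.eval z := by
  have hc := h.absSummable.continuousOn
  have h0 : ∀ z : ℂ, ‖z‖ ≤ 1 → ev (PowerSeries.mk φ) z ≠ 0 := fun z hz => by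
    rw [ev_mk]
    exact h.zero_free z hz
  obtain ⟨p', q', hp', hq', hp0, hq0, h1⟩ := exists_cancel hc h0 _ p q rfl hp hq fun z hz =>
    eq_of_ae_circle (u := fun z => ‖ev (PowerSeries.mk φ) z * p.eval z‖)
      (v := fun z => ‖q.eval z‖) (hc.mul p.continuous.continuousOn).norm
      q.continuous.norm.continuousOn heq hz
  obtain ⟨γ, hγ, hγ0, hγn⟩ := exists_reflect _ p' rfl hp0
  obtain ⟨θ, hθ, hθ0, hθn⟩ := exists_reflect _ q' rfl hq0
  obtain ⟨c, hc0, hcm⟩ := exists_const_mul_eq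
    (h.diffContOnCl.smul (diffContOnCl_eval γ _)) (diffContOnCl_eval θ _)
    (fun z hz => mul_ne_zero (h0 z hz) (hγ0 z hz)) hθ0 fun z hz => by
      rw [smul_eq_mul, norm_mul, hγn z hz, ← norm_mul, h1 z hz, hθn z hz]
  have hg : γ.coeff 0 ≠ 0 := by
    rw [Polynomial.coeff_zero_eq_eval_zero]
    exact hγ0 0 (by simp)
  refine ⟨Polynomial.C (γ.coeff 0)⁻¹ * γ, Polynomial.C ((γ.coeff 0)⁻¹ * c) * θ,
    (Polynomial.natDegree_C_mul_le _ _).trans (hγ.trans hp'),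
    (Polynomial.natDegree_C_mul_le _ _).trans (hθ.trans hq'),
    by rw [Polynomial.coeff_C_mul, inv_mul_cancel₀ hg], fun z hz => ?_⟩
  rw [Polynomial.eval_mul, Polynomial.eval_mul, Polynomial.eval_C, Polynomial.eval_C]
  refine ⟨mul_ne_zero (inv_ne_zero hg) (hγ0 z hz),
    mul_ne_zero (mul_ne_zero (inv_ne_zero hg) hc0) (hθ0 z hz), ?_⟩
  have := hcm z hz
  rw [smul_eq_mul] at this
  rw [mul_left_comm, this, mul_assoc]

/-! ### Moving averages of sequences with stationary increments -/

lemma increment_zero {Ω : Type u} (ξ : ℤ → Ω → ℂ) (m s : ℤ) (ω : Ω) :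
    increment 0 ξ m s ω = ξ m ω := by
  simp [increment]

/-- Pascal's rule for the binomial weights; it permits induction on the order of differencing. -/
lemma increment_succ {Ω : Type u} (n : ℕ) (ξ : ℤ → Ω → ℂ) (m s : ℤ) (ω : Ω) :
    increment (n + 1) ξ m s ω = increment n ξ m s ω - increment n ξ (m - s) s ω := by
  have h1 : increment n ξ m s ω = ∑ l ∈ Finset.range (n + 1),
      (-1 : ℂ) ^ (l + 1) * (n.choose (l + 1) : ℂ) * ξ (m - ((l + 1 : ℕ) : ℤ) * s) ω + ξ m ω := by
    have h2 := Finset.sum_range_succ' (fun l => (-1 : ℂ) ^ l * (n.choose l : ℂ) *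
      ξ (m - (l : ℤ) * s) ω) (n + 1)
    rw [Finset.sum_range_succ] at h2
    simpa [increment] using h2
  rw [h1, increment, increment, Finset.sum_range_succ', add_sub_right_comm,
    ← Finset.sum_sub_distrib]
  congr 1
  · refine Finset.sum_congr rfl fun l _ => ?_
    rw [Nat.choose_succ_succ, show m - s - l * s = m - ((l + 1 : ℕ) : ℤ) * s by push_cast; ring]
    push_cast
    ring
  · simp

/-- From `|y (k+1)| ≤ |y k| + |y k - y (k+1)|` a partial sum `S` satisfies `S ≤ |y 0| + ρ (D + S)`,
and `ρ < 1` allows solving for `S`. -/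
lemma summable_of_summable_sub {ρ : ℝ} (h0 : 0 < ρ) (h1 : ρ < 1) {y : ℕ → ℂ}
    (hy : Summable fun k => ρ ^ k * ‖y k - y (k + 1)‖) : Summable fun k => ρ ^ k * ‖y k‖ := by
  set D := ∑' k, ρ ^ k * ‖y k - y (k + 1)‖ with hD
  refine summable_of_sum_range_le (c := (‖y 0‖ + ρ * D) / (1 - ρ)) (fun k => by positivity)
    fun K => ?_
  have h2 : ∑ k ∈ Finset.range K, ρ ^ k * ‖y k‖ ≤
      ∑ k ∈ Finset.range (K + 1), ρ ^ k * ‖y k‖ := by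
    rw [Finset.sum_range_succ]
    have : 0 ≤ ρ ^ K * ‖y K‖ := by positivity
    linarith
  have h3 : ∑ k ∈ Finset.range K, ρ ^ (k + 1) * ‖y (k + 1)‖ ≤
      ρ * (∑ k ∈ Finset.range K, ρ ^ k * ‖y k - y (k + 1)‖ +
        ∑ k ∈ Finset.range K, ρ ^ k * ‖y k‖) := by
    rw [← Finset.sum_add_distrib, Finset.mul_sum]
    refine Finset.sum_le_sum fun k _ => ?_
    have h4 : ‖y (k + 1)‖ ≤ ‖y k - y (k + 1)‖ + ‖y k‖ := by
      have h5 := norm_sub_le (y k) (y k - y (k + 1))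
      rw [sub_sub_cancel] at h5
      linarith
    calc ρ ^ (k + 1) * ‖y (k + 1)‖ ≤ ρ ^ (k + 1) * (‖y k - y (k + 1)‖ + ‖y k‖) := by gcongr
      _ = _ := by ring
  have h5 : ∑ k ∈ Finset.range K, ρ ^ k * ‖y k - y (k + 1)‖ ≤ D :=
    hy.sum_le_tsum _ fun k _ => by positivity
  rw [Finset.sum_range_succ', pow_zero, one_mul] at h2
  rw [le_div_iff₀ (by linarith)]
  nlinarith

/-- Moments are assumed for the increments only, not for `ξ`. Undoing one difference at a time
transfers geometrically weighted summability to the path itself. -/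
lemma summable_of_summable_increment {Ω : Type u} {ρ : ℝ} (h0 : 0 < ρ) (h1 : ρ < 1) (n : ℕ)
    (ξ : ℤ → Ω → ℂ) (ω : Ω)
    (h : ∀ m : ℤ, Summable fun k : ℕ => ρ ^ k * ‖increment n ξ (m - k) 1 ω‖) (m : ℤ) :
    Summable fun k : ℕ => ρ ^ k * ‖ξ (m - k) ω‖ := by
  induction n generalizing m with
  | zero => simpa [increment_zero] using h m
  | succ n ih =>
    refine ih (fun m => summable_of_summable_sub h0 h1
      (y := fun k => increment n ξ (m - k) 1 ω) ((h m).congr fun k => ?_)) m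
    rw [increment_succ]
    congr 4
    push_cast
    ring

/-- The one-sided moving average of a sequence with the coefficients of a power series. -/
def movingAverage (p : PowerSeries ℂ) (x : ℤ → ℂ) (m : ℤ) : ℂ :=
  ∑' k : ℕ, PowerSeries.coeff k p * x (m - k)

lemma movingAverage_coe (p : Polynomial ℂ) {M : ℕ} (hp : p.natDegree ≤ M) (x : ℤ → ℂ) (m : ℤ) :
    movingAverage p x m = ∑ k ∈ Finset.range (M + 1), p.coeff k * x (m - k) := by
  rw [movingAverage, tsum_eq_sum (s := Finset.range (M + 1))]
  · simp
  · intro k hk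
    rw [Polynomial.coeff_coe, Polynomial.coeff_eq_zero_of_natDegree_lt (by
      simp only [Finset.mem_range] at hk; omega), zero_mul]

lemma sum_mul_movingAverage {q : PowerSeries ℂ} {x : ℤ → ℂ}
    (h : ∀ m : ℤ, Summable fun k : ℕ => PowerSeries.coeff k q * x (m - k)) (p : Polynomial ℂ)
    {N : ℕ} (hp : p.natDegree ≤ N) (m : ℤ) :
    ∑ i ∈ Finset.range (N + 1), p.coeff i * movingAverage q x (m - i) =
      movingAverage (p * q) x m := by
  have h1 : ∀ i : ℕ, HasSum (fun j : ℕ => PowerSeries.coeff j (PowerSeries.X ^ i * q) * x (m - j))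
      (movingAverage q x (m - i)) := by
    intro i
    rw [← hasSum_nat_add_iff' i, Finset.sum_eq_zero, sub_zero]
    · have h2 : (fun k : ℕ => PowerSeries.coeff (k + i) (PowerSeries.X ^ i * q) *
          x (m - ((k + i : ℕ) : ℤ))) = fun k : ℕ => PowerSeries.coeff k q * x (m - i - k) := by
        funext k
        rw [PowerSeries.coeff_X_pow_mul, show m - ((k + i : ℕ) : ℤ) = m - i - k by push_cast; ring]
      rw [h2]
      exact (h (m - i)).hasSum
    · intro j hj
      rw [PowerSeries.coeff_X_pow_mul', if_neg (by simpa using hj), zero_mul]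
  have h2 : HasSum (fun j : ℕ => PowerSeries.coeff j ((p : PowerSeries ℂ) * q) * x (m - j))
      (∑ i ∈ Finset.range (N + 1), p.coeff i * movingAverage q x (m - i)) := by
    have h3 := hasSum_sum (s := Finset.range (N + 1)) fun i _ => (h1 i).mul_left (p.coeff i)
    have h4 : (fun j : ℕ => PowerSeries.coeff j ((p : PowerSeries ℂ) * q) * x (m - j)) =
        fun j : ℕ => ∑ i ∈ Finset.range (N + 1),
          p.coeff i * (PowerSeries.coeff j (PowerSeries.X ^ i * q) * x (m - j)) := by
      funext j
      have h5 : (p : PowerSeries ℂ) = ∑ i ∈ Finset.range (N + 1),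
          PowerSeries.C (p.coeff i) * PowerSeries.X ^ i := by
        conv_lhs => rw [p.as_sum_range_C_mul_X_pow' (Nat.lt_succ_of_le hp)]
        rw [← Polynomial.coeToPowerSeries.ringHom_apply, map_sum]
        simp
      rw [h5, Finset.sum_mul, map_sum, Finset.sum_mul]
      refine Finset.sum_congr rfl fun i _ => ?_
      rw [mul_assoc (PowerSeries.C _), PowerSeries.coeff_C_mul, mul_assoc]
    rw [h4]
    exact h3
  exact h2.tsum_eq.symm

/-! ### Mean square convergence -/

section

variable {Ω : Type u} [MeasurableSpace Ω] {P : Measure Ω}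

lemma inner_toLp_toLp {X Y : Ω → ℂ} (hX : MemLp X 2 P) (hY : MemLp Y 2 P) :
    inner ℂ (hY.toLp Y) (hX.toLp X) = ∫ ω, X ω * star (Y ω) ∂P := by
  rw [L2.inner_def]
  refine integral_congr_ae ?_
  filter_upwards [hX.coeFn_toLp, hY.coeFn_toLp] with ω h1 h2
  rw [h1, h2, RCLike.inner_apply, starRingEnd_apply]

/-- Summable weights and bounded norms give convergence in mean square; an almost everywhere
convergent subsequence identifies the limit with the pointwise sum `Z`. -/
lemma exists_tendsto_toLp {κ : ℕ → ℂ} (hκ : Summable fun k => ‖κ k‖) {X : ℕ → Ω → ℂ}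
    (hX : ∀ k, MemLp (X k) 2 P) {σ : ℝ} (hσ : ∀ k, ‖(hX k).toLp (X k)‖ ≤ σ) {Z : Ω → ℂ}
    (hZ : ∀ᵐ ω ∂P, HasSum (fun k => κ k * X k ω) (Z ω)) :
    ∃ hZ2 : MemLp Z 2 P, Tendsto (fun K => ∑ k ∈ Finset.range K, κ k • (hX k).toLp (X k)) atTop
      (𝓝 (hZ2.toLp Z)) := by
  have hs : Summable fun k => κ k • (hX k).toLp (X k) := by
    refine Summable.of_norm_bounded (hκ.mul_right σ) fun k => ?_
    rw [norm_smul]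
    exact mul_le_mul_of_nonneg_left (hσ k) (norm_nonneg _)
  obtain ⟨S, hS⟩ := hs
  have hlim := hS.tendsto_sum_nat
  obtain ⟨ns, hns, hae⟩ := (tendstoInMeasure_of_tendsto_Lp hlim).exists_seq_tendsto_ae
  have hfin : ∀ᵐ ω ∂P, ∀ K, (∑ k ∈ Finset.range K, κ k • (hX k).toLp (X k) : Lp ℂ 2 P) ω =
      ∑ k ∈ Finset.range K, κ k * X k ω := by
    have h1 : ∀ᵐ ω ∂P, ∀ k, (κ k • (hX k).toLp (X k) : Lp ℂ 2 P) ω = κ k * X k ω := by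
      refine ae_all_iff.2 fun k => ?_
      filter_upwards [Lp.coeFn_smul (κ k) ((hX k).toLp (X k)), (hX k).coeFn_toLp] with ω h2 h3
      rw [h2, Pi.smul_apply, h3, smul_eq_mul]
    refine ae_all_iff.2 fun K => ?_
    filter_upwards [h1, Lp.coeFn_finsetSum (Finset.range K) fun k => κ k • (hX k).toLp (X k)]
      with ω h2 h3
    rw [h3, Finset.sum_apply]
    exact Finset.sum_congr rfl fun k _ => h2 k
  have hSZ : ∀ᵐ ω ∂P, S ω = Z ω := by
    filter_upwards [hae, hfin, hZ] with ω h1 h2 h3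
    simp_rw [h2] at h1
    exact tendsto_nhds_unique h1 (h3.tendsto_sum_nat.comp hns.tendsto_atTop)
  have hZ2 : MemLp Z 2 P := (memLp_congr_ae hSZ).1 (Lp.memLp S)
  refine ⟨hZ2, ?_⟩
  have : hZ2.toLp Z = S := by
    refine Lp.ext ?_
    filter_upwards [hSZ, hZ2.coeFn_toLp] with ω h1 h2
    rw [h1, h2]
  rwa [this]

variable {n : ℕ} {ξ : ℤ → Ω → ℂ} {f : ℝ → ℝ}

/-- Stationarity: the second moment in the structural function does not depend on the base time. -/
lemma HasSpectralDensity.exists_norm_toLp_le (h : HasSpectralDensity n P ξ f) (s : ℤ) :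
    ∃ σ : ℝ, 0 ≤ σ ∧ ∀ m, ‖(h.memLp m s).toLp (increment n ξ m s)‖ ≤ σ := by
  have h1 : ∀ m, ‖(h.memLp m s).toLp (increment n ξ m s)‖ ^ 2 =
      ‖(h.memLp 0 s).toLp (increment n ξ 0 s)‖ ^ 2 := by
    intro m
    have h2 : ∀ m, ((‖(h.memLp m s).toLp (increment n ξ m s)‖ : ℂ)) ^ 2 =
        ∫ ω, increment n ξ (m + 0) s ω * star (increment n ξ m s ω) ∂P := fun m => by
      rw [add_zero, ← inner_toLp_toLp (h.memLp m s) (h.memLp m s), inner_self_eq_norm_sq_to_K]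
      rfl
    have h3 := (h2 m).trans ((h.structural m 0 s s).trans
      ((h2 0).trans (h.structural 0 0 s s)).symm)
    exact_mod_cast h3
  exact ⟨_, norm_nonneg _, fun m => (pow_le_pow_iff_left₀ (norm_nonneg _) (norm_nonneg _)
    two_ne_zero).1 (h1 m).le⟩

/-- On a probability space the first absolute moments of the increments are bounded by their uniform
`L²` norm, so the geometrically weighted series has finite expectation and converges almost surely.
The passage to `ξ` is pathwise. -/
lemma HasSpectralDensity.ae_summable [IsProbabilityMeasure P] (h : HasSpectralDensity n P ξ f)
    {ρ : ℝ} (h0 : 0 < ρ) (h1 : ρ < 1) :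
    ∀ᵐ ω ∂P, ∀ m : ℤ, Summable fun k : ℕ => ρ ^ k * ‖ξ (m - k) ω‖ := by
  obtain ⟨σ, hσ0, hσ⟩ := h.exists_norm_toLp_le 1
  have h2 : ∀ᵐ ω ∂P, ∀ m : ℤ, Summable fun k : ℕ => ρ ^ k * ‖increment n ξ (m - k) 1 ω‖ := by
    refine ae_all_iff.2 fun m => ?_
    have hmeas : ∀ k : ℕ, AEMeasurable (fun ω =>
        ENNReal.ofReal (ρ ^ k * ‖increment n ξ (m - k) 1 ω‖)) P := fun k =>
      ((h.memLp (m - k) 1).1.norm.aemeasurable.const_mul _).ennreal_ofReal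
    have hle : ∀ k : ℕ, ∫⁻ ω, ENNReal.ofReal (ρ ^ k * ‖increment n ξ (m - k) 1 ω‖) ∂P ≤
        ENNReal.ofReal (ρ ^ k * σ) := by
      intro k
      have h3 := h.memLp (m - k) 1
      have h4 : eLpNorm (increment n ξ (m - k) 1) 1 P ≤ ENNReal.ofReal σ := by
        refine (eLpNorm_le_eLpNorm_of_exponent_le one_le_two h3.1).trans ?_
        rw [← ENNReal.ofReal_toReal h3.eLpNorm_ne_top, ← Lp.norm_toLp _ h3]
        exact ENNReal.ofReal_le_ofReal (hσ _)
      rw [eLpNorm_one_eq_lintegral_enorm] at h4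
      simp_rw [ENNReal.ofReal_mul (pow_nonneg h0.le k), ofReal_norm]
      rw [lintegral_const_mul' _ _ ENNReal.ofReal_ne_top]
      gcongr
    have hfin : ∫⁻ ω, ∑' k : ℕ, ENNReal.ofReal (ρ ^ k * ‖increment n ξ (m - k) 1 ω‖) ∂P ≠ ⊤ := by
      rw [lintegral_tsum hmeas]
      refine ne_top_of_le_ne_top ?_ (ENNReal.tsum_le_tsum hle)
      exact ((summable_geometric_of_lt_one h0.le h1).mul_right σ).tsum_ofReal_ne_top
    filter_upwards [ae_lt_top' (AEMeasurable.tsum hmeas) hfin] with ω hω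
    have h5 := ENNReal.summable_toReal hω.ne
    refine h5.congr fun k => ENNReal.toReal_ofReal (by positivity)
  filter_upwards [h2] with ω hω m
  exact summable_of_summable_increment h0 h1 n ξ ω hω m

end

lemma hasSum_increment_movingAverage {Ω : Type u} {n : ℕ} {ξ : ℤ → Ω → ℂ}
    {q : PowerSeries ℂ} {ω : Ω}
    (h : ∀ m : ℤ, Summable fun k : ℕ => PowerSeries.coeff k q * ξ (m - k) ω) (m s : ℤ) :
    HasSum (fun k : ℕ => PowerSeries.coeff k q * increment n ξ (m - k) s ω)
      (increment n (fun m ω => movingAverage q (fun j => ξ j ω) m) m s ω) := by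
  have h1 := hasSum_sum (s := Finset.range (n + 1)) fun l _ =>
    ((h (m - l * s)).hasSum).mul_left ((-1 : ℂ) ^ l * (n.choose l : ℂ))
  have h2 : (fun k : ℕ => PowerSeries.coeff k q * increment n ξ (m - k) s ω) = fun k : ℕ =>
      ∑ l ∈ Finset.range (n + 1), (-1 : ℂ) ^ l * (n.choose l : ℂ) *
        (PowerSeries.coeff k q * ξ (m - l * s - k) ω) := by
    funext k
    rw [increment, Finset.mul_sum]
    refine Finset.sum_congr rfl fun l _ => ?_
    rw [sub_right_comm m (k : ℤ)]
    ring
  rw [h2]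
  exact h1

section

variable {Ω : Type u} [MeasurableSpace Ω] {P : Measure Ω} {n : ℕ} {ξ : ℤ → Ω → ℂ} {f : ℝ → ℝ}
  {q : PowerSeries ℂ} {r : ℝ}

lemma absSummable_of_radius (hr : 1 < r)
    (hq : Summable fun k => ‖PowerSeries.coeff k q‖ * r ^ k) : AbsSummable q :=
  Summable.of_nonneg_of_le (fun _ => norm_nonneg _)
    (fun _ => le_mul_of_one_le_right (norm_nonneg _) (one_le_pow₀ hr.le)) hq

/-- The coefficients of `q` are `O(r^{-k})` with `r > 1`, so weighted path summability with ratio `1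
/ r` suffices. -/
lemma HasSpectralDensity.ae_summable_movingAverage [IsProbabilityMeasure P]
    (h : HasSpectralDensity n P ξ f) (hr : 1 < r)
    (hq : Summable fun k => ‖PowerSeries.coeff k q‖ * r ^ k) :
    ∀ᵐ ω ∂P, ∀ m : ℤ, Summable fun k : ℕ => PowerSeries.coeff k q * ξ (m - k) ω := by
  have hr0 : 0 < r := zero_lt_one.trans hr
  filter_upwards [h.ae_summable (inv_pos.2 hr0) (inv_lt_one_of_one_lt₀ hr)] with ω hω m
  refine Summable.of_norm_bounded ((hω m).mul_left (∑' k, ‖PowerSeries.coeff k q‖ * r ^ k))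
    fun k => ?_
  have h1 : ‖PowerSeries.coeff k q‖ * r ^ k ≤ ∑' k, ‖PowerSeries.coeff k q‖ * r ^ k :=
    hq.le_tsum k fun _ _ => by positivity
  rw [norm_mul, ← mul_assoc]
  gcongr
  rw [inv_pow]
  exact (le_mul_inv_iff₀ (pow_pos hr0 k)).2 h1

/-- The factor multiplying `f` in the structural function, without the exponential. -/
def structFactor (n : ℕ) (s₁ s₂ : ℤ) (t : ℝ) : ℂ :=
  (1 - cis (-(s₁ * t))) ^ n * (1 - cis (s₂ * t)) ^ n / (t : ℂ) ^ (2 * n)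

lemma norm_structFactor_le (n : ℕ) (s₁ s₂ : ℤ) (t : ℝ) :
    ‖structFactor n s₁ s₂ t‖ ≤ |(s₁ : ℝ)| ^ n * |(s₂ : ℝ)| ^ n := by
  have h1 : structFactor n s₁ s₂ t = ((1 - cis (-((s₁ : ℝ) * t))) ^ n / (t : ℂ) ^ n) *
      ((1 - cis (-((-s₂ : ℝ) * t))) ^ n / (t : ℂ) ^ n) := by
    rw [structFactor, div_mul_div_comm, ← pow_add, two_mul, neg_mul, neg_neg]
  rw [h1, norm_mul, ← abs_neg (s₂ : ℝ)]
  exact mul_le_mul (norm_one_sub_cis_pow_div_le _ _ _) (norm_one_sub_cis_pow_div_le _ _ _)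
    (norm_nonneg _) (by positivity)

lemma measurable_structFactor (n : ℕ) (s₁ s₂ : ℤ) : Measurable (structFactor n s₁ s₂) := by
  unfold structFactor
  exact ((by fun_prop : Continuous fun t : ℝ => (1 - cis (-(s₁ * t))) ^ n *
    (1 - cis (s₂ * t)) ^ n).measurable).div
    (by fun_prop : Continuous fun t : ℝ => (t : ℂ) ^ (2 * n)).measurable

lemma integrableOn_structFactor_mul (n : ℕ) (s₁ s₂ : ℤ) (hf : IntegrableOn f freq) :
    IntegrableOn (fun t => structFactor n s₁ s₂ t * (f t : ℂ)) freq :=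
  hf.ofReal.bdd_mul (measurable_structFactor n s₁ s₂).aestronglyMeasurable
    (ae_of_all _ fun t => norm_structFactor_le n s₁ s₂ t)

lemma HasSpectralDensity.structural_eq (h : HasSpectralDensity n P ξ f) (m₀ m s₁ s₂ : ℤ) :
    ∫ ω, increment n ξ (m₀ + m) s₁ ω * star (increment n ξ m₀ s₂ ω) ∂P =
      circMean fun t => cis (m * t) * (structFactor n s₁ s₂ t * (f t : ℂ)) := by
  rw [h.structural, circMean]
  congr 2
  funext t
  rw [structFactor]
  ring

lemma tendsto_circMean {F : ℕ → ℝ → ℂ} {G : ℝ → ℂ} {B : ℝ → ℝ}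
    (hF : ∀ m, AEStronglyMeasurable (F m) (volume.restrict freq)) (hB : IntegrableOn B freq)
    (hb : ∀ m, ∀ᵐ t ∂volume.restrict freq, ‖F m t‖ ≤ B t)
    (hl : ∀ᵐ t ∂volume.restrict freq, Tendsto (fun m => F m t) atTop (𝓝 (G t))) :
    Tendsto (fun m => circMean (F m)) atTop (𝓝 (circMean G)) :=
  (tendsto_integral_of_dominated_convergence B hF hB hb hl).const_mul _

/-- The moving average with the inverse of a canonical factor has spectral density one. -/
lemma HasSpectralDensity.movingAverage [IsProbabilityMeasure P] (h : HasSpectralDensity n P ξ f)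
    (hf : IntegrableOn f freq) (hr : 1 < r)
    (hq : Summable fun k => ‖PowerSeries.coeff k q‖ * r ^ k)
    (hqf : ∀ᵐ t ∂volume.restrict freq, ‖bdry q t‖ ^ 2 * f t = 1) :
    HasSpectralDensity n P (fun m ω => movingAverage q (fun j => ξ j ω) m) fun _ => 1 := by
  have hqs := absSummable_of_radius hr hq
  have hsum := h.ae_summable_movingAverage hr hq
  set ε : ℤ → Ω → ℂ := fun m ω => RobustExtrapolation.movingAverage q (fun j => ξ j ω) m with hε
  have hL : ∀ m s : ℤ, ∃ hZ : MemLp (increment n ε m s) 2 P,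
      Tendsto (fun K => ∑ k ∈ Finset.range K, PowerSeries.coeff k q •
        (h.memLp (m - (k : ℕ)) s).toLp (increment n ξ (m - (k : ℕ)) s)) atTop
        (𝓝 (hZ.toLp (increment n ε m s))) := by
    intro m s
    obtain ⟨σ, -, hσ⟩ := h.exists_norm_toLp_le s
    refine exists_tendsto_toLp hqs.summable (fun k => h.memLp (m - (k : ℕ)) s)
      (fun k => hσ _) ?_
    filter_upwards [hsum] with ω hω
    exact hasSum_increment_movingAverage hω m s
  choose hmem hlim using hL
  refine ⟨fun m => ?_, hmem, fun m s => ?_, fun m₀ m s₁ s₂ => ?_⟩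
  · refine aestronglyMeasurable_of_tendsto_ae atTop
      (f := fun K ω => ∑ k ∈ Finset.range K, PowerSeries.coeff k q * ξ (m - (k : ℕ)) ω)
      (fun K => ?_) ?_
    · exact Finset.aestronglyMeasurable_fun_sum _ fun k _ => (h.measurable _).const_mul _
    · filter_upwards [hsum] with ω hω
      exact (hω m).hasSum.tendsto_sum_nat
  -- The expectation is an inner product with the constant `1`, hence continuous under mean square
  -- limits.
  · have h1 : MemLp (fun _ : Ω => (1 : ℂ)) 2 P := memLp_const 1
    have h2 : ∀ k : ℤ, inner ℂ (h1.toLp _) ((h.memLp k s).toLp (increment n ξ k s)) = 0 := by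
      intro k
      rw [inner_toLp_toLp]
      simpa using h.mean_zero k s
    have h3 := (tendsto_const_nhds (x := h1.toLp _)).inner (𝕜 := ℂ) (hlim m s)
    simp_rw [inner_sum, inner_smul_right, h2, mul_zero, Finset.sum_const_zero] at h3
    have h4 := tendsto_nhds_unique h3 tendsto_const_nhds
    rw [inner_toLp_toLp] at h4
    simpa using h4
  · have h1 := (hlim m₀ s₂).inner (𝕜 := ℂ) (hlim (m₀ + m) s₁)
    rw [inner_toLp_toLp] at h1
    set H : ℝ → ℂ := fun t => structFactor n s₁ s₂ t * (f t : ℂ) with hH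
    have hHi : IntegrableOn H freq := integrableOn_structFactor_mul n s₁ s₂ hf
    set S : ℕ → ℝ → ℂ := fun K t => ∑ k ∈ Finset.range K,
      PowerSeries.coeff k q * cis (-t) ^ k with hS
    have hSle : ∀ K t, ‖S K t‖ ≤ coeffNorm q := fun K t => by
      refine (norm_sum_le _ _).trans ((Finset.sum_le_sum fun k _ =>
        norm_term_le q (norm_cis_le_one _) k).trans ?_)
      exact hqs.summable.sum_le_tsum _ fun _ _ => norm_nonneg _
    have hSc : ∀ K, Continuous (S K) := fun K => by
      simp only [hS]
      fun_prop
    -- For finite sums, filtering in time is multiplication by `S K` in frequency, so the covariance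
    -- acquires the factor `|S K|²`; in the limit it is `|q|²`, which cancels `f`.
    have h2 : ∀ K, inner ℂ (∑ k ∈ Finset.range K, PowerSeries.coeff k q •
        (h.memLp (m₀ - (k : ℕ)) s₂).toLp (increment n ξ (m₀ - (k : ℕ)) s₂))
        (∑ k ∈ Finset.range K, PowerSeries.coeff k q •
        (h.memLp (m₀ + m - (k : ℕ)) s₁).toLp (increment n ξ (m₀ + m - (k : ℕ)) s₁)) =
        circMean fun t => cis (m * t) * (S K t * star (S K t)) * H t := by
      intro K
      have h3 : ∀ k l : ℕ, inner ℂ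
          ((h.memLp (m₀ - l) s₂).toLp (increment n ξ (m₀ - l) s₂))
          ((h.memLp (m₀ + m - k) s₁).toLp (increment n ξ (m₀ + m - k) s₁)) =
          circMean fun t => cis (m * t) * (cis (-t) ^ k * star (cis (-t) ^ l)) * H t := by
        intro k l
        rw [inner_toLp_toLp]
        have h4 := h.structural_eq (m₀ - l) (m - k + l) s₁ s₂
        rw [show m₀ - l + (m - k + l) = m₀ + m - k by ring] at h4
        rw [h4]
        congr 1
        funext t
        rw [star_pow, star_cis, ← cis_nat_mul, ← cis_nat_mul, ← cis_add, ← cis_add]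
        congr 2
        push_cast
        ring
      have h5 : ∀ t, cis (m * t) * (S K t * star (S K t)) * H t =
          ∑ l ∈ Finset.range K, ∑ k ∈ Finset.range K,
            star (PowerSeries.coeff l q) * (PowerSeries.coeff k q *
              (cis (m * t) * (cis (-t) ^ k * star (cis (-t) ^ l)) * H t)) := by
        intro t
        rw [mul_comm (S K t)]
        simp only [hS]
        rw [star_sum, Finset.sum_mul_sum, Finset.mul_sum, Finset.sum_mul]
        refine Finset.sum_congr rfl fun l _ => ?_
        rw [Finset.mul_sum, Finset.sum_mul]
        refine Finset.sum_congr rfl fun k _ => ?_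
        rw [star_mul']
        ring
      have h6 : ∀ k l : ℕ, IntegrableOn (fun t =>
          cis (m * t) * (cis (-t) ^ k * star (cis (-t) ^ l)) * H t) freq := fun k l => by
        refine hHi.bdd_mul (c := 1) (by fun_prop : Continuous fun t : ℝ => cis (m * t) *
          (cis (-t) ^ k * star (cis (-t) ^ l))).aestronglyMeasurable (ae_of_all _ fun t => ?_)
        simp [norm_cis]
      simp_rw [h5]
      rw [circMean_sum _ fun l _ => integrable_finsetSum _ fun k _ =>
        ((h6 k l).const_mul _).const_mul _, sum_inner]
      refine Finset.sum_congr rfl fun l _ => ?_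
      rw [circMean_sum _ fun k _ => ((h6 k l).const_mul _).const_mul _, inner_sum]
      refine Finset.sum_congr rfl fun k _ => ?_
      rw [inner_smul_left, inner_smul_right, h3, circMean_const_mul, circMean_const_mul,
        starRingEnd_apply]
    simp_rw [h2] at h1
    have h7 : Tendsto (fun K => circMean fun t => cis (m * t) * (S K t * star (S K t)) * H t) atTop
        (𝓝 (circMean fun t => cis (m * t) * (bdry q t * star (bdry q t)) * H t)) := by
      refine tendsto_circMean (B := fun t => coeffNorm q ^ 2 * ‖H t‖) (fun K => ?_)
        (hHi.norm.const_mul _) (fun K => ae_of_all _ fun t => ?_) (ae_of_all _ fun t => ?_)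
      · have := hSc K
        exact (by fun_prop : Continuous fun t : ℝ => cis (m * t) *
          (S K t * star (S K t))).aestronglyMeasurable.mul hHi.1
      · rw [norm_mul, norm_mul, norm_cis, one_mul, norm_mul, norm_star, ← sq]
        gcongr
        exact hSle K t
      · have h8 : Tendsto (fun K => S K t) atTop (𝓝 (bdry q t)) :=
          (hqs.hasSum_ev (norm_cis_le_one (-t))).tendsto_sum_nat
        exact ((h8.mul h8.star).const_mul _).mul_const _
    rw [tendsto_nhds_unique h1 h7, circMean]
    congr 1
    refine integral_congr_ae ?_
    filter_upwards [hqf] with t ht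
    have h9 : ((‖bdry q t‖ ^ 2 : ℝ) : ℂ) * (f t : ℂ) = 1 := by
      rw [← Complex.ofReal_mul, ht, Complex.ofReal_one]
    rw [← ofReal_norm_sq]
    simp only [hH, structFactor]
    rw [Complex.ofReal_one]
    linear_combination cis (m * t) * ((1 - cis (-(s₁ * t))) ^ n * (1 - cis (s₂ * t)) ^ n /
      (t : ℂ) ^ (2 * n)) * h9

end

lemma sum_mul_increment {Ω : Type u} (n : ℕ) {M : ℕ} (c : ℕ → ℂ) (ξ : ℤ → Ω → ℂ) (m s : ℤ)
    (ω : Ω) : ∑ j : Fin (M + 1), c j * increment n ξ (m - (j : ℕ)) s ω =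
      ∑ l ∈ Finset.range (n + 1), (-1 : ℂ) ^ l * (n.choose l : ℂ) *
        ∑ j : Fin (M + 1), c j * ξ (m - l * s - (j : ℕ)) ω := by
  simp only [increment, Finset.mul_sum]
  rw [Finset.sum_comm]
  refine Finset.sum_congr rfl fun l _ => Finset.sum_congr rfl fun j _ => ?_
  rw [sub_right_comm m]
  ring

lemma sum_fin_coeff_mul_pow (p : Polynomial ℂ) {N : ℕ} (hp : p.natDegree ≤ N) (z : ℂ) :
    ∑ k : Fin (N + 1), p.coeff k * z ^ (k : ℕ) = p.eval z := by
  rw [Polynomial.eval_eq_sum_range' (Nat.lt_succ_of_le hp),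
    ← Fin.sum_univ_eq_sum_range fun k => p.coeff k * z ^ k]

/-- Take `ε` to be `ξ` filtered by `q = 1 / Φ`. From `Φ γ = θ` one has `θ q = γ`, so the filter `θ`
applied to `ε` equals `γ` applied to `ξ` already before differencing; increments preserve the
identity. -/
lemma IsCanonicalFactor.hasARMARepresentation {n M N : ℕ} {φ : ℕ → ℂ} {f : ℝ → ℝ}
    (h : IsCanonicalFactor φ f) {γ θ : Polynomial ℂ} (hγ : γ.natDegree ≤ M) (hθ : θ.natDegree ≤ N)
    (h0 : γ.coeff 0 = 1) (hz : ∀ z : ℂ, ‖z‖ ≤ 1 → γ.eval z ≠ 0 ∧ θ.eval z ≠ 0 ∧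
      ev (PowerSeries.mk φ) z * γ.eval z = θ.eval z) :
    HasARMARepresentation.{u} n M N φ f := by
  refine ⟨fun j => γ.coeff j, fun k => θ.coeff k, h0, fun z hz1 => ?_, ?_⟩
  · rw [sum_fin_coeff_mul_pow γ hγ, sum_fin_coeff_mul_pow θ hθ, ← ev_mk]
    exact hz z hz1
  · intro Ω _ P _ ξ hξ
    obtain ⟨q, hq, hφq, r, hr, hqr⟩ := h.exists_inverse
    have hθq : (θ : PowerSeries ℂ) * q = γ := by
      have h1 : PowerSeries.mk φ * (γ : PowerSeries ℂ) = θ := by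
        refine (h.absSummable.mul (absSummable_coe γ)).eq_of_ev (absSummable_coe θ) fun z hz1 => ?_
        rw [h.absSummable.ev_mul (absSummable_coe γ) hz1.le, ev_coe, ev_coe]
        exact (hz z hz1.le).2.2
      rw [← h1, mul_right_comm, hφq, one_mul]
    refine ⟨_, hξ.movingAverage h.integrableOn hr hqr ?_, fun m s => ?_⟩
    · filter_upwards [h.density_bdry] with t ht
      rw [ht, ← mul_pow, ← norm_mul, mul_comm,
        bdry_mul_bdry_inverse h.absSummable hq hφq, norm_one, one_pow]
    · filter_upwards [hξ.ae_summable_movingAverage hr hqr] with ω hω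
      have h2 : ∀ m : ℤ, ∑ j : Fin (M + 1), γ.coeff j * ξ (m - (j : ℕ)) ω =
          ∑ k : Fin (N + 1), θ.coeff k *
            movingAverage q (fun j => ξ j ω) (m - (k : ℕ)) := by
        intro m
        have h3 := sum_mul_movingAverage (x := fun j => ξ j ω) hω θ hθ m
        rw [hθq, movingAverage_coe γ hγ] at h3
        rw [Fin.sum_univ_eq_sum_range (fun j : ℕ => γ.coeff j * ξ (m - (j : ℤ)) ω) (M + 1),
          Fin.sum_univ_eq_sum_range (fun k : ℕ => θ.coeff k *
            movingAverage q (fun j => ξ j ω) (m - (k : ℤ))) (N + 1)]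
        exact h3.symm
      have h4 := sum_mul_increment (M := M) n (fun j => γ.coeff j) ξ m s ω
      have h5 := sum_mul_increment (M := N) n (fun k => θ.coeff k)
        (fun m ω => movingAverage q (fun j => ξ j ω) m) m s ω
      exact h4.trans (Eq.trans (Finset.sum_congr rfl fun l _ => by rw [h2]) h5.symm)

/-! ### The two candidates -/

section

variable {n μ N M : ℕ} {a : ℕ → ℂ} {ρ : ℕ → ℝ}

lemma IsRationalSolution.hasARMARepresentation {φ : ℕ → ℂ} {c : ℕ → ℝ} {f : ℝ → ℝ}
    (h : IsRationalSolution n μ N M a ρ φ c f) : HasARMARepresentation.{u} n M N φ f := by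
  obtain ⟨-, h1⟩ := h.ne_zero
  set p : Polynomial ℂ := ∑ k ∈ Finset.range (M + 1),
    Polynomial.C ((if k = 0 then 1 else c k : ℝ) : ℂ) * Polynomial.X ^ k with hp
  -- The numerator of (53) is a polynomial in `e^{it}`. Conjugating its coefficients gives a
  -- polynomial in `e^{-it}` with the same modulus, as needed for comparison with `Φ(e^{-it})`.
  set q : Polynomial ℂ := ∑ k ∈ Finset.range (N + 1),
    Polynomial.C ((c 0 : ℂ) * star (rSeq n μ N a φ k)) * Polynomial.X ^ k with hq
  have hdeg : ∀ (L : ℕ) (e : ℕ → ℂ), (∑ k ∈ Finset.range (L + 1),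
      Polynomial.C (e k) * Polynomial.X ^ k).natDegree ≤ L := fun L e =>
    Polynomial.natDegree_sum_le_of_forall_le _ _ fun k hk =>
      (Polynomial.natDegree_C_mul_X_pow_le _ _).trans (Nat.lt_succ_iff.1 (Finset.mem_range.1 hk))
  have hpe : ∀ t, p.eval (cis (-t)) =
      1 + ∑ k ∈ Finset.Icc 1 M, (c k : ℂ) * cis (-t) ^ k := fun t => by
    rw [one_add_sum_Icc, hp, Polynomial.eval_finsetSum]
    simp
  have hqe : ∀ t, q.eval (cis (-t)) = c 0 * star (rPoly n μ N a φ t) := fun t => by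
    rw [hq, Polynomial.eval_finsetSum, rPoly, star_sum, Finset.mul_sum]
    refine Finset.sum_congr rfl fun k _ => ?_
    rw [Polynomial.eval_mul, Polynomial.eval_C, Polynomial.eval_pow, Polynomial.eval_X, star_mul',
      star_cis, ← cis_nat_mul, mul_assoc, mul_neg]
  have heq : ∀ᵐ t ∂volume.restrict freq,
      ‖bdry (PowerSeries.mk φ) t * p.eval (cis (-t))‖ = ‖q.eval (cis (-t))‖ := by
    filter_upwards [h1, h.form, h.canonical.density_bdry] with t h2 h3 h4
    rw [rationalDensity_eq, h4, eq_div_iff (pow_ne_zero 2 (norm_ne_zero_iff.2 h2))] at h3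
    rw [← pow_left_inj₀ (norm_nonneg _) (norm_nonneg _) two_ne_zero, hpe, hqe, norm_mul, norm_mul,
      norm_star, mul_pow, mul_pow, h3, Complex.norm_real, Real.norm_eq_abs, sq_abs]
  have hp0 : p ≠ 0 := by
    obtain ⟨t, ht⟩ := h1.exists
    rw [← hpe] at ht
    rintro h0
    simp [h0] at ht
  have hq0 : q ≠ 0 := by
    intro h0
    obtain ⟨t, h2, h3⟩ := (h1.and heq).exists
    rw [h0, Polynomial.eval_zero, norm_zero, norm_eq_zero, hpe] at h3
    refine (mul_ne_zero ?_ h2) h3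
    rw [bdry, ev_mk]
    exact h.canonical.zero_free _ (norm_cis_le_one _)
  obtain ⟨γ, θ, hγ, hθ, h0, hz⟩ := h.canonical.exists_zeroFree_quotient hp0 hq0 heq
  exact h.canonical.hasARMARepresentation (hγ.trans (hdeg M _)) (hθ.trans (hdeg N _)) h0 hz

lemma truncate_extend (φ : Fin (N + 1) → ℂ) : truncate N (extend N φ) = φ := by
  funext k
  exact dif_pos k.2

lemma IsMASolution.hasARMARepresentation {φ : Fin (N + 1) → ℂ}
    (h : IsMASolution n μ N M a ρ φ) :
    HasARMARepresentation.{u} n M N (extend N φ) (maDensity N φ) := by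
  set θ : Polynomial ℂ := ∑ k ∈ Finset.range (N + 1),
    Polynomial.C (extend N φ k) * Polynomial.X ^ k with hθ
  have hdeg : θ.natDegree ≤ N := Polynomial.natDegree_sum_le_of_forall_le _ _ fun k hk =>
      (Polynomial.natDegree_C_mul_X_pow_le _ _).trans (Nat.lt_succ_iff.1 (Finset.mem_range.1 hk))
  have hev : ∀ z, ev (PowerSeries.mk (extend N φ)) z = θ.eval z := fun z => by
    rw [ev_mk, tsum_eq_sum (s := Finset.range (N + 1)), hθ, Polynomial.eval_finsetSum]
    · simp
    · intro k hk
      rw [extend, dif_neg (by simpa using hk), zero_mul]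
  refine h.canonical.hasARMARepresentation (γ := 1) (by simp) hdeg (by simp) fun z hz => ?_
  refine ⟨by simp, ?_, by rw [hev, Polynomial.eval_one, mul_one]⟩
  rw [← hev, ev_mk]
  exact h.canonical.zero_free z hz

/-- The product of the reversed `b` with `w_μ φ` vanishes up to order `N`; the second factor has a
nonzero constant term, so it can be divided out formally. -/
lemma bCoef_eq_zero_of_objective_eq_zero (hμ : 1 ≤ μ) {φ : ℕ → ℂ} (hφ : φ 0 ≠ 0)
    (h : objective n μ N a (truncate N φ) = 0) {k : ℕ} (hk : k ≤ N) : bCoef n μ N a k = 0 := by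
  obtain ⟨V, V', -, -, hVV, hW, -⟩ := exists_wSeries n μ hμ
  set G := wSeries n μ * PowerSeries.mk φ with hG
  have hr : ∀ j ≤ N, rSeq n μ N a φ j = 0 := by
    intro j hj
    rw [objective_eq, Finset.sum_eq_zero_iff_of_nonneg fun _ _ => by positivity] at h
    simpa using h j (Finset.mem_range.2 (Nat.lt_succ_of_le hj))
  have hG0 : PowerSeries.constantCoeff G ≠ 0 := by
    have h1 : PowerSeries.constantCoeff V ≠ 0 := fun h0 => by
      have := congrArg PowerSeries.constantCoeff hVV
      simp [h0] at this
    have h2 : PowerSeries.constantCoeff (geomPoly μ) ≠ 0 := by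
      rw [← PowerSeries.coeff_zero_eq_constantCoeff_apply, geomPoly, Polynomial.coeff_coe,
        Polynomial.finsetSum_coeff]
      simp [Polynomial.coeff_X_pow, show μ ≠ 0 by omega]
    rw [hG, hW, map_mul, map_mul, map_pow]
    refine mul_ne_zero (mul_ne_zero (pow_ne_zero _ h2) h1) ?_
    simpa [← PowerSeries.coeff_zero_eq_constantCoeff_apply] using hφ
  have h1 : revSeries N (bCoef n μ N a) * G * G⁻¹ = revSeries N (bCoef n μ N a) := by
    rw [mul_assoc, PowerSeries.mul_inv_cancel G hG0, mul_one]
  rw [← coeff_revSeries N (bCoef n μ N a) hk, ← h1, coeff_mul_congr (p' := 0), zero_mul, map_zero]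
  intro i hi
  have h2 := hr (N - i) (Nat.sub_le _ _)
  rw [rSeq, Nat.sub_sub_self (hi.trans (Nat.sub_le _ _))] at h2
  rw [h2, map_zero]

lemma iInf_spectralError_le_zero (hb : ∀ k ≤ N, bCoef n μ N a k = 0) {f : ℝ → ℝ}
    (hf : ∀ᵐ t ∂volume.restrict freq, 0 ≤ f t) : ⨅ c, spectralError n μ N a f c ≤ 0 := by
  refine (ciInf_le (bddBelow_spectralError hf) 0).trans (le_of_eq ?_)
  have h1 : ∀ t, errPoly n μ N a 0 t = 0 := fun t => by
    rw [errPoly, Finsupp.sum_zero_index, sub_zero]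
    refine Finset.sum_eq_zero fun k hk => ?_
    rw [hb k (Nat.lt_succ_iff.1 (Finset.mem_range.1 hk)), zero_mul]
  simp [spectralError, h1]

lemma StrictlyPositive.pos (hρ : StrictlyPositive M ρ) : 0 < ρ 0 := by
  have h := Matrix.PosDef.diag_pos hρ (i := (0 : Fin (M + 1)))
  simpa using h

/-- The extremal value of the objective over the rational solutions is attained by all of them. -/
lemma IsRationalSolution.nuRational_mul (hμ : 1 ≤ μ) (hρ : StrictlyPositive M ρ) {φ : ℕ → ℂ}
    {c : ℕ → ℝ} {f : ℝ → ℝ} (h : IsRationalSolution n μ N M a ρ φ c f) :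
    nuRational n μ N M a ρ * ρ 0 = objective n μ N a (truncate N φ) := by
  have h1 : {v | ∃ φ c f, IsRationalSolution n μ N M a ρ φ c f ∧
      v = objective n μ N a (truncate N φ)} = {objective n μ N a (truncate N φ)} := by
    ext v
    constructor
    · rintro ⟨φ', c', f', h', rfl⟩
      exact h'.objective_eq hμ h
    · rintro rfl
      exact ⟨φ, c, f, h, rfl⟩
  rw [nuRational, h1, csSup_singleton, div_mul_cancel₀ _ hρ.pos.ne']

lemma nuRational_eq_zero (h : ∀ φ c f, ¬ IsRationalSolution n μ N M a ρ φ c f) :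
    nuRational n μ N M a ρ = 0 := by
  have h1 : {v | ∃ φ c f, IsRationalSolution n μ N M a ρ φ c f ∧
      v = objective n μ N a (truncate N φ)} = ∅ := by
    ext v
    simp only [Set.mem_ofPred_eq, Set.mem_empty_iff_false, iff_false]
    rintro ⟨φ, c, f, h', -⟩
    exact h φ c f h'
  rw [nuRational, h1, Real.sSup_empty, zero_div]

lemma nuMA_nonneg (hρ : StrictlyPositive M ρ) : 0 ≤ nuMA n μ N M a ρ := by
  refine div_nonneg (Real.sSup_nonneg ?_) hρ.pos.le
  rintro _ ⟨φ, -, rfl⟩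
  exact Finset.sum_nonneg fun _ _ => by positivity

/-- If rational solutions exist, their common value bounds all optimal errors and is attained here.
If none exists, the supremum is zero by convention, so the objective is zero, all `b(k)` vanish and
the zero combination of increments is free of error for each density. -/
lemma IsMASolution.isLeastFavorable (hμ : 1 ≤ μ) (hρ : StrictlyPositive M ρ)
    {φ : Fin (N + 1) → ℂ} (h : IsMASolution n μ N M a ρ φ)
    (hν : nuRational n μ N M a ρ * ρ 0 = objective n μ N a φ) :
    IsLeastFavorable.{u} n μ N a (momentClass M ρ) (maDensity N φ) := by
  refine h.canonical.isFactor.isLeastFavorable hμ h.mem fun g hg => ?_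
  rw [truncate_extend, ← hν]
  by_cases hS : ∃ φ c f, IsRationalSolution n μ N M a ρ φ c f
  · obtain ⟨φ', c', f', h'⟩ := hS
    rw [h'.nuRational_mul hμ hρ]
    exact h'.iInf_spectralError_le hμ hg
  · push Not at hS
    have h0 := nuRational_eq_zero hS
    rw [h0, zero_mul] at hν ⊢
    refine iInf_spectralError_le_zero (fun k hk => ?_) hg.2.1
    refine bCoef_eq_zero_of_objective_eq_zero hμ (φ := extend N φ) ?_
      (by rw [truncate_extend, ← hν]) hk
    have h1 := h.canonical.zero_free 0 (by simp)
    rw [← ev_mk, ← coeff_zero_eq_ev, PowerSeries.coeff_mk] at h1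
    exact h1

lemma IsRationalSolution.isExtremal (hμ : 1 ≤ μ) {φ : ℕ → ℂ}
    {c : ℕ → ℝ} {f : ℝ → ℝ} (h : IsRationalSolution n μ N M a ρ φ c f) :
    IsExtremal n μ N a (momentClass M ρ) φ :=
  ⟨⟨f, h.mem, h.canonical.isFactor⟩, fun _ _ hg hψ =>
    (le_ciInf fun c => objective_le_spectralError hμ hψ c).trans (h.iInf_spectralError_le hμ hg)⟩

end

end

end RobustExtrapolation

/-! ### The main theorem -/

open RobustExtrapolation

theorem theorem6p2 (n μ N M : ℕ) (hn : 1 ≤ n) (hμ : 1 ≤ μ) (a : ℕ → ℂ) (ρ : ℕ → ℝ)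
    (hρ : StrictlyPositive M ρ) :
    (∀ φ : Fin (N + 1) → ℂ, IsMASolution n μ N M a ρ φ →
      nuMA n μ N M a ρ * ρ 0 = nuRational n μ N M a ρ * ρ 0 →
      nuRational n μ N M a ρ * ρ 0 = objective n μ N a φ →
        IsLeastFavorable.{u} n μ N a (momentClass M ρ) (maDensity N φ) ∧
        HasARMARepresentation.{u} n M N (extend N φ) (maDensity N φ)) ∧
    (nuMA n μ N M a ρ < nuRational n μ N M a ρ →
      (∃ φ c f, IsRationalSolution n μ N M a ρ φ c f) ∧
      (∀ φ c f, IsRationalSolution n μ N M a ρ φ c f →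
        IsLeastFavorable.{u} n μ N a (momentClass M ρ) f ∧
        objective n μ N a (truncate N φ) = nuRational n μ N M a ρ * ρ 0 ∧
        HasARMARepresentation.{u} n M N φ f) ∧
      (∀ φ f, IsCanonicalFactor φ f →
        (IsLeastFavorable.{u} n μ N a (momentClass M ρ) f ↔
          ∃ c, IsRationalSolution n μ N M a ρ φ c f) ∧
        (IsLeastFavorable.{u} n μ N a (momentClass M ρ) f ↔
          f ∈ momentClass M ρ ∧ IsExtremal n μ N a (momentClass M ρ) φ))) := by
  refine ⟨fun φ h _ hν => ⟨h.isLeastFavorable hμ hρ hν, h.hasARMARepresentation⟩, fun hlt => ?_⟩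
  -- An empty `S⁺` would give `ν₀⁺ = 0`, while `ν₀` is never negative.
  have hS : ∃ φ c f, IsRationalSolution n μ N M a ρ φ c f := by
    by_contra hS
    push Not at hS
    rw [nuRational_eq_zero hS] at hlt
    exact hlt.not_ge (nuMA_nonneg hρ)
  refine ⟨hS, fun φ c f h => ⟨h.isLeastFavorable hμ, (h.nuRational_mul hμ hρ).symm,
    h.hasARMARepresentation⟩, fun φ f hφ => ?_⟩
  obtain ⟨φ₀, c₀, f₀, h₀⟩ := hS
  have h1 : IsLeastFavorable.{u} n μ N a (momentClass M ρ) f ↔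
      ∃ c, IsRationalSolution n μ N M a ρ φ c f :=
    ⟨fun hl => ⟨c₀, hl.isRationalSolution hμ h₀ hφ⟩, fun ⟨_, h⟩ => h.isLeastFavorable hμ⟩
  refine ⟨h1, fun hl => ⟨hl.1, ?_⟩, fun ⟨hf, _, hmax⟩ => ?_⟩
  · obtain ⟨c, h⟩ := h1.1 hl
    exact h.isExtremal hμ
  -- The value at `φ₀` bounds all optimal errors over the class, and the extremal `φ` does at least
  -- as well.
  · exact hφ.isFactor.isLeastFavorable hμ hf fun g hg =>
      (h₀.iInf_spectralError_le hμ hg).trans (hmax φ₀ f₀ h₀.mem h₀.canonical.isFactor)
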